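/- Let $H^2(\mathbb{D}^2)$ be the Hardy space of the bidisk and let $\theta$ be a rational inner function on $\mathbb{D}^2$: a bounded holomorphic function on $\mathbb{D}^2$ that is a quotient of two polynomials and satisfies $|\theta|=1$ almost everywhere on $\mathbb{T}^2$ (in the sense of radial limits). Assume that $\theta$ has no univariate inner factor, that is, $\theta$ is not a product $\varphi\psi$ of inner functions on $\mathbb{D}^2$ with $\varphi$ nonconstant and depending only on $z$ or only on $w$. Let $\mathcal{K}_\theta=H^2(\mathbb{D}^2)\ominus\theta H^2(\mathbb{D}^2)$, let $S_z=P_{\mathcal{K}_\theta}M_z|_{\mathcal{K}_\theta}$ be the compression to $\mathcal{K}_\theta$ of multiplication by $z$, put $\Omega=\sigma(S_z)\setminus\sigma_e(S_z)$ and let $\Omega^*=\{\bar\lambda:\lambda\in\Omega\}$, with connected components $\Omega^*_i$. Then $S_z^*$ is a generalized Cowen--Douglas operator over $\Omega^*$: the set $\Omega^*$ is bounded and open, $\operatorname{Ran}(S_z^*-c)=\mathcal{K}_\theta$ for every $c\in\Omega^*$, the closed linear span of the spaces $\operatorname{Ker}(S_z^*-c)$, $c\in\Omega^*$, is $\mathcal{K}_\theta$,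 and $\dim\operatorname{Ker}(S_z^*-c)$ is finite, positive and constant on each $\Omega^*_i$. Moreover, $S_z$ is reducible (it has a closed subspace different from $\{0\}$ and $\mathcal{K}_\theta$ that is invariant under $S_z$ and $S_z^*$) if and only if its kernel bundle $E=E_{S_z^*}$ over $\Omega^*$, with fibres $E(c)=\operatorname{Ker}(S_z^*-c)$, is strictly reducible. Here a reducing decomposition $E=E^1\oplus E^2$ consists of two holomorphic subbundles $E^1,E^2$ of $E$ over $\Omega^*$ (the rank may differ between components), each different from the zero bundle and from $E$, such that $E^1(c)\oplus E^2(c)=E(c)$ for all $c\in\Omega^*$ and $E^1(c)\perp E^2(c')$ for all $c,c'\in\Omega^*$, including points of different components. The bundle $E$ is reducible if it has a reducing decomposition, and strictly reducible if it is reducible and, for every reducing decomposition $E=E^1\oplus E^2$ and every $i$, the restriction of $E^1$ to $\Omega^*_i$ is neither the zero bundle nor the restriction of $E$. -/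

import Mathlib

open Filter Topology MeasureTheory
open scoped ComplexConjugate InnerProductSpace lp Polynomial.Bivariate

noncomputable section

namespace Bidisk

/-- The open unit bidisk `𝔻²`. -/
def bidisk : Set (ℂ × ℂ) := Metric.ball 0 1 ×ˢ Metric.ball 0 1

/-! ### The Hardy space of the bidisk -/

/-- The Hardy space `H²(𝔻²)`: the Hilbert space of power series `∑ a_{mn} z^m w^n` with
square-summable coefficients, an element being given by its coefficients. -/
abbrev H2 : Type := lp (fun _ : ℕ × ℕ => ℂ) 2

/-- The holomorphic function on the bidisk defined by an element of `H²(𝔻²)`. -/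
def H2.toFun (f : H2) (x : ℂ × ℂ) : ℂ := ∑' k : ℕ × ℕ, f k * (x.1 ^ k.1 * x.2 ^ k.2)

theorem H2.summable (f : H2) {x : ℂ × ℂ} (hx : x ∈ bidisk) :
    Summable fun k : ℕ × ℕ => f k * (x.1 ^ k.1 * x.2 ^ k.2) := by
  obtain ⟨h1, h2⟩ := hx
  rw [mem_ball_zero_iff] at h1 h2
  have hs : Summable fun k : ℕ × ℕ => ‖x.1‖ ^ k.1 * ‖x.2‖ ^ k.2 :=
    (summable_geometric_of_lt_one (norm_nonneg _) h1).mul_of_nonneg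
      (summable_geometric_of_lt_one (norm_nonneg _) h2)
      (fun _ => by positivity) (fun _ => by positivity)
  refine Summable.of_norm_bounded (hs.mul_left ‖f‖) fun k => ?_
  rw [norm_mul, norm_mul, norm_pow, norm_pow]
  exact mul_le_mul_of_nonneg_right (lp.norm_apply_le_norm (by norm_num) f k) (by positivity)

/-- Coefficients of `z · f`. -/
def shiftCoeff (f : ℕ × ℕ → ℂ) : ℕ × ℕ → ℂ
  | (0, _) => 0
  | (m + 1, n) => f (m, n)

theorem hasSum_shiftCoeff (f : H2) :
    HasSum (fun k => ‖shiftCoeff f k‖ ^ (2 : ENNReal).toReal)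
      (‖f‖ ^ (2 : ENNReal).toReal) := by
  have h := lp.hasSum_norm (p := 2) (by norm_num) f
  have hinj : Function.Injective (fun k : ℕ × ℕ => (k.1 + 1, k.2)) := by
    rintro ⟨a, b⟩ ⟨c, d⟩ h
    simpa using h
  refine (hinj.hasSum_iff ?_).mp h
  rintro ⟨m, n⟩ hk
  cases m with
  | zero => simp [shiftCoeff]
  | succ m => exact absurd ⟨(m, n), rfl⟩ hk

/-- Multiplication by the coordinate function `z` on `H²(𝔻²)`. -/
def Mz : H2 →L[ℂ] H2 :=
  LinearMap.mkContinuous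
    { toFun := fun f => ⟨shiftCoeff f, memℓp_gen (hasSum_shiftCoeff f).summable⟩
      map_add' := fun f g => by
        ext ⟨m, n⟩
        cases m with
        | zero => exact (add_zero (0 : ℂ)).symm
        | succ m => rfl
      map_smul' := fun c f => by
        ext ⟨m, n⟩
        cases m <;> simp [shiftCoeff] }
    1 fun f => by
      rw [one_mul]
      refine le_of_eq ?_
      have h1 := lp.hasSum_norm (p := 2) (by norm_num)
        (⟨shiftCoeff f, memℓp_gen (hasSum_shiftCoeff f).summable⟩ : H2)
      have h2 := h1.unique (hasSum_shiftCoeff f)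
      exact (Real.rpow_left_inj (norm_nonneg _) (norm_nonneg _) (by norm_num)).mp h2

/-! ### Inner functions -/

/-- `θ` is an inner function on the bidisk: bounded and holomorphic, with radial boundary values
of modulus one almost everywhere on the torus. -/
structure IsInner (θ : ℂ × ℂ → ℂ) : Prop where
  holomorphic : DifferentiableOn ℂ θ bidisk
  bounded : ∃ C : ℝ, ∀ x ∈ bidisk, ‖θ x‖ ≤ C
  unimodular : ∀ᵐ t : ℝ × ℝ, ∃ c : ℂ, ‖c‖ = 1 ∧
    Tendsto (fun r : ℝ => θ (r * Complex.exp (t.1 * Complex.I), r * Complex.exp (t.2 * Complex.I)))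
      (𝓝[<] 1) (𝓝 c)

/-- A rational inner function: an inner function which on the bidisk is a quotient of two
polynomials, the denominator having no zeros in the bidisk. -/
def IsRationalInner (θ : ℂ × ℂ → ℂ) : Prop :=
  IsInner θ ∧ ∃ p q : ℂ[X][Y], ∀ x ∈ bidisk,
    p.evalEval x.1 x.2 ≠ 0 ∧ θ x = q.evalEval x.1 x.2 / p.evalEval x.1 x.2

/-- On the bidisk, `φ` depends only on `z` or only on `w`. -/
def IsUnivariate (φ : ℂ × ℂ → ℂ) : Prop :=
  (∃ g : ℂ → ℂ, ∀ x ∈ bidisk, φ x = g x.1) ∨ (∃ g : ℂ → ℂ, ∀ x ∈ bidisk, φ x = g x.2)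

/-- `θ` has a nonconstant inner factor that depends on one of the variables only. -/
def HasUnivariateInnerFactor (θ : ℂ × ℂ → ℂ) : Prop :=
  ∃ φ ψ : ℂ × ℂ → ℂ, IsInner φ ∧ IsInner ψ ∧ (∀ x ∈ bidisk, θ x = φ x * ψ x) ∧
    IsUnivariate φ ∧ ¬ ∃ c : ℂ, ∀ x ∈ bidisk, φ x = c

/-! ### The quotient module and the compressed shift -/

/-- The submodule `θ H²(𝔻²)`. -/
def thetaH2 (θ : ℂ × ℂ → ℂ) : Submodule ℂ H2 where
  carrier := {f | ∃ h : H2, ∀ x ∈ bidisk, f.toFun x = θ x * h.toFun x}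
  zero_mem' := ⟨0, fun x _ => by simp [H2.toFun]⟩
  add_mem' := by
    rintro f g ⟨a, ha⟩ ⟨b, hb⟩
    have key : ∀ u v : H2, ∀ x ∈ bidisk, (u + v).toFun x = u.toFun x + v.toFun x := by
      intro u v x hx
      simp only [H2.toFun]
      rw [← (u.summable hx).tsum_add (v.summable hx)]
      exact tsum_congr fun k => by rw [lp.coeFn_add, Pi.add_apply, add_mul]
    exact ⟨a + b, fun x hx => by rw [key f g x hx, key a b x hx, ha x hx, hb x hx, mul_add]⟩
  smul_mem' := by
    rintro c f ⟨a, ha⟩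
    have key : ∀ u : H2, ∀ x, (c • u).toFun x = c * u.toFun x := by
      intro u x
      simp only [H2.toFun]
      rw [← tsum_mul_left]
      exact tsum_congr fun k => by rw [lp.coeFn_smul, Pi.smul_apply, smul_eq_mul, mul_assoc]
    exact ⟨c • a, fun x hx => by rw [key, key, ha x hx]; ring⟩

/-- The Beurling type quotient module `K_θ = H²(𝔻²) ⊖ θ H²(𝔻²)`. -/
abbrev quotientModule (θ : ℂ × ℂ → ℂ) : Submodule ℂ H2 := (thetaH2 θ)ᗮ

/-- The compressed shift `S_z = P M_z |_{K_θ}` on `K_θ`. -/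
def Sz (θ : ℂ × ℂ → ℂ) : quotientModule θ →L[ℂ] quotientModule θ :=
  (quotientModule θ).orthogonalProjectionOnto ∘L Mz ∘L (quotientModule θ).subtypeL

/-! ### Operators, generalized Cowen-Douglas class and kernel bundles -/

section Operators

variable {H : Type*} [NormedAddCommGroup H] [InnerProductSpace ℂ H] [CompleteSpace H]

/-- `T` is reducible: there is a closed subspace, neither zero nor everything, that is invariant
under `T` and under its adjoint. -/
def IsReducible (T : H →L[ℂ] H) : Prop :=
  ∃ M : Submodule ℂ H, IsClosed (M : Set H) ∧ M ≠ ⊥ ∧ M ≠ ⊤ ∧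
    (∀ x ∈ M, T x ∈ M) ∧ ∀ x ∈ M, ContinuousLinearMap.adjoint T x ∈ M

/-- The essential spectrum. -/
def essentialSpectrum (T : H →L[ℂ] H) : Set ℂ :=
  {c | ¬ (T - c • ContinuousLinearMap.id ℂ H).IsFredholm}

/-- The fibre `Ker (T - c)` at `c` of the kernel bundle `E_T`. -/
def kernelBundle (T : H →L[ℂ] H) (c : ℂ) : Submodule ℂ H :=
  (T - c • ContinuousLinearMap.id ℂ H).ker

/-- `T` is a generalized Cowen-Douglas operator over `Ω`, that is, `T ∈ 𝔅_α(Ω)` for some family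
`α` of positive integers indexed by the connected components of `Ω`. -/
structure IsGeneralizedCowenDouglas (Ω : Set ℂ) (T : H →L[ℂ] H) : Prop where
  isOpen : IsOpen Ω
  isBounded : Bornology.IsBounded Ω
  range_eq_top : ∀ c ∈ Ω, (T - c • ContinuousLinearMap.id ℂ H).range = ⊤
  span_eq_top : (⨆ c ∈ Ω, kernelBundle T c).topologicalClosure = ⊤
  dim_constant : ∀ c₀ ∈ Ω, ∃ a : ℕ, 0 < a ∧
    ∀ c ∈ connectedComponentIn Ω c₀, Module.finrank ℂ (kernelBundle T c) = a

/-- The family of subspaces `E c`, `c ∈ Ω`, is a holomorphic subbundle of `Ω × H`: near every point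
of `Ω` it has a holomorphic frame. Its Hermitian metric is the one inherited from `H`. The rank is
constant on each connected component of `Ω` and may differ between components. -/
def IsHolomorphicSubbundle (Ω : Set ℂ) (E : ℂ → Submodule ℂ H) : Prop :=
  ∀ c₀ ∈ Ω, ∃ Δ : Set ℂ, IsOpen Δ ∧ c₀ ∈ Δ ∧ Δ ⊆ Ω ∧
    ∃ (n : ℕ) (s : Fin n → ℂ → H), (∀ i, DifferentiableOn ℂ (s i) Δ) ∧
      ∀ c ∈ Δ, LinearIndependent ℂ (fun i => s i c) ∧
        Submodule.span ℂ (Set.range fun i => s i c) = E c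

/-- `E_T = E¹ ⊕ E²` is a reducing decomposition of the kernel bundle of `T` over `Ω`.
Fibres over all pairs of points, also of different components, have to be orthogonal; equivalently,
the closed spans of `E¹` and `E²` over any two components are orthogonal. -/
structure IsReducingDecomposition (Ω : Set ℂ) (T : H →L[ℂ] H) (E₁ E₂ : ℂ → Submodule ℂ H) :
    Prop where
  holomorphic₁ : IsHolomorphicSubbundle Ω E₁
  holomorphic₂ : IsHolomorphicSubbundle Ω E₂
  disjoint : ∀ c ∈ Ω, E₁ c ⊓ E₂ c = ⊥
  sup_eq : ∀ c ∈ Ω, E₁ c ⊔ E₂ c = kernelBundle T c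
  orthogonal : ∀ c ∈ Ω, ∀ c' ∈ Ω, E₁ c ⟂ E₂ c'
  ne_zero₁ : ¬ ∀ c ∈ Ω, E₁ c = ⊥
  ne_kernelBundle₁ : ¬ ∀ c ∈ Ω, E₁ c = kernelBundle T c
  ne_zero₂ : ¬ ∀ c ∈ Ω, E₂ c = ⊥
  ne_kernelBundle₂ : ¬ ∀ c ∈ Ω, E₂ c = kernelBundle T c

/-- The kernel bundle of `T` over `Ω` is reducible. -/
def KernelBundleReducible (Ω : Set ℂ) (T : H →L[ℂ] H) : Prop :=
  ∃ E₁ E₂ : ℂ → Submodule ℂ H, IsReducingDecomposition Ω T E₁ E₂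

/-- The kernel bundle of `T` over `Ω` is strictly reducible: it is reducible, and in every reducing
decomposition `E_T = E¹ ⊕ E²` the restriction of `E¹` to each connected component of `Ω` is neither
zero nor all of `E_T`. -/
def KernelBundleStrictlyReducible (Ω : Set ℂ) (T : H →L[ℂ] H) : Prop :=
  KernelBundleReducible Ω T ∧
    ∀ E₁ E₂ : ℂ → Submodule ℂ H, IsReducingDecomposition Ω T E₁ E₂ → ∀ c₀ ∈ Ω,
      (¬ ∀ c ∈ connectedComponentIn Ω c₀, E₁ c = ⊥) ∧
      ¬ ∀ c ∈ connectedComponentIn Ω c₀, E₁ c = kernelBundle T c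

end Operators

/-- `Ω* = {conj c : c ∈ Ω}` for `Ω = σ(S_z) \ σ_e(S_z)`, the base of the kernel bundle of `S_z^*`. -/
def baseSet (θ : ℂ × ℂ → ℂ) : Set ℂ :=
  (fun c => conj c) '' (spectrum ℂ (Sz θ) \ essentialSpectrum (Sz θ))

end Bidisk
end

/-!
An element of `Ker (S_z^* - d)` satisfies `(1 - d z) f(z, w) = f(0, w)`, so it is determined by one
function of `w`; in particular `‖d‖ < 1`. Write `θ = q / p` in lowest terms. Since `θ` has no
univariate inner factor, no slice of `q` at a fixed `z` in the disk or at a fixed `w` in the closed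
disk vanishes identically. The first fact gives finite-dimensional kernels and injectivity of
`S_z - c`. By the second, the set of `z` for which `q(z, ·)` vanishes somewhere on the circle has
Hausdorff dimension at most one, so its complement is dense (it is also open).

For `c` in the disk outside that set, `θ(c, ·)` is bounded below near the circle, hence `S_z - c` is
bounded below, `S_z^* - conj c` is onto, and a function orthogonal to `Ker (S_z^* - conj c)` has a
slice at `z = c` divisible by `θ(c, ·)`. If this holds for all such `c`, Cauchy's formula for the
quotient shows that `θ` divides the function in the bidisk, and division by `θ` keeps it in `H²`.
So the kernels span `K_θ`.

Reducing subspaces of `S_z` correspond to reducing decompositions of the kernel bundle: one way by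
transporting a kernel along `(1 - (c - c₀) R)⁻¹`, where the right inverse `R` of `S_z^* - c₀`
commutes with the projection, the other way by taking closed spans. A decomposition cannot be
trivial over a single component: an `f ∈ Ker (S_z^* - d)` orthogonal to all kernels over a nonempty
open set `V` would force each point of `V` outside the exceptional set to be a root of some
`q(·, w)` with `f(0, w) = 0`, and there are only countably many such points.
-/

noncomputable section

namespace Bidisk

section Fredholm

open ContinuousLinearMap (adjoint)

variable {𝕜 E F : Type*} [RCLike 𝕜]
  [NormedAddCommGroup E] [InnerProductSpace 𝕜 E] [CompleteSpace E]

theorem hasRightInverse_of_surjective [NormedAddCommGroup F] [NormedSpace 𝕜 F] [CompleteSpace F]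
    {T : E →L[𝕜] F} (hT : Function.Surjective T) : T.HasRightInverse := by
  have : CompleteSpace T.ker := T.isClosed_ker.completeSpace_coe
  have hker : (T ∘L T.kerᗮ.subtypeL).ker = ⊥ := by
    refine LinearMap.ker_eq_bot'.2 fun x hx => Subtype.ext ?_
    have hmem : (x : E) ∈ T.ker ⊓ T.kerᗮ := ⟨hx, x.2⟩
    rwa [Submodule.inf_orthogonal_eq_bot] at hmem
  have hrange : (T ∘L T.kerᗮ.subtypeL).range = ⊤ := by
    refine LinearMap.range_eq_top.2 fun y => ?_
    obtain ⟨x, rfl⟩ := hT y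
    have hproj : T (T.ker.starProjection x) = 0 := Submodule.starProjection_apply_mem T.ker x
    refine ⟨⟨x - T.ker.starProjection x, Submodule.sub_starProjection_mem_orthogonal x⟩, ?_⟩
    change T (x - T.ker.starProjection x) = T x
    rw [map_sub, hproj, sub_zero]
  exact (ContinuousLinearEquiv.ofBijective _ hker hrange).hasRightInverse.of_comp

variable [NormedAddCommGroup F] [InnerProductSpace 𝕜 F] [CompleteSpace F]

theorem surjective_adjoint_iff_hasLeftInverse {T : E →L[𝕜] F} :
    Function.Surjective (adjoint T) ↔ T.HasLeftInverse := by
  constructor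
  · intro hT
    obtain ⟨R, hR⟩ := hasRightInverse_of_surjective hT
    refine ⟨adjoint R, fun x => ext_inner_right 𝕜 fun y => ?_⟩
    rw [ContinuousLinearMap.adjoint_inner_left, ← ContinuousLinearMap.adjoint_inner_right, hR y]
  · rintro ⟨L, hL⟩ x
    refine ⟨adjoint L x, ext_inner_right 𝕜 fun y => ?_⟩
    rw [ContinuousLinearMap.adjoint_inner_left, ContinuousLinearMap.adjoint_inner_left, hL y]

theorem isFredholm_iff_surjective_adjoint {T : E →L[𝕜] F} (hT : Function.Injective T)
    (hcoker : FiniteDimensional 𝕜 (adjoint T).ker) :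
    T.IsFredholm ↔ Function.Surjective (adjoint T) := by
  rw [surjective_adjoint_iff_hasLeftInverse]
  refine ⟨fun h => .of_injective_of_isClosed_range_of_closedComplement_range hT
    h.isClosed_range h.closedComplemented_range, fun h => ?_⟩
  have hker : T.ker = ⊥ := LinearMap.ker_eq_bot.2 hT
  have : CompleteSpace T.range := h.isClosed_range.completeSpace_coe
  have hfg : T.rangeᗮ.FG := by
    rw [ContinuousLinearMap.orthogonal_range]
    exact Module.Finite.iff_fg.1 hcoker
  exact
    { isStrictMap := (h.leftInverse_leftInverse.isEmbedding h.leftInverse.continuous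
        T.continuous).isStrictMap
      isClosed_range := h.isClosed_range
      finite_ker := by rw [hker]; infer_instance
      finite_coker := hfg.cofg_of_isCompl (Submodule.isCompl_orthogonal _).symm
      closedComplemented_ker := by rw [hker]; exact Submodule.closedComplemented_bot }

theorem surjective_adjoint_of_antilipschitzWith {T : E →L[𝕜] F} {K : NNReal}
    (hT : AntilipschitzWith K T) : Function.Surjective (adjoint T) := by
  have hclosed : IsClosed (T.range : Set F) := hT.isClosed_range T.uniformContinuous
  have : CompleteSpace T.range := hclosed.completeSpace_coe
  exact surjective_adjoint_iff_hasLeftInverse.2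
    (.of_injective_of_isClosed_range_of_closedComplement_range hT.injective hclosed
      (Submodule.isTopCompl_orthogonal _).closedComplemented)

end Fredholm

section CowenDouglas

open ContinuousLinearMap (adjoint)

variable {H : Type*} [NormedAddCommGroup H] [InnerProductSpace ℂ H]

theorem mem_kernelBundle_iff {T : H →L[ℂ] H} {c : ℂ} {x : H} :
    x ∈ kernelBundle T c ↔ T x = c • x := by
  simp [kernelBundle, sub_eq_zero]

theorem adjoint_sub_smul_id [CompleteSpace H] (S : H →L[ℂ] H) (c : ℂ) :
    adjoint (S - c • ContinuousLinearMap.id ℂ H) =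
      adjoint S - conj c • ContinuousLinearMap.id ℂ H := by
  rw [map_sub, map_smulₛₗ, ContinuousLinearMap.adjoint_id]

theorem mem_spectrum_iff [CompleteSpace H] {S : H →L[ℂ] H} {c : ℂ} :
    c ∈ spectrum ℂ S ↔
      ¬ Function.Bijective (adjoint S - conj c • ContinuousLinearMap.id ℂ H) := by
  rw [spectrum.mem_iff, ← IsUnit.neg_iff, neg_sub, Algebra.algebraMap_eq_smul_one,
    ← isUnit_star, ContinuousLinearMap.isUnit_iff_bijective, ← adjoint_sub_smul_id]
  rfl

theorem mem_conj_image_spectrum_diff_essentialSpectrum_iff [CompleteSpace H] {S : H →L[ℂ] H}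
    (hinj : ∀ c : ℂ, Function.Injective (S - c • ContinuousLinearMap.id ℂ H))
    (hfin : ∀ c, FiniteDimensional ℂ (kernelBundle (adjoint S) c)) {c : ℂ} :
    c ∈ (fun c => conj c) '' (spectrum ℂ S \ essentialSpectrum S) ↔
      Function.Surjective (adjoint S - c • ContinuousLinearMap.id ℂ H) ∧
        kernelBundle (adjoint S) c ≠ ⊥ := by
  have hadj : adjoint (S - conj c • ContinuousLinearMap.id ℂ H) =
      adjoint S - c • ContinuousLinearMap.id ℂ H := by
    rw [adjoint_sub_smul_id, Complex.conj_conj]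
  have hfredholm : (S - conj c • ContinuousLinearMap.id ℂ H).IsFredholm ↔
      Function.Surjective (adjoint S - c • ContinuousLinearMap.id ℂ H) := by
    rw [← hadj]
    exact isFredholm_iff_surjective_adjoint (hinj _) (by rw [hadj]; exact hfin c)
  rw [Set.mem_image_iff_of_inverse Complex.conj_conj Complex.conj_conj, Set.mem_sdiff,
    mem_spectrum_iff, Complex.conj_conj, essentialSpectrum, Set.mem_ofPred_eq, not_not, hfredholm,
    Function.Bijective, ne_eq, kernelBundle, LinearMap.ker_eq_bot]
  exact and_comm.trans (and_congr_right fun hsurj => not_congr (and_iff_left hsurj))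

end CowenDouglas

section Frames

theorem exists_rightInverse_commute {A : Type*} [Ring A] {a p r : A} (hp : IsIdempotentElem p)
    (hpa : Commute p a) (har : a * r = 1) : ∃ s, a * s = 1 ∧ Commute p s := by
  have hconj : ∀ e : A, IsIdempotentElem e → Commute e a → a * (e * r * e) = e := fun e he hea => by
    rw [← mul_assoc, ← mul_assoc, ← hea.eq, mul_assoc e, har, mul_one, he.eq]
  refine ⟨p * r * p + (1 - p) * r * (1 - p), ?_, ?_⟩
  · rw [mul_add, hconj p hp hpa, hconj (1 - p) hp.one_sub ((Commute.one_left a).sub_left hpa),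
      add_sub_cancel]
  · rw [commute_iff_eq, mul_add, add_mul]
    simp only [← mul_assoc, hp.eq, hp.mul_one_sub_self, zero_mul]
    simp only [mul_assoc, hp.eq, hp.one_sub_mul_self, mul_zero]

section Pencil

variable {𝕜 A : Type*} [NontriviallyNormedField 𝕜] [NormedRing A] [NormedAlgebra 𝕜 A]

/-- The points `c` at which the pencil `1 - (c - c₀) r` is invertible. If `r` is a right inverse of
`T - c₀`, then over this neighbourhood of `c₀` the pencil identifies `Ker (T - c)` with
`Ker (T - c₀)`. -/
def pencilDomain (r : A) (c₀ : 𝕜) : Set 𝕜 := {c | IsUnit (1 - (c - c₀) • r)}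

theorem mem_pencilDomain_self (r : A) (c₀ : 𝕜) : c₀ ∈ pencilDomain r c₀ := by
  simp [pencilDomain]

theorem sub_smul_one_mul_pencil {t r : A} {c₀ : 𝕜} (h : (t - c₀ • 1) * r = 1) (c : 𝕜) :
    (t - c₀ • 1) * (1 - (c - c₀) • r) = t - c • 1 := by
  rw [mul_sub, mul_one, mul_smul_comm, h, sub_smul]
  abel

theorem sub_smul_one_mul_eq_pencil {t r : A} {c₀ : 𝕜} (h : (t - c₀ • 1) * r = 1) (c : 𝕜) :
    (t - c • 1) * r = 1 - (c - c₀) • r := by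
  rw [← sub_sub_sub_cancel_right t (c • 1) (c₀ • 1), sub_mul, h, ← sub_smul, smul_one_mul]

variable [HasSummableGeomSeries A]

theorem isOpen_pencilDomain (r : A) (c₀ : 𝕜) : IsOpen (pencilDomain r c₀) :=
  Units.isOpen.preimage (by fun_prop)

theorem differentiableOn_inverse_pencil (r : A) (c₀ : 𝕜) :
    DifferentiableOn 𝕜 (fun c => Ring.inverse (1 - (c - c₀) • r)) (pencilDomain r c₀) :=
  have hpencil : DifferentiableOn 𝕜 (fun c => 1 - (c - c₀) • r) (pencilDomain r c₀) := by fun_prop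
  (differentiableOn_inverse (R := A)).comp hpencil fun _ hc => hc

end Pencil

variable {H : Type*} [NormedAddCommGroup H] [InnerProductSpace ℂ H]

section RightInverse

variable {T R P : H →L[ℂ] H} {c₀ c : ℂ} (hTR : (T - c₀ • ContinuousLinearMap.id ℂ H) * R = 1)
include hTR

theorem pencil_apply_mem_kernelBundle_iff {x : H} :
    (1 - (c - c₀) • R) x ∈ kernelBundle T c₀ ↔ x ∈ kernelBundle T c :=
  Eq.congr_left (DFunLike.congr_fun (sub_smul_one_mul_pencil hTR c) x)

theorem surjective_sub_smul_of_mem_pencilDomain (hc : c ∈ pencilDomain R c₀) :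
    Function.Surjective (T - c • ContinuousLinearMap.id ℂ H) := by
  obtain ⟨u, hu⟩ := hc
  have hright : (T - c • ContinuousLinearMap.id ℂ H) * (R * ↑u⁻¹) = 1 := by
    rw [← mul_assoc]
    exact (congrArg (· * _) ((sub_smul_one_mul_eq_pencil hTR c).trans hu.symm)).trans u.mul_inv
  exact fun y => ⟨_, DFunLike.congr_fun hright y⟩

theorem map_inverse_pencil_range_inf_kernelBundle (hPR : Commute P R)
    (hc : c ∈ pencilDomain R c₀) :
    (P.range ⊓ kernelBundle T c₀).map (Ring.inverse (1 - (c - c₀) • R) : H →L[ℂ] H).toLinearMap =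
      P.range ⊓ kernelBundle T c := by
  have hcomm : Commute P (1 - (c - c₀) • R) :=
    (Commute.one_right P).sub_right (hPR.smul_right _)
  have hrange {B : H →L[ℂ] H} (hB : Commute P B) {x : H} (hx : x ∈ P.range) : B x ∈ P.range := by
    obtain ⟨y, rfl⟩ := hx
    exact ⟨B y, DFunLike.congr_fun hB.eq y⟩
  have hmem (x : H) : (1 - (c - c₀) • R) x ∈ kernelBundle T c₀ ↔ x ∈ kernelBundle T c :=
    pencil_apply_mem_kernelBundle_iff hTR
  obtain ⟨u, hu⟩ := hc
  rw [← hu] at hcomm hmem ⊢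
  rw [Ring.inverse_unit]
  have hright (x : H) : (u : H →L[ℂ] H) ((↑u⁻¹ : H →L[ℂ] H) x) = x :=
    DFunLike.congr_fun u.mul_inv x
  refine le_antisymm ?_ fun x hx => ⟨_, ⟨hrange hcomm hx.1, (hmem x).2 hx.2⟩,
    DFunLike.congr_fun u.inv_mul x⟩
  rintro _ ⟨y, hy, rfl⟩
  refine ⟨hrange hcomm.units_inv_right hy.1, (hmem _).1 ?_⟩
  exact (hright y).symm ▸ hy.2

end RightInverse

end Frames

section KernelBundle

variable {H : Type*} [NormedAddCommGroup H] [InnerProductSpace ℂ H]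

theorem ker_inverse_pencil {R : H →L[ℂ] H} {c₀ c : ℂ} (hc : c ∈ pencilDomain R c₀) :
    (Ring.inverse (1 - (c - c₀) • R) : H →L[ℂ] H).toLinearMap.ker = ⊥ := by
  refine LinearMap.ker_eq_bot.2 (Function.LeftInverse.injective
    (g := (1 - (c - c₀) • R : H →L[ℂ] H)) fun x => ?_)
  exact DFunLike.congr_fun (Ring.mul_inverse_cancel _ hc) x

variable [CompleteSpace H]

theorem exists_rightInverse_sub_smul_commute {T P : H →L[ℂ] H} {c₀ : ℂ} (hP : IsIdempotentElem P)
    (hPT : Commute P T) (hsurj : Function.Surjective (T - c₀ • ContinuousLinearMap.id ℂ H)) :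
    ∃ R, (T - c₀ • ContinuousLinearMap.id ℂ H) * R = 1 ∧ Commute P R := by
  obtain ⟨R, hR⟩ := hasRightInverse_of_surjective hsurj
  exact exists_rightInverse_commute hP (hPT.sub_right ((Commute.one_right P).smul_right c₀))
    (ContinuousLinearMap.ext hR)

theorem isHolomorphicSubbundle_range_inf_kernelBundle {T P : H →L[ℂ] H} {Ω : Set ℂ}
    (hΩ : IsOpen Ω) (hsurj : ∀ c ∈ Ω, Function.Surjective (T - c • ContinuousLinearMap.id ℂ H))
    (hfin : ∀ c ∈ Ω, FiniteDimensional ℂ (kernelBundle T c)) (hP : IsIdempotentElem P)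
    (hPT : Commute P T) : IsHolomorphicSubbundle Ω fun c => P.range ⊓ kernelBundle T c := by
  intro c₀ hc₀
  obtain ⟨R, hTR, hPR⟩ := exists_rightInverse_sub_smul_commute hP hPT (hsurj c₀ hc₀)
  have := hfin c₀ hc₀
  have : FiniteDimensional ℂ ↥(P.range ⊓ kernelBundle T c₀) :=
    Submodule.finiteDimensional_of_le inf_le_right
  let b := Module.finBasis ℂ ↥(P.range ⊓ kernelBundle T c₀)
  refine ⟨pencilDomain R c₀ ∩ Ω, (isOpen_pencilDomain R c₀).inter hΩ,
    ⟨mem_pencilDomain_self R c₀, hc₀⟩, Set.inter_subset_right, _,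
    fun i c => (Ring.inverse (1 - (c - c₀) • R) : H →L[ℂ] H) (b i), fun i => ?_,
    fun c hc => ⟨?_, ?_⟩⟩
  · exact ((differentiableOn_inverse_pencil R c₀).mono Set.inter_subset_left).clm_apply
      (differentiableOn_const _)
  · exact (b.linearIndependent.map' _ (Submodule.ker_subtype _)).map' _ (ker_inverse_pencil hc.1)
  · have hspan := congrArg (Submodule.map (Submodule.subtype _)) b.span_eq
    rw [Submodule.map_subtype_top] at hspan
    have hmap := congrArg (Submodule.map
      (Ring.inverse (1 - (c - c₀) • R) : H →L[ℂ] H).toLinearMap) hspan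
    rw [Submodule.map_span, Submodule.map_span, ← Set.range_comp, ← Set.range_comp,
      map_inverse_pencil_range_inf_kernelBundle hTR hPR hc.1] at hmap
    exact hmap

theorem eventually_surjective_and_finrank_kernelBundle_eq {T : H →L[ℂ] H} {c₀ : ℂ}
    (hsurj : Function.Surjective (T - c₀ • ContinuousLinearMap.id ℂ H)) :
    ∀ᶠ c : ℂ in 𝓝 c₀, Function.Surjective (T - c • ContinuousLinearMap.id ℂ H) ∧
      Module.finrank ℂ (kernelBundle T c) = Module.finrank ℂ (kernelBundle T c₀) := by
  obtain ⟨R, hTR, hPR⟩ :=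
    exists_rightInverse_sub_smul_commute .one (Commute.one_left T) hsurj
  filter_upwards [(isOpen_pencilDomain R c₀).mem_nhds (mem_pencilDomain_self R c₀)] with c hc
  refine ⟨surjective_sub_smul_of_mem_pencilDomain hTR hc, ?_⟩
  have hmap := map_inverse_pencil_range_inf_kernelBundle hTR hPR hc
  have htop : (1 : H →L[ℂ] H).range = ⊤ := LinearMap.range_id
  rw [htop, top_inf_eq, top_inf_eq] at hmap
  rw [← hmap]
  exact (Submodule.equivMapOfInjective _ (LinearMap.ker_eq_bot.1 (ker_inverse_pencil hc))
    _).finrank_eq.symm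

theorem isGeneralizedCowenDouglas_of_mem_iff {T : H →L[ℂ] H} {Ω : Set ℂ}
    (hmem : ∀ c, c ∈ Ω ↔ Function.Surjective (T - c • ContinuousLinearMap.id ℂ H) ∧
      kernelBundle T c ≠ ⊥)
    (hbounded : Bornology.IsBounded Ω) (hfin : ∀ c ∈ Ω, FiniteDimensional ℂ (kernelBundle T c))
    (hspan : (⨆ c ∈ Ω, kernelBundle T c).topologicalClosure = ⊤) :
    IsGeneralizedCowenDouglas Ω T := by
  have hrank : ∀ c₀ ∈ Ω, 0 < Module.finrank ℂ (kernelBundle T c₀) := fun c₀ hc₀ => by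
    have := hfin c₀ hc₀
    exact Module.finrank_pos_iff.2 (Submodule.nontrivial_iff_ne_bot.2 ((hmem c₀).1 hc₀).2)
  have hlocal := fun c₀ hc₀ => eventually_surjective_and_finrank_kernelBundle_eq
    ((hmem c₀).1 hc₀).1
  refine ⟨isOpen_iff_mem_nhds.2 fun c₀ hc₀ => ?_, hbounded,
    fun c hc => LinearMap.range_eq_top.2 ((hmem c).1 hc).1, hspan,
    fun c₀ hc₀ => ⟨_, hrank c₀ hc₀, fun c hc => ?_⟩⟩
  · filter_upwards [hlocal c₀ hc₀] with c hc
    refine (hmem c).2 ⟨hc.1, fun hbot => (hrank c₀ hc₀).ne' ?_⟩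
    rw [← hc.2, hbot, finrank_bot]
  · have hcont : ContinuousOn (fun c => Module.finrank ℂ (kernelBundle T c)) Ω := fun c hc =>
      ContinuousAt.continuousWithinAt
        (continuousAt_const.congr ((hlocal c hc).mono fun _ h => h.2.symm))
    exact isPreconnected_connectedComponentIn.constant
      (hcont.mono (connectedComponentIn_subset Ω c₀)) hc (mem_connectedComponentIn hc₀)

end KernelBundle

section Reducibility

open ContinuousLinearMap (adjoint)

variable {H : Type*} [NormedAddCommGroup H] [InnerProductSpace ℂ H]

/-- The closed linear span of the fibres of the bundle `E` over `Ω`. -/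
def bundleSpan (Ω : Set ℂ) (E : ℂ → Submodule ℂ H) : Submodule ℂ H :=
  (⨆ c ∈ Ω, E c).topologicalClosure

variable {Ω : Set ℂ} {E E' : ℂ → Submodule ℂ H}

theorem le_bundleSpan {c : ℂ} (hc : c ∈ Ω) : E c ≤ bundleSpan Ω E :=
  (le_biSup E hc).trans (Submodule.le_topologicalClosure _)

theorem bundleSpan_le {N : Submodule ℂ H} (hN : IsClosed (N : Set H)) (h : ∀ c ∈ Ω, E c ≤ N) :
    bundleSpan Ω E ≤ N :=
  Submodule.topologicalClosure_minimal _ (iSup₂_le h) hN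

theorem apply_mem_bundleSpan {T : H →L[ℂ] H} (hE : ∀ c ∈ Ω, E c ≤ kernelBundle T c) :
    ∀ x ∈ bundleSpan Ω E, T x ∈ bundleSpan Ω E := by
  have hclosed : IsClosed ((bundleSpan Ω E).comap T.toLinearMap : Set H) :=
    (Submodule.isClosed_topologicalClosure _).preimage T.continuous
  refine bundleSpan_le hclosed fun c hc x hx => ?_
  change T x ∈ bundleSpan Ω E
  rw [mem_kernelBundle_iff.1 (hE c hc hx)]
  exact Submodule.smul_mem _ c (le_bundleSpan hc hx)

theorem isOrtho_bundleSpan (h : ∀ c ∈ Ω, ∀ c' ∈ Ω, E c ⟂ E' c') :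
    bundleSpan Ω E ⟂ bundleSpan Ω E' := by
  refine bundleSpan_le (Submodule.isClosed_orthogonal _) fun c hc => ?_
  refine (Submodule.IsOrtho.symm ?_).le
  exact bundleSpan_le (Submodule.isClosed_orthogonal _) fun c' hc' => (h c hc c' hc').symm

variable [CompleteSpace H] {S : H →L[ℂ] H}

theorem adjoint_apply_mem_orthogonal {M : Submodule ℂ H} (hM : ∀ x ∈ M, S x ∈ M) :
    ∀ x ∈ Mᗮ, adjoint S x ∈ Mᗮ := fun x hx u hu => by
  rw [ContinuousLinearMap.adjoint_inner_right]
  exact hx _ (hM u hu)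

theorem bundleSpan_eq_orthogonal_of_isReducingDecomposition {T : H →L[ℂ] H}
    (hspan : bundleSpan Ω (kernelBundle T) = ⊤) (h : IsReducingDecomposition Ω T E E') :
    bundleSpan Ω E = (bundleSpan Ω E')ᗮ := by
  have horth : bundleSpan Ω E ≤ (bundleSpan Ω E')ᗮ := isOrtho_bundleSpan h.orthogonal
  have : CompleteSpace (bundleSpan Ω E) :=
    (Submodule.isClosed_topologicalClosure _).completeSpace_coe
  have hdense : (bundleSpan Ω E ⊔ bundleSpan Ω E')ᗮ = ⊥ := by
    rw [← Submodule.topologicalClosure_eq_top_iff, eq_top_iff, ← hspan]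
    refine bundleSpan_le (Submodule.isClosed_topologicalClosure _) fun c hc => ?_
    rw [← h.sup_eq c hc]
    exact (sup_le_sup (le_bundleSpan hc) (le_bundleSpan hc)).trans
      (Submodule.le_topologicalClosure _)
  have hdecomp := Submodule.sup_orthogonal_inf_of_hasOrthogonalProjection horth
  rwa [Submodule.inf_orthogonal, hdense, sup_bot_eq] at hdecomp

theorem isReducible_of_kernelBundleReducible
    (hspan : bundleSpan Ω (kernelBundle (adjoint S)) = ⊤)
    (h : KernelBundleReducible Ω (adjoint S)) : IsReducible S := by
  obtain ⟨E₁, E₂, hE⟩ := h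
  have heq := bundleSpan_eq_orthogonal_of_isReducingDecomposition hspan hE
  have hinv₁ := apply_mem_bundleSpan fun c hc => hE.sup_eq c hc ▸ le_sup_left
  have hinv₂ := apply_mem_bundleSpan fun c hc => hE.sup_eq c hc ▸ le_sup_right
  refine ⟨bundleSpan Ω E₁, Submodule.isClosed_topologicalClosure _, fun hbot => ?_, fun htop => ?_,
    ?_, hinv₁⟩
  · exact hE.ne_zero₁ fun c hc => eq_bot_iff.2 (hbot ▸ le_bundleSpan hc)
  · rw [heq, Submodule.orthogonal_eq_top_iff] at htop
    exact hE.ne_zero₂ fun c hc => eq_bot_iff.2 (htop ▸ le_bundleSpan hc)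
  · rw [heq, ← ContinuousLinearMap.adjoint_adjoint S]
    exact adjoint_apply_mem_orthogonal hinv₂

theorem commute_starProjection_adjoint {M : Submodule ℂ H} [M.HasOrthogonalProjection]
    (hM : ∀ x ∈ M, S x ∈ M) (hM' : ∀ x ∈ M, adjoint S x ∈ M) :
    Commute M.starProjection (adjoint S) := by
  refine (ContinuousLinearMap.IsIdempotentElem.commute_iff M.isIdempotentElem_starProjection).2
    ⟨?_, ?_⟩
  · rw [Submodule.range_starProjection]
    exact hM'
  · rw [Submodule.ker_starProjection]
    exact adjoint_apply_mem_orthogonal hM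

omit [CompleteSpace H] in
theorem inf_kernelBundle_sup_orthogonal_inf_kernelBundle {T : H →L[ℂ] H} {M : Submodule ℂ H}
    [M.HasOrthogonalProjection] (hMT : Commute M.starProjection T) (c : ℂ) :
    (M ⊓ kernelBundle T c) ⊔ (Mᗮ ⊓ kernelBundle T c) = kernelBundle T c := by
  refine le_antisymm (sup_le inf_le_right inf_le_right) fun x hx => ?_
  have hproj : M.starProjection x ∈ kernelBundle T c := by
    rw [mem_kernelBundle_iff] at hx ⊢
    have h := DFunLike.congr_fun hMT.eq x
    change M.starProjection (T x) = T (M.starProjection x) at h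
    rw [← h, hx, map_smul]
  rw [← add_sub_cancel (M.starProjection x) x]
  exact Submodule.add_mem_sup ⟨Submodule.starProjection_apply_mem M x, hproj⟩
    ⟨Submodule.sub_starProjection_mem_orthogonal x, Submodule.sub_mem _ hx hproj⟩

theorem kernelBundleReducible_of_isReducible (hΩ : IsOpen Ω)
    (hsurj : ∀ c ∈ Ω, Function.Surjective (adjoint S - c • ContinuousLinearMap.id ℂ H))
    (hfin : ∀ c ∈ Ω, FiniteDimensional ℂ (kernelBundle (adjoint S) c))
    (hspan : bundleSpan Ω (kernelBundle (adjoint S)) = ⊤)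
    (h : IsReducible S) : KernelBundleReducible Ω (adjoint S) := by
  obtain ⟨M, hclosed, hbot, htop, hMS, hMT⟩ := h
  have : CompleteSpace M := hclosed.completeSpace_coe
  have hcomm := commute_starProjection_adjoint hMS hMT
  have hcomm' : Commute Mᗮ.starProjection (adjoint S) := by
    rw [Submodule.starProjection_orthogonal']
    exact (Commute.one_left _).sub_left hcomm
  have hsup := inf_kernelBundle_sup_orthogonal_inf_kernelBundle hcomm
  have hsubbundle (N : Submodule ℂ H) [N.HasOrthogonalProjection]
      (hN : Commute N.starProjection (adjoint S)) :
      IsHolomorphicSubbundle Ω fun c => N ⊓ kernelBundle (adjoint S) c := by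
    simpa only [Submodule.range_starProjection] using isHolomorphicSubbundle_range_inf_kernelBundle
      hΩ hsurj hfin N.isIdempotentElem_starProjection hN
  have htotal {N : Submodule ℂ H} (hN : IsClosed (N : Set H))
      (h : ∀ c ∈ Ω, kernelBundle (adjoint S) c ≤ N) : N = ⊤ :=
    eq_top_iff.2 (hspan ▸ bundleSpan_le hN h)
  have hM : ¬ ∀ c ∈ Ω, kernelBundle (adjoint S) c ≤ M := fun h => htop (htotal hclosed h)
  have hM' : ¬ ∀ c ∈ Ω, kernelBundle (adjoint S) c ≤ Mᗮ := fun h =>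
    hbot ((Submodule.orthogonal_eq_top_iff M).1 (htotal (Submodule.isClosed_orthogonal M) h))
  exact ⟨_, _,
    { holomorphic₁ := hsubbundle M hcomm
      holomorphic₂ := hsubbundle Mᗮ hcomm'
      disjoint := fun c _ => (M.orthogonal_disjoint.mono inf_le_left inf_le_left).eq_bot
      sup_eq := fun c _ => hsup c
      orthogonal := fun c _ c' _ =>
        (Submodule.isOrtho_orthogonal_right M).mono inf_le_left inf_le_left
      ne_zero₁ := fun h => hM' fun c hc => inf_eq_right.1 <| by
        simpa only [h c hc, bot_sup_eq] using hsup c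
      ne_kernelBundle₁ := fun h => hM fun c hc => inf_eq_right.1 (h c hc)
      ne_zero₂ := fun h => hM fun c hc => inf_eq_right.1 <| by
        simpa only [h c hc, sup_bot_eq] using hsup c
      ne_kernelBundle₂ := fun h => hM' fun c hc => inf_eq_right.1 (h c hc) }⟩

omit [CompleteSpace H] in
theorem kernelBundleStrictlyReducible_of_kernelBundleReducible {T : H →L[ℂ] H}
    (hcomp : ∀ c₀ ∈ Ω, ∀ c' ∈ Ω, ∀ f ∈ kernelBundle T c',
      (∀ c ∈ connectedComponentIn Ω c₀, ∀ g ∈ kernelBundle T c, ⟪g, f⟫_ℂ = 0) → f = 0)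
    (h : KernelBundleReducible Ω T) : KernelBundleStrictlyReducible Ω T := by
  refine ⟨h, fun E₁ E₂ hE c₀ hc₀ => ⟨fun hE₁ => hE.ne_zero₁ fun c' hc' => ?_,
    fun hE₁ => hE.ne_zero₂ fun c' hc' => ?_⟩⟩
  · refine eq_bot_iff.2 fun f hf => hcomp c₀ hc₀ c' hc' f
      (hE.sup_eq c' hc' ▸ Submodule.mem_sup_left hf) fun c hc g hg => ?_
    have hcΩ := connectedComponentIn_subset Ω c₀ hc
    rw [← hE.sup_eq c hcΩ, hE₁ c hc, bot_sup_eq] at hg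
    exact Submodule.isOrtho_iff_inner_eq.1 (hE.orthogonal c' hc' c hcΩ).symm g hg f hf
  · refine eq_bot_iff.2 fun f hf => hcomp c₀ hc₀ c' hc' f
      (hE.sup_eq c' hc' ▸ Submodule.mem_sup_right hf) fun c hc g hg => ?_
    have hcΩ := connectedComponentIn_subset Ω c₀ hc
    rw [← hE₁ c hc] at hg
    exact Submodule.isOrtho_iff_inner_eq.1 (hE.orthogonal c hcΩ c' hc') g hg f hf

omit [CompleteSpace H] in
theorem IsGeneralizedCowenDouglas.finiteDimensional_kernelBundle {T : H →L[ℂ] H}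
    (hT : IsGeneralizedCowenDouglas Ω T) {c : ℂ} (hc : c ∈ Ω) :
    FiniteDimensional ℂ (kernelBundle T c) := by
  obtain ⟨a, ha, hdim⟩ := hT.dim_constant c hc
  exact Module.finite_of_finrank_pos (ha.trans_eq (hdim c (mem_connectedComponentIn hc)).symm)

theorem isReducible_iff_kernelBundleStrictlyReducible_adjoint
    (hS : IsGeneralizedCowenDouglas Ω (adjoint S))
    (hcomp : ∀ c₀ ∈ Ω, ∀ c' ∈ Ω, ∀ f ∈ kernelBundle (adjoint S) c',
      (∀ c ∈ connectedComponentIn Ω c₀, ∀ g ∈ kernelBundle (adjoint S) c, ⟪g, f⟫_ℂ = 0) → f = 0) :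
    IsReducible S ↔ KernelBundleStrictlyReducible Ω (adjoint S) :=
  ⟨fun h => kernelBundleStrictlyReducible_of_kernelBundleReducible hcomp
    (kernelBundleReducible_of_isReducible hS.isOpen
      (fun c hc => LinearMap.range_eq_top.1 (hS.range_eq_top c hc))
      (fun _ hc => hS.finiteDimensional_kernelBundle hc) hS.span_eq_top h),
    fun h => isReducible_of_kernelBundleReducible hS.span_eq_top h.1⟩

theorem isGeneralizedCowenDouglas_adjoint
    (hinj : ∀ c : ℂ, Function.Injective (S - c • ContinuousLinearMap.id ℂ H))
    (hfin : ∀ c, FiniteDimensional ℂ (kernelBundle (adjoint S) c))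
    (hspan : bundleSpan ((fun c => conj c) '' (spectrum ℂ S \ essentialSpectrum S))
      (kernelBundle (adjoint S)) = ⊤) :
    IsGeneralizedCowenDouglas ((fun c => conj c) '' (spectrum ℂ S \ essentialSpectrum S))
      (adjoint S) :=
  isGeneralizedCowenDouglas_of_mem_iff
    (fun _ => mem_conj_image_spectrum_diff_essentialSpectrum_iff hinj hfin)
    (Complex.conjLIE.lipschitz.isBounded_image ((spectrum.isBounded S).subset Set.sdiff_subset))
    (fun c _ => hfin c) hspan

end Reducibility

section Parseval

open Complex

theorem hasSum_norm_sq_of_hasSum_smul {ι E : Type*} [NormedAddCommGroup E]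
    [InnerProductSpace ℂ E] {v : ι → E} (hv : Orthonormal ℂ v) {a : ι → ℂ} {x : E}
    (hx : HasSum (fun i => a i • v i) x) : HasSum (fun i => ‖a i‖ ^ 2) (‖x‖ ^ 2) := by
  refine Tendsto.congr (fun s => ?_) (hx.norm.pow 2)
  simp only [norm_sq_eq_re_inner (𝕜 := ℂ), hv.inner_sum, conj_mul', ← ofReal_pow, ← ofReal_sum]
  rfl

theorem hasSum_norm_sq_integral {a : ℕ → ℂ} (ha : Summable fun n => ‖a n‖) :
    HasSum (fun n => 2 * Real.pi * ‖a n‖ ^ 2)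
      (∫ s in (0 : ℝ)..2 * Real.pi, ‖∑' n, a n * exp (n * s * I)‖ ^ 2) := by
  have : Fact (0 < 2 * Real.pi) := ⟨Real.two_pi_pos⟩
  obtain ⟨F, hF⟩ : Summable fun n : ℕ => a n • (fourier n : C(AddCircle (2 * Real.pi), ℂ)) :=
    Summable.of_norm <| ha.congr fun n => by rw [norm_smul, fourier_norm, mul_one]
  have hFs (s : ℝ) : ∑' n, a n * exp (n * s * I) = F s := by
    refine (tsum_congr fun n => ?_).trans
      ((ContinuousMap.evalCLM ℂ (s : AddCircle (2 * Real.pi))).hasSum hF).tsum_eq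
    simp only [ContinuousMap.evalCLM_apply, ContinuousMap.smul_apply, fourier_coe_apply,
      smul_eq_mul]
    have := Real.pi_pos.ne'
    push_cast
    congr 2
    field_simp
  have hnorm := hasSum_norm_sq_of_hasSum_smul
    ((orthonormal_fourier (T := 2 * Real.pi)).comp _ Nat.cast_injective)
    (by simpa using (ContinuousMap.toLp (E := ℂ) 2 AddCircle.haarAddCircle ℂ).hasSum hF)
  have hint : ‖ContinuousMap.toLp (E := ℂ) 2 AddCircle.haarAddCircle ℂ F‖ ^ 2 =
      ∫ t, ‖F t‖ ^ 2 ∂AddCircle.haarAddCircle := by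
    simp only [norm_sq_eq_re_inner (𝕜 := ℂ), ContinuousMap.inner_toLp, mul_conj', ← ofReal_pow,
      integral_complex_ofReal]
    rfl
  have hperiod := AddCircle.intervalIntegral_preimage (2 * Real.pi) 0 fun t => ‖F t‖ ^ 2
  rw [zero_add, AddCircle.volume_eq_smul_haarAddCircle, integral_smul_measure,
    ENNReal.toReal_ofReal Real.two_pi_pos.le, smul_eq_mul] at hperiod
  simp only [hFs]
  rw [hperiod, ← hint]
  exact hnorm.mul_left _

theorem continuous_tsum_mul_exp {a : ℕ → ℂ} (ha : Summable fun n => ‖a n‖) :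
    Continuous fun s : ℝ => ∑' n, a n * exp (n * s * I) :=
  continuous_tsum (fun n => by fun_prop) ha fun n s => by simp [Complex.norm_exp]

theorem tsum_norm_sq_le_of_norm_tsum_le {a b : ℕ → ℂ} {K : ℝ} (ha : Summable fun n => ‖a n‖)
    (hb : Summable fun n => ‖b n‖)
    (h : ∀ t : ℂ, ‖t‖ = 1 → ‖∑' n, a n * t ^ n‖ ≤ K * ‖∑' n, b n * t ^ n‖) :
    ∑' n, ‖a n‖ ^ 2 ≤ K ^ 2 * ∑' n, ‖b n‖ ^ 2 := by
  have hle (s : ℝ) : ‖∑' n, a n * exp (n * s * I)‖ ^ 2 ≤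
      K ^ 2 * ‖∑' n, b n * exp (n * s * I)‖ ^ 2 := by
    have hs := h (exp (s * I)) (norm_exp_ofReal_mul_I s)
    simp only [← exp_nat_mul, ← mul_assoc] at hs
    rw [← mul_pow]
    exact pow_le_pow_left₀ (norm_nonneg _) hs 2
  have hint := intervalIntegral.integral_mono (μ := volume) Real.two_pi_pos.le
    (((continuous_tsum_mul_exp ha).norm.pow 2).intervalIntegrable _ _)
    ((((continuous_tsum_mul_exp hb).norm.pow 2).const_mul _).intervalIntegrable _ _) hle
  simp only [Pi.pow_apply] at hint
  rw [intervalIntegral.integral_const_mul, ← (hasSum_norm_sq_integral ha).tsum_eq,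
    ← (hasSum_norm_sq_integral hb).tsum_eq, tsum_mul_left, tsum_mul_left, mul_left_comm] at hint
  exact le_of_mul_le_mul_left hint Real.two_pi_pos

theorem summable_norm_sq_of_summable_norm {a : ℕ → ℂ} (ha : Summable fun n => ‖a n‖) :
    Summable fun n => ‖a n‖ ^ 2 := by
  have := (hasSum_norm_sq_integral ha).summable
  rwa [summable_mul_left_iff Real.two_pi_pos.ne'] at this

theorem sum_norm_sq_le_of_norm_tsum_le {a b : ℕ → ℂ} {C ρ : ℝ} (hρ : ρ < 1)
    (ha : ∀ r : ℝ, 0 ≤ r → r < 1 → Summable fun n => ‖a n‖ * r ^ n)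
    (hb : ∀ r : ℝ, 0 ≤ r → r < 1 → Summable fun n => ‖b n‖ * r ^ n)
    (hb' : Summable fun n => ‖b n‖ ^ 2)
    (h : ∀ t : ℂ, ρ < ‖t‖ → ‖t‖ < 1 → ‖∑' n, a n * t ^ n‖ ≤ C * ‖∑' n, b n * t ^ n‖)
    (s : Finset ℕ) : ∑ n ∈ s, ‖a n‖ ^ 2 ≤ C ^ 2 * ∑' n, ‖b n‖ ^ 2 := by
  have hlim : Tendsto (fun r : ℝ => ∑ n ∈ s, ‖a n * (r : ℂ) ^ n‖ ^ 2) (𝓝[<] 1)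
      (𝓝 (∑ n ∈ s, ‖a n‖ ^ 2)) := by
    have hcont : Continuous fun r : ℝ => ∑ n ∈ s, ‖a n * (r : ℂ) ^ n‖ ^ 2 := by fun_prop
    simpa using (hcont.tendsto 1).mono_left nhdsWithin_le_nhds
  refine le_of_tendsto hlim ?_
  filter_upwards [Ioo_mem_nhdsLT (max_lt hρ one_pos)] with r hr
  obtain ⟨hρr, hr0⟩ := max_lt_iff.1 hr.1
  have hdil {c : ℕ → ℂ} (hc : Summable fun n => ‖c n‖ * r ^ n) :
      Summable fun n => ‖c n * (r : ℂ) ^ n‖ := by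
    simpa only [norm_mul, norm_pow, norm_real, Real.norm_of_nonneg hr0.le] using hc
  have hA := hdil (ha r hr0.le hr.2)
  have hB := hdil (hb r hr0.le hr.2)
  calc ∑ n ∈ s, ‖a n * (r : ℂ) ^ n‖ ^ 2 ≤ ∑' n, ‖a n * (r : ℂ) ^ n‖ ^ 2 :=
        (summable_norm_sq_of_summable_norm hA).sum_le_tsum s fun n _ => by positivity
    _ ≤ C ^ 2 * ∑' n, ‖b n * (r : ℂ) ^ n‖ ^ 2 := by
        refine tsum_norm_sq_le_of_norm_tsum_le hA hB fun t ht => ?_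
        have hrt : ‖r * t‖ = r := by
          rw [norm_mul, ht, mul_one, norm_real, Real.norm_of_nonneg hr0.le]
        simpa only [mul_pow, mul_assoc] using h (r * t) (hρr.trans_eq hrt.symm) (hrt.trans_lt hr.2)
    _ ≤ C ^ 2 * ∑' n, ‖b n‖ ^ 2 := by
        gcongr with n
        · exact summable_norm_sq_of_summable_norm hB
        · rw [norm_mul, norm_pow, norm_real, Real.norm_of_nonneg hr0.le]
          exact mul_le_of_le_one_right (norm_nonneg _) (pow_le_one₀ hr0.le hr.2.le)

theorem tsum_norm_sq_le_of_eventually_norm_tsum_le {a b : ℕ → ℂ} {C : ℝ}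
    (ha : ∀ r : ℝ, 0 ≤ r → r < 1 → Summable fun n => ‖a n‖ * r ^ n)
    (hb : ∀ r : ℝ, 0 ≤ r → r < 1 → Summable fun n => ‖b n‖ * r ^ n)
    (hb' : Summable fun n => ‖b n‖ ^ 2)
    (h : ∀ ε > 0, ∃ ρ < (1 : ℝ), ∀ t : ℂ, ρ < ‖t‖ → ‖t‖ < 1 →
      ‖∑' n, a n * t ^ n‖ ≤ (C + ε) * ‖∑' n, b n * t ^ n‖) :
    Summable (fun n => ‖a n‖ ^ 2) ∧ ∑' n, ‖a n‖ ^ 2 ≤ C ^ 2 * ∑' n, ‖b n‖ ^ 2 := by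
  have hsum (s : Finset ℕ) : ∑ n ∈ s, ‖a n‖ ^ 2 ≤ C ^ 2 * ∑' n, ‖b n‖ ^ 2 := by
    have hlim : Tendsto (fun ε : ℝ => (C + ε) ^ 2 * ∑' n, ‖b n‖ ^ 2) (𝓝[>] 0)
        (𝓝 (C ^ 2 * ∑' n, ‖b n‖ ^ 2)) := by
      have hcont : Continuous fun ε : ℝ => (C + ε) ^ 2 * ∑' n, ‖b n‖ ^ 2 := by fun_prop
      simpa only [add_zero] using (hcont.tendsto 0).mono_left nhdsWithin_le_nhds
    refine ge_of_tendsto hlim (eventually_mem_nhdsWithin.mono fun ε hε => ?_)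
    obtain ⟨ρ, hρ, hle⟩ := h ε hε
    exact sum_norm_sq_le_of_norm_tsum_le hρ ha hb hb' hle s
  have hsummable := summable_of_sum_le (fun n => by positivity) hsum
  exact ⟨hsummable, hsummable.tsum_le_of_sum_le hsum⟩

end Parseval

section Slices

open Complex
open Finset.HasAntidiagonal (antidiagonal mem_antidiagonal sigmaAntidiagonalEquivProd)

variable {a : ℕ × ℕ → ℂ}

/-- The sum of the double power series with coefficients `a`. -/
def powerSum (a : ℕ × ℕ → ℂ) (x : ℂ × ℂ) : ℂ := ∑' k : ℕ × ℕ, a k * (x.1 ^ k.1 * x.2 ^ k.2)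

/-- Absolute convergence on the bidisk of the double power series with coefficients `a`, tested on
the diagonal points `(r, r)`. -/
def AbsConv (a : ℕ × ℕ → ℂ) : Prop :=
  ∀ r : ℝ, 0 ≤ r → r < 1 → Summable fun k : ℕ × ℕ => ‖a k‖ * r ^ (k.1 + k.2)

theorem AbsConv.summable_norm (ha : AbsConv a) {x : ℂ × ℂ} (hx : x ∈ bidisk) :
    Summable fun k : ℕ × ℕ => ‖a k * (x.1 ^ k.1 * x.2 ^ k.2)‖ := by
  obtain ⟨h1, h2⟩ := hx
  rw [mem_ball_zero_iff] at h1 h2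
  refine Summable.of_nonneg_of_le (fun _ => norm_nonneg _) (fun k => ?_)
    (ha (max ‖x.1‖ ‖x.2‖) (le_max_of_le_left (norm_nonneg _)) (max_lt h1 h2))
  rw [norm_mul, norm_mul, norm_pow, norm_pow, pow_add]
  gcongr
  · exact le_max_left _ _
  · exact le_max_right _ _

theorem absConv_coe (f : H2) : AbsConv f := by
  intro r hr hr1
  have hs : Summable fun k : ℕ × ℕ => r ^ k.1 * r ^ k.2 :=
    (summable_geometric_of_lt_one hr hr1).mul_of_nonneg (summable_geometric_of_lt_one hr hr1)
      (fun _ => by positivity) (fun _ => by positivity)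
  refine Summable.of_nonneg_of_le (fun _ => by positivity) (fun k => ?_) (hs.mul_left ‖f‖)
  rw [pow_add]
  gcongr
  exact lp.norm_apply_le_norm (by norm_num) f k

theorem toFun_eq_powerSum (f : H2) (x : ℂ × ℂ) : f.toFun x = powerSum f x := rfl

/-- The Taylor coefficients of the slice `t ↦ F (t, t e^{iτ})` of the power series `F` with
coefficients `a`. -/
def sliceCoeff (a : ℕ × ℕ → ℂ) (τ : ℝ) (N : ℕ) : ℂ :=
  ∑ k ∈ antidiagonal N, a k * exp (k.2 * τ * I)

theorem norm_sliceCoeff_le (a : ℕ × ℕ → ℂ) (τ : ℝ) (N : ℕ) :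
    ‖sliceCoeff a τ N‖ ≤ ∑ k ∈ antidiagonal N, ‖a k‖ :=
  norm_sum_le_of_le _ fun k _ => by simp [Complex.norm_exp]

theorem AbsConv.summable_norm_sliceCoeff (ha : AbsConv a) (τ : ℝ) {r : ℝ} (hr : 0 ≤ r)
    (hr1 : r < 1) : Summable fun N => ‖sliceCoeff a τ N‖ * r ^ N := by
  have hdiag : Summable fun N => ∑ k ∈ antidiagonal N, ‖a k‖ * r ^ (k.1 + k.2) := by
    refine ((sigmaAntidiagonalEquivProd (A := ℕ)).summable_iff.2 (ha r hr hr1)).sigma.congr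
      fun N => ?_
    rw [tsum_fintype]
    exact Finset.sum_coe_sort (antidiagonal N) fun k => ‖a k‖ * r ^ (k.1 + k.2)
  refine Summable.of_nonneg_of_le (fun _ => by positivity) (fun N => ?_) hdiag
  refine (mul_le_mul_of_nonneg_right (norm_sliceCoeff_le a τ N) (by positivity)).trans_eq ?_
  rw [Finset.sum_mul]
  exact Finset.sum_congr rfl fun k hk => by rw [mem_antidiagonal.1 hk]

theorem mk_mem_bidisk {t : ℂ} (ht : ‖t‖ < 1) (τ : ℝ) : (t, t * exp (τ * I)) ∈ bidisk := by
  refine ⟨mem_ball_zero_iff.2 ht, mem_ball_zero_iff.2 ?_⟩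
  rwa [norm_mul, norm_exp_ofReal_mul_I, mul_one]

theorem AbsConv.powerSum_slice (ha : AbsConv a) (τ : ℝ) {t : ℂ} (ht : ‖t‖ < 1) :
    powerSum a (t, t * exp (τ * I)) = ∑' N, sliceCoeff a τ N * t ^ N := by
  have h := (sigmaAntidiagonalEquivProd (A := ℕ)).summable_iff.2
    (ha.summable_norm (mk_mem_bidisk ht τ)).of_norm
  rw [powerSum, ← (sigmaAntidiagonalEquivProd (A := ℕ)).tsum_eq]
  refine (Summable.tsum_sigma' (fun N => (hasSum_fintype _).summable) h).trans ?_
  refine tsum_congr fun N => ?_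
  rw [tsum_fintype, Finset.univ_eq_attach, sliceCoeff, Finset.sum_mul,
    ← Finset.sum_attach (antidiagonal N)]
  refine Finset.sum_congr rfl fun k _ => ?_
  change a k.1 * (t ^ k.1.1 * (t * exp (τ * I)) ^ k.1.2) = _
  have hk : t ^ N = t ^ k.1.1 * t ^ k.1.2 := by rw [← pow_add, mem_antidiagonal.1 k.2]
  rw [mul_pow, ← exp_nat_mul, hk]
  ring_nf

theorem continuous_sliceCoeff (a : ℕ × ℕ → ℂ) (N : ℕ) : Continuous fun τ => sliceCoeff a τ N := by
  unfold sliceCoeff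
  fun_prop

theorem measurable_tsum_norm_sq_sliceCoeff (a : ℕ × ℕ → ℂ) :
    Measurable fun τ => ∑' N, ENNReal.ofReal (‖sliceCoeff a τ N‖ ^ 2) :=
  Measurable.tsum fun N => ((continuous_sliceCoeff a N).norm.pow 2).measurable.ennreal_ofReal

theorem integral_norm_sq_sliceCoeff (a : ℕ × ℕ → ℂ) (N : ℕ) :
    ∫ τ in (0 : ℝ)..2 * Real.pi, ‖sliceCoeff a τ N‖ ^ 2 =
      2 * Real.pi * ∑ k ∈ antidiagonal N, ‖a k‖ ^ 2 := by
  let c : ℕ → ℂ := fun k => if k ∈ Finset.range (N + 1) then a (N - k, k) else 0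
  have hc : ∀ k ∉ Finset.range (N + 1), c k = 0 := fun k hk => if_neg hk
  have h := (hasSum_norm_sq_integral (a := c)
    (summable_of_ne_finset_zero (s := Finset.range (N + 1)) fun k hk => by
      rw [hc k hk, norm_zero])).tsum_eq
  have hslice (τ : ℝ) : ∑' n, c n * exp (n * τ * I) = sliceCoeff a τ N := by
    rw [tsum_eq_sum (s := Finset.range (N + 1)) fun k hk => by rw [hc k hk, zero_mul],
      sliceCoeff, ← Finset.Nat.sum_antidiagonal_swap,
      Finset.Nat.sum_antidiagonal_eq_sum_range_succ_mk]
    exact Finset.sum_congr rfl fun k hk => by simp only [c, if_pos hk, Prod.swap]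
  rw [tsum_mul_left, tsum_eq_sum (s := Finset.range (N + 1)) fun k hk => by rw [hc k hk]; simp]
    at h
  simp only [hslice] at h
  rw [← h, ← Finset.Nat.sum_antidiagonal_swap, Finset.Nat.sum_antidiagonal_eq_sum_range_succ_mk]
  congr 1
  exact Finset.sum_congr rfl fun k hk => by simp only [c, if_pos hk, Prod.swap]

theorem lintegral_tsum_norm_sq_sliceCoeff (a : ℕ × ℕ → ℂ) :
    ∫⁻ τ in Set.Ioc (0 : ℝ) (2 * Real.pi), ∑' N, ENNReal.ofReal (‖sliceCoeff a τ N‖ ^ 2) =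
      ENNReal.ofReal (2 * Real.pi) * ∑' k, ENNReal.ofReal (‖a k‖ ^ 2) := by
  have hcont (N : ℕ) : Continuous fun τ => ‖sliceCoeff a τ N‖ ^ 2 :=
    (continuous_sliceCoeff a N).norm.pow 2
  have hN (N : ℕ) :
      ∫⁻ τ in Set.Ioc (0 : ℝ) (2 * Real.pi), ENNReal.ofReal (‖sliceCoeff a τ N‖ ^ 2) =
        ENNReal.ofReal (2 * Real.pi) * ∑ k ∈ antidiagonal N, ENNReal.ofReal (‖a k‖ ^ 2) := by
    rw [← ofReal_integral_eq_lintegral_ofReal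
        ((hcont N).integrableOn_Icc.mono_set Set.Ioc_subset_Icc_self)
        (Eventually.of_forall fun _ => by positivity),
      ← intervalIntegral.integral_of_le Real.two_pi_pos.le, integral_norm_sq_sliceCoeff,
      ENNReal.ofReal_mul Real.two_pi_pos.le,
      ENNReal.ofReal_sum_of_nonneg fun _ _ => by positivity]
  rw [lintegral_tsum fun N => (hcont N).measurable.ennreal_ofReal.aemeasurable, tsum_congr hN,
    ENNReal.tsum_mul_left,
    ← (sigmaAntidiagonalEquivProd (A := ℕ)).tsum_eq fun k => ENNReal.ofReal (‖a k‖ ^ 2),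
    ENNReal.tsum_sigma']
  congr 1
  refine tsum_congr fun N => ?_
  rw [tsum_fintype, Finset.univ_eq_attach, ← Finset.sum_attach]
  rfl

theorem H2.hasSum_norm_sq (f : H2) : HasSum (fun k => ‖f k‖ ^ 2) (‖f‖ ^ 2) := by
  simpa using lp.hasSum_norm (p := 2) (by norm_num) f

theorem H2.tsum_ofReal_norm_sq (f : H2) :
    ∑' k, ENNReal.ofReal (‖f k‖ ^ 2) = ENNReal.ofReal (‖f‖ ^ 2) := by
  rw [← f.hasSum_norm_sq.tsum_eq,
    ENNReal.ofReal_tsum_of_nonneg (fun _ => by positivity) f.hasSum_norm_sq.summable]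

theorem summable_of_tsum_ofReal_ne_top {ι : Type*} {u : ι → ℝ} (hu : ∀ i, 0 ≤ u i)
    (h : ∑' i, ENNReal.ofReal (u i) ≠ ⊤) : Summable u :=
  (ENNReal.summable_toReal h).congr fun i => ENNReal.toReal_ofReal (hu i)

theorem H2.exists_of_tsum_le {M : ℝ} (hM : 0 ≤ M)
    (h : ∑' k, ENNReal.ofReal (‖a k‖ ^ 2) ≤ ENNReal.ofReal (M ^ 2)) :
    ∃ f : H2, (f : ℕ × ℕ → ℂ) = a ∧ ‖f‖ ≤ M := by
  have hs : Summable fun k => ‖a k‖ ^ 2 := summable_of_tsum_ofReal_ne_top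
    (fun _ => by positivity) (ne_top_of_le_ne_top ENNReal.ofReal_ne_top h)
  let f : H2 := ⟨a, memℓp_gen (by simpa using hs)⟩
  refine ⟨f, rfl, le_of_sq_le_sq ?_ hM⟩
  rwa [← ENNReal.ofReal_le_ofReal_iff (by positivity), ← f.tsum_ofReal_norm_sq]

theorem AbsConv.tsum_norm_sq_sliceCoeff_le (ha : AbsConv a) (g : H2) {C τ : ℝ}
    (hg : ∑' N, ENNReal.ofReal (‖sliceCoeff g τ N‖ ^ 2) ≠ ⊤)
    (h : ∀ ε > 0, ∃ ρ < (1 : ℝ), ∀ t : ℂ, ρ < ‖t‖ → ‖t‖ < 1 →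
      ‖powerSum a (t, t * exp (τ * I))‖ ≤ (C + ε) * ‖g.toFun (t, t * exp (τ * I))‖) :
    ∑' N, ENNReal.ofReal (‖sliceCoeff a τ N‖ ^ 2) ≤
      ENNReal.ofReal (C ^ 2) * ∑' N, ENNReal.ofReal (‖sliceCoeff g τ N‖ ^ 2) := by
  have hs := summable_of_tsum_ofReal_ne_top (fun _ => by positivity) hg
  have hslices : ∀ ε > 0, ∃ ρ < (1 : ℝ), ∀ t : ℂ, ρ < ‖t‖ → ‖t‖ < 1 →
      ‖∑' N, sliceCoeff a τ N * t ^ N‖ ≤ (C + ε) * ‖∑' N, sliceCoeff g τ N * t ^ N‖ := by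
    intro ε hε
    obtain ⟨ρ, hρ, hle⟩ := h ε hε
    refine ⟨ρ, hρ, fun t ht ht1 => ?_⟩
    rw [← ha.powerSum_slice τ ht1, ← (absConv_coe g).powerSum_slice τ ht1]
    exact hle t ht ht1
  obtain ⟨hsum, hle⟩ := tsum_norm_sq_le_of_eventually_norm_tsum_le
    (fun _ => ha.summable_norm_sliceCoeff τ) (fun _ => (absConv_coe g).summable_norm_sliceCoeff τ)
    hs hslices
  rw [← ENNReal.ofReal_tsum_of_nonneg (fun _ => by positivity) hsum,
    ← ENNReal.ofReal_tsum_of_nonneg (fun _ => by positivity) hs,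
    ← ENNReal.ofReal_mul (by positivity)]
  exact ENNReal.ofReal_le_ofReal hle

theorem AbsConv.exists_H2_of_slice_le (ha : AbsConv a) (g : H2) {C : ℝ} (hC : 0 ≤ C)
    (h : ∀ᵐ τ : ℝ, ∀ ε > 0, ∃ ρ < (1 : ℝ), ∀ t : ℂ, ρ < ‖t‖ → ‖t‖ < 1 →
      ‖powerSum a (t, t * exp (τ * I))‖ ≤ (C + ε) * ‖g.toFun (t, t * exp (τ * I))‖) :
    ∃ f : H2, (f : ℕ × ℕ → ℂ) = a ∧ ‖f‖ ≤ C * ‖g‖ := by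
  have hfin : ∀ᵐ τ ∂volume.restrict (Set.Ioc (0 : ℝ) (2 * Real.pi)),
      ∑' N, ENNReal.ofReal (‖sliceCoeff g τ N‖ ^ 2) < ⊤ := by
    refine ae_lt_top (measurable_tsum_norm_sq_sliceCoeff g) ?_
    rw [lintegral_tsum_norm_sq_sliceCoeff, g.tsum_ofReal_norm_sq]
    exact ENNReal.mul_ne_top ENNReal.ofReal_ne_top ENNReal.ofReal_ne_top
  have hle : ∀ᵐ τ ∂volume.restrict (Set.Ioc (0 : ℝ) (2 * Real.pi)),
      ∑' N, ENNReal.ofReal (‖sliceCoeff a τ N‖ ^ 2) ≤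
        ENNReal.ofReal (C ^ 2) * ∑' N, ENNReal.ofReal (‖sliceCoeff g τ N‖ ^ 2) := by
    filter_upwards [hfin, ae_restrict_of_ae h] with τ hτ hτ'
    exact ha.tsum_norm_sq_sliceCoeff_le g hτ.ne hτ'
  have hint := lintegral_mono_ae hle
  rw [lintegral_const_mul _ (measurable_tsum_norm_sq_sliceCoeff g),
    lintegral_tsum_norm_sq_sliceCoeff, lintegral_tsum_norm_sq_sliceCoeff, g.tsum_ofReal_norm_sq,
    mul_left_comm, ENNReal.mul_le_mul_iff_right (by simpa using Real.pi_pos) ENNReal.ofReal_ne_top,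
    ← ENNReal.ofReal_mul (by positivity), ← mul_pow] at hint
  exact H2.exists_of_tsum_le (by positivity) hint

end Slices

section ParametricIntegral

open Metric

theorem measurable_of_hasDerivAt {α : Type*} [MeasurableSpace α] {F : ℂ → α → ℂ} {F' : α → ℂ}
    {z₀ : ℂ} (hF : ∀ᶠ z in 𝓝 z₀, Measurable (F z))
    (hF' : ∀ s, HasDerivAt (fun z => F z s) (F' s) z₀) : Measurable F' := by
  obtain ⟨z, hz, hzF⟩ := exists_seq_forall_of_frequently
    (hF.filter_mono (nhdsWithin_le_nhds (s := {z₀}ᶜ))).frequently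
  refine measurable_of_tendsto_metrizable
    (f := fun n s => slope (fun z => F z s) z₀ (z n)) (fun n => ?_)
    (tendsto_pi_nhds.2 fun s => (hasDerivAt_iff_tendsto_slope.1 (hF' s)).comp hz)
  simp only [slope_def_field]
  exact ((hzF n).sub hF.self_of_nhds).div_const _

theorem differentiableOn_intervalIntegral {U : Set ℂ} (hU : IsOpen U) {G : ℂ → ℝ → ℂ} {a b : ℝ}
    (hc : ContinuousOn (fun x : ℂ × ℝ => G x.1 x.2) (U ×ˢ Set.univ))
    (hd : ∀ s, DifferentiableOn ℂ (fun z => G z s) U) :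
    DifferentiableOn ℂ (fun z => ∫ s in a..b, G z s) U := by
  intro z₀ hz₀
  obtain ⟨ε, hε, hball⟩ : ∃ ε > 0, closedBall z₀ (2 * ε) ⊆ U := by
    obtain ⟨δ, hδ, h⟩ := nhds_basis_closedBall.mem_iff.1 (hU.mem_nhds hz₀)
    exact ⟨δ / 2, half_pos hδ, by rwa [mul_div_cancel₀ δ two_ne_zero]⟩
  obtain ⟨M, hM⟩ := ((isCompact_closedBall z₀ (2 * ε)).prod
    (isCompact_uIcc (a := a) (b := b))).exists_bound_of_continuousOn
      (hc.mono (Set.prod_mono hball (Set.subset_univ _)))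
  have hcont : ∀ z ∈ U, Continuous (G z) := fun z hz =>
    hc.comp_continuous (by fun_prop : Continuous fun s : ℝ => (z, s)) fun _ => ⟨hz, trivial⟩
  have hderiv : ∀ s, ∀ z ∈ U, HasDerivAt (fun z => G z s) (deriv (fun z => G z s) z) z :=
    fun s z hz => ((hd s).differentiableAt (hU.mem_nhds hz)).hasDerivAt
  have hbound : ∀ s ∈ Set.uIcc a b, ∀ z ∈ ball z₀ ε, ‖deriv (fun z => G z s) z‖ ≤ M / ε := by
    intro s hs z hz
    have hsub : closedBall z ε ⊆ closedBall z₀ (2 * ε) :=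
      closedBall_subset_closedBall' (by have := mem_ball.1 hz; linarith)
    refine Complex.norm_deriv_le_of_forall_mem_sphere_norm_le hε ?_ fun w hw =>
      hM (w, s) ⟨hsub (sphere_subset_closedBall hw), hs⟩
    exact ((hd s).mono (hsub.trans hball)).diffContOnCl_ball subset_rfl
  have hballU : ball z₀ ε ⊆ U := (ball_subset_closedBall.trans
    (closedBall_subset_closedBall (by linarith))).trans hball
  refine (intervalIntegral.hasDerivAt_integral_of_dominated_loc_of_deriv_le
    (F' := fun z s => deriv (fun z => G z s) z) (bound := fun _ => M / ε) (ball_mem_nhds z₀ hε)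
    (by filter_upwards [hU.mem_nhds hz₀] with z hz using (hcont z hz).aestronglyMeasurable)
    ((hcont z₀ hz₀).intervalIntegrable _ _) ?_
    (Eventually.of_forall fun s hs => hbound s (Set.uIoc_subset_uIcc hs))
    intervalIntegrable_const
    (Eventually.of_forall fun s _ z hz => hderiv s z (hballU hz))).2.differentiableAt
    |>.differentiableWithinAt
  exact (measurable_of_hasDerivAt
    (by filter_upwards [hU.mem_nhds hz₀] with z hz using (hcont z hz).measurable)
    fun s => hderiv s z₀ hz₀).aestronglyMeasurable

end ParametricIntegral

section Zeros

open Metric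

theorem countable_zeros {g : ℂ → ℂ} {U : Set ℂ} (hg : DifferentiableOn ℂ g U) (hU : IsOpen U)
    (hconn : IsPreconnected U) (hne : ∃ x ∈ U, g x ≠ 0) : {x ∈ U | g x = 0}.Countable := by
  obtain ⟨x, hx, hgx⟩ := hne
  rcases (hg.analyticOnNhd hU).eqOn_zero_or_eventually_ne_zero_of_preconnected hconn with h | h
  · exact absurd (h hx) hgx
  · refine ((HereditarilyLindelofSpace.isLindelof _).countable_of_isDiscrete
      (isDiscrete_of_codiscreteWithin (s := {x | g x = 0}) h)).mono ?_
    exact fun y hy => ⟨hy.2, hy.1⟩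

theorem exists_radius_ne_zero {g : ℂ → ℂ} (hg : DifferentiableOn ℂ g (ball 0 1))
    (hne : ∃ x ∈ ball (0 : ℂ) 1, g x ≠ 0) {ρ₁ : ℝ} (h1 : ρ₁ < 1) :
    ∃ ρ, ρ₁ < ρ ∧ ρ < 1 ∧ ∀ ζ ∈ sphere (0 : ℂ) ρ, g ζ ≠ 0 := by
  have hZ := (countable_zeros hg isOpen_ball (convex_ball 0 1).isPreconnected hne).image
    (fun x => ‖x‖)
  obtain ⟨ρ, hρ, hρ'⟩ := (hZ.dense_compl ℝ).exists_mem_open isOpen_Ioo (Set.nonempty_Ioo.2 h1)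
  refine ⟨ρ, hρ'.1, hρ'.2, fun ζ hζ h => hρ ⟨ζ, ⟨?_, h⟩, mem_sphere_zero_iff_norm.1 hζ⟩⟩
  rw [mem_ball_zero_iff, mem_sphere_zero_iff_norm.1 hζ]
  exact hρ'.2

end Zeros

section Division

open Metric

/-- `F` is continuous on the bidisk and holomorphic in each variable. By Osgood's lemma this is the
same as holomorphy, but it is the form in which holomorphy is used and verified below. -/
structure SepHolo (F : ℂ × ℂ → ℂ) : Prop where
  cont : ContinuousOn F bidisk
  left : ∀ w ∈ ball (0 : ℂ) 1, DifferentiableOn ℂ (fun z => F (z, w)) (ball 0 1)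
  right : ∀ z ∈ ball (0 : ℂ) 1, DifferentiableOn ℂ (fun w => F (z, w)) (ball 0 1)

theorem isOpen_bidisk : IsOpen bidisk := isOpen_ball.prod isOpen_ball

theorem sphere_subset_ball_one {ρ : ℝ} (hρ : ρ < 1) : sphere (0 : ℂ) ρ ⊆ ball 0 1 :=
  sphere_subset_closedBall.trans (closedBall_subset_ball hρ)

/-- The circle of radius `ρ` in the unit disk is free of zeros of `θ (z, ·)`, so that one can
integrate `f (z, ·) / θ (z, ·)` over it. -/
def GoodRadius (θ : ℂ × ℂ → ℂ) (ρ : ℝ) (z : ℂ) : Prop :=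
  0 < ρ ∧ ρ < 1 ∧ ∀ ζ ∈ sphere (0 : ℂ) ρ, θ (z, ζ) ≠ 0

/-- The `k`-th coefficient of the power series of the Cauchy integral of `f (z, ·) / θ (z, ·)` over
the circle of radius `ρ`. -/
def cauchyCoeff (f θ : ℂ × ℂ → ℂ) (ρ : ℝ) (k : ℕ) (z : ℂ) : ℂ :=
  (cauchyPowerSeries (fun ζ => f (z, ζ) / θ (z, ζ)) 0 ρ).coeff k

variable {f θ : ℂ × ℂ → ℂ} {ρ : ℝ}

theorem GoodRadius.exists_ball (hθ : SepHolo θ) {z₀ : ℂ} (hz₀ : z₀ ∈ ball (0 : ℂ) 1)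
    (h : GoodRadius θ ρ z₀) :
    ∃ ε > 0, ball z₀ ε ⊆ ball 0 1 ∧ ∀ z ∈ ball z₀ ε, GoodRadius θ ρ z := by
  have hopen : IsOpen (bidisk ∩ θ ⁻¹' {0}ᶜ) :=
    hθ.cont.isOpen_inter_preimage isOpen_bidisk isOpen_compl_singleton
  obtain ⟨u, v, hu, -, hzu, hv, huv⟩ := generalized_tube_lemma (isCompact_singleton (x := z₀))
    (isCompact_sphere (0 : ℂ) ρ) hopen (by
      rintro ⟨_, ζ⟩ ⟨rfl, hζ⟩
      exact ⟨⟨hz₀, sphere_subset_ball_one h.2.1 hζ⟩, h.2.2 ζ hζ⟩)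
  obtain ⟨ε, hε, hsub⟩ := Metric.isOpen_iff.1 (hu.inter isOpen_ball) z₀
    ⟨hzu (Set.mem_singleton z₀), hz₀⟩
  exact ⟨ε, hε, fun z hz => (hsub hz).2, fun z hz => ⟨h.1, h.2.1, fun ζ hζ =>
    (huv (⟨(hsub hz).1, hv hζ⟩ : (z, ζ) ∈ u ×ˢ v)).2⟩⟩

theorem continuousOn_div_prod_sphere (hf : SepHolo f) (hθ : SepHolo θ) {U : Set ℂ}
    (hU : U ⊆ ball 0 1) (hρ : ρ < 1) (hgood : ∀ z ∈ U, GoodRadius θ ρ z) :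
    ContinuousOn (fun x : ℂ × ℂ => f (x.1, x.2) / θ (x.1, x.2)) (U ×ˢ sphere 0 ρ) := by
  have hsub : U ×ˢ sphere (0 : ℂ) ρ ⊆ bidisk := Set.prod_mono hU (sphere_subset_ball_one hρ)
  exact (hf.cont.mono hsub).div (hθ.cont.mono hsub) fun x hx => (hgood x.1 hx.1).2.2 x.2 hx.2

theorem cauchyCoeff_eq_circleIntegral (f θ : ℂ × ℂ → ℂ) (ρ : ℝ) (k : ℕ) (z : ℂ) :
    cauchyCoeff f θ ρ k z = (2 * Real.pi * Complex.I)⁻¹ *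
      ∮ ζ in C(0, ρ), (1 / ζ) ^ k * (ζ⁻¹ * (f (z, ζ) / θ (z, ζ))) := by
  have h := (cauchyPowerSeries (fun ζ => f (z, ζ) / θ (z, ζ)) 0 ρ).apply_eq_pow_smul_coeff
    (n := k) (z := 1)
  rw [cauchyPowerSeries_apply, one_pow, one_smul] at h
  simpa only [cauchyCoeff, smul_eq_mul, sub_zero] using h.symm

theorem differentiableOn_cauchyCoeff (hf : SepHolo f) (hθ : SepHolo θ) {U : Set ℂ}
    (hUo : IsOpen U) (hU : U ⊆ ball 0 1) (hρ₀ : 0 < ρ) (hρ : ρ < 1)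
    (hgood : ∀ z ∈ U, GoodRadius θ ρ z) (k : ℕ) :
    DifferentiableOn ℂ (cauchyCoeff f θ ρ k) U := by
  have hsphere : ∀ s : ℝ, circleMap 0 ρ s ∈ sphere (0 : ℂ) ρ := circleMap_mem_sphere 0 hρ₀.le
  have hne : ∀ s : ℝ, circleMap 0 ρ s ≠ 0 := fun s => circleMap_ne_center hρ₀.ne'
  simp only [funext (cauchyCoeff_eq_circleIntegral f θ ρ k), circleIntegral, deriv_circleMap,
    smul_eq_mul]
  refine DifferentiableOn.const_mul (differentiableOn_intervalIntegral hUo ?_ fun s => ?_) _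
  · have hc := (continuousOn_div_prod_sphere hf hθ hU hρ hgood).comp
      (f := fun x : ℂ × ℝ => (x.1, circleMap 0 ρ x.2)) (s := U ×ˢ Set.univ) (by fun_prop)
      fun x hx => ⟨hx.1, hsphere x.2⟩
    have hinv : Continuous fun x : ℂ × ℝ => (circleMap 0 ρ x.2)⁻¹ :=
      Continuous.inv₀ (by fun_prop) fun x => hne x.2
    simp only [one_div]
    exact (by fun_prop : Continuous fun x : ℂ × ℝ => circleMap 0 ρ x.2 * Complex.I).continuousOn.mul
      ((hinv.pow k).continuousOn.mul (hinv.continuousOn.mul hc))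
  · have hζ := sphere_subset_ball_one hρ (hsphere s)
    exact DifferentiableOn.const_mul (DifferentiableOn.const_mul (DifferentiableOn.const_mul
      (((hf.left _ hζ).mono hU).div ((hθ.left _ hζ).mono hU) fun z hz =>
        (hgood z hz).2.2 _ (hsphere s)) _) _) _

theorem exists_ball_norm_cauchyCoeff_le (hf : SepHolo f) (hθ : SepHolo θ) {z₀ : ℂ}
    (hz₀ : z₀ ∈ ball (0 : ℂ) 1) (h : GoodRadius θ ρ z₀) :
    ∃ ε > 0, ∃ M : ℝ, ball z₀ ε ⊆ ball 0 1 ∧ ∀ z ∈ ball z₀ ε, GoodRadius θ ρ z ∧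
      ∀ k, ‖cauchyCoeff f θ ρ k z‖ ≤ M * ρ⁻¹ ^ k := by
  obtain ⟨ε, hε, hsub, hgood⟩ := h.exists_ball hθ hz₀
  have hcb : closedBall z₀ (ε / 2) ⊆ ball z₀ ε := closedBall_subset_ball (half_lt_self hε)
  obtain ⟨M, hM⟩ := ((isCompact_closedBall z₀ (ε / 2)).prod
    (isCompact_sphere (0 : ℂ) ρ)).exists_bound_of_continuousOn
      (continuousOn_div_prod_sphere hf hθ (hcb.trans hsub) h.2.1 fun z hz => hgood z (hcb hz))
  refine ⟨ε / 2, half_pos hε, M, (ball_subset_closedBall.trans hcb).trans hsub,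
    fun z hz => ⟨hgood z (hcb (ball_subset_closedBall hz)), fun k => ?_⟩⟩
  have hρ := h.1
  rw [cauchyCoeff_eq_circleIntegral, ← smul_eq_mul]
  calc ‖(2 * Real.pi * Complex.I : ℂ)⁻¹ •
        ∮ ζ in C(0, ρ), (1 / ζ) ^ k * (ζ⁻¹ * (f (z, ζ) / θ (z, ζ)))‖
      ≤ ρ * (ρ⁻¹ ^ k * (ρ⁻¹ * M)) := by
        refine circleIntegral.norm_two_pi_i_inv_smul_integral_le_of_norm_le_const hρ.le
          fun ζ hζ => ?_
        rw [norm_mul, norm_mul, norm_pow, one_div, norm_inv, mem_sphere_zero_iff_norm.1 hζ]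
        gcongr
        exact hM (z, ζ) ⟨ball_subset_closedBall hz, hζ⟩
    _ = M * ρ⁻¹ ^ k := by field_simp

theorem hasFPowerSeriesOnBall_of_eq_mul {z : ℂ} (h : GoodRadius θ ρ z) {g : ℂ → ℂ}
    (hg : DifferentiableOn ℂ g (ball 0 1))
    (hfg : ∀ w ∈ ball (0 : ℂ) 1, f (z, w) = θ (z, w) * g w) :
    HasFPowerSeriesOnBall g (cauchyPowerSeries (fun ζ => f (z, ζ) / θ (z, ζ)) 0 ρ) 0
      (ENNReal.ofReal ρ) := by
  have heq : cauchyPowerSeries (fun ζ => f (z, ζ) / θ (z, ζ)) 0 ρ = cauchyPowerSeries g 0 ρ := by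
    ext n : 1
    unfold cauchyPowerSeries
    congr 2
    refine circleIntegral.integral_congr h.1.le fun ζ hζ => ?_
    dsimp only
    rw [hfg ζ (sphere_subset_ball_one h.2.1 hζ), mul_div_cancel_left₀ _ (h.2.2 ζ hζ)]
  have hcoe := Real.coe_toNNReal _ h.1.le
  have hpow := DifferentiableOn.hasFPowerSeriesOnBall (R := ρ.toNNReal) (c := 0)
    (hg.mono (by rw [hcoe]; exact closedBall_subset_ball h.2.1)) (Real.toNNReal_pos.2 h.1)
  rwa [hcoe, ← heq] at hpow

end Division

section TaylorCoefficients

open Metric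

theorem absConv_of_norm_le {b : ℕ × ℕ → ℂ}
    (hb : ∀ R : ℝ, 0 < R → R < 1 → ∃ M : ℝ, ∀ i, ‖b i‖ ≤ M * R⁻¹ ^ (i.1 + i.2)) : AbsConv b := by
  intro r hr hr1
  obtain ⟨R, hR, hR1⟩ := exists_between hr1
  have hR0 : 0 < R := hr.trans_lt hR
  obtain ⟨M, hM⟩ := hb R hR0 hR1
  have hgeom := summable_geometric_of_lt_one (r := r / R) (by positivity) ((div_lt_one hR0).2 hR)
  have hs : Summable fun k : ℕ × ℕ => (r / R) ^ k.1 * (r / R) ^ k.2 :=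
    hgeom.mul_of_nonneg hgeom (fun _ => by positivity) (fun _ => by positivity)
  refine Summable.of_nonneg_of_le (fun _ => by positivity) (fun k => ?_) (hs.mul_left M)
  calc ‖b k‖ * r ^ (k.1 + k.2) ≤ M * R⁻¹ ^ (k.1 + k.2) * r ^ (k.1 + k.2) := by
        gcongr; exact hM k
    _ = M * ((r / R) ^ k.1 * (r / R) ^ k.2) := by
        rw [← pow_add, div_eq_mul_inv, mul_pow]; ring

theorem exists_powerSum_eq_tsum {a : ℕ → ℂ → ℂ}
    (hd : ∀ k, DifferentiableOn ℂ (a k) (ball 0 1))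
    (hb : ∀ r : ℝ, 0 < r → r < 1 → ∃ M : ℝ, ∀ z : ℂ, ‖z‖ ≤ r → ∀ k, ‖a k z‖ ≤ M * r⁻¹ ^ k) :
    ∃ b : ℕ × ℕ → ℂ, AbsConv b ∧
      ∀ x ∈ bidisk, powerSum b x = ∑' k, a k x.1 * x.2 ^ k := by
  let b : ℕ × ℕ → ℂ := fun i => (i.1.factorial : ℂ)⁻¹ * iteratedDeriv i.1 (a i.2) 0
  have hconv : AbsConv b := by
    refine absConv_of_norm_le fun R hR0 hR1 => ?_
    obtain ⟨M, hM⟩ := hb R hR0 hR1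
    refine ⟨M, fun i => ?_⟩
    have hcauchy := Complex.norm_iteratedDeriv_le_of_forall_mem_sphere_norm_le (c := 0)
      (C := M * R⁻¹ ^ i.2) (f := a i.2) i.1 hR0
      (((hd i.2).mono (by
        rw [closure_ball _ hR0.ne']
        exact closedBall_subset_ball hR1)).diffContOnCl)
      (fun z hz => hM z (mem_sphere_zero_iff_norm.1 hz).le i.2)
    have hfact : (0 : ℝ) < i.1.factorial := by positivity
    rw [norm_mul, norm_inv, RCLike.norm_natCast, inv_mul_le_iff₀ hfact]
    refine hcauchy.trans (le_of_eq ?_)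
    rw [pow_add, inv_pow, inv_pow]
    field_simp
  refine ⟨b, hconv, fun x hx => ?_⟩
  have hs := (Equiv.prodComm ℕ ℕ).summable_iff.2 (hconv.summable_norm hx).of_norm
  rw [powerSum, ← (Equiv.prodComm ℕ ℕ).tsum_eq]
  refine (hs.tsum_prod' fun k => hs.prod_factor k).trans (tsum_congr fun k => ?_)
  rw [← Complex.taylorSeries_eq_on_ball' hx.1 (hd k), ← tsum_mul_right]
  refine tsum_congr fun j => ?_
  simp only [b, Function.comp_apply, Equiv.prodComm_apply, Prod.swap, sub_zero]
  ring

end TaylorCoefficients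

section BidiskDivision

open Metric

/-- For `z` in the set `S`, which is dense in the unit disk, the function `f (z, ·)` is the product
of `θ (z, ·)` and a holomorphic function; moreover no `θ (z, ·)` vanishes identically. This is the
input for division of `f` by `θ` on the bidisk. -/
structure DenselyDivides (θ f : ℂ × ℂ → ℂ) (S : Set ℂ) : Prop where
  divisor : SepHolo θ
  dividend : SepHolo f
  exists_ne_zero : ∀ z ∈ ball (0 : ℂ) 1, ∃ w ∈ ball (0 : ℂ) 1, θ (z, w) ≠ 0
  subset_closure : ball 0 1 ⊆ closure S
  exists_eq_mul : ∀ z ∈ S ∩ ball 0 1, ∃ g : ℂ → ℂ, DifferentiableOn ℂ g (ball 0 1) ∧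
    ∀ w ∈ ball (0 : ℂ) 1, f (z, w) = θ (z, w) * g w

/-- The `k`-th Taylor coefficient of `f (z, ·) / θ (z, ·)`, computed by a Cauchy integral over some
circle on which `θ (z, ·)` has no zeros. -/
def quotientCoeff (f θ : ℂ × ℂ → ℂ) (k : ℕ) (z : ℂ) : ℂ :=
  cauchyCoeff f θ (Classical.epsilon fun ρ => GoodRadius θ ρ z) k z

namespace DenselyDivides

variable {θ f : ℂ × ℂ → ℂ} {S : Set ℂ} (h : DenselyDivides θ f S)
include h

theorem exists_goodRadius {z : ℂ} (hz : z ∈ ball (0 : ℂ) 1) {ρ₁ : ℝ} (h0 : 0 ≤ ρ₁) (h1 : ρ₁ < 1) :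
    ∃ ρ, ρ₁ < ρ ∧ GoodRadius θ ρ z := by
  obtain ⟨ρ, hlt, hρ, hne⟩ :=
    exists_radius_ne_zero (h.divisor.right z hz) (h.exists_ne_zero z hz) h1
  exact ⟨ρ, hlt, h0.trans_lt hlt, hρ, hne⟩

theorem ball_subset_closure {z₀ : ℂ} {ε : ℝ} (hsub : ball z₀ ε ⊆ ball 0 1) :
    ball z₀ ε ⊆ closure (S ∩ ball z₀ ε) := by
  rw [Set.inter_comm]
  exact fun z hz => isOpen_ball.inter_closure ⟨hz, h.subset_closure (hsub hz)⟩

theorem cauchyCoeff_eq {z : ℂ} (hz : z ∈ ball (0 : ℂ) 1) {ρ ρ' : ℝ} (hρ : GoodRadius θ ρ z)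
    (hρ' : GoodRadius θ ρ' z) (k : ℕ) : cauchyCoeff f θ ρ k z = cauchyCoeff f θ ρ' k z := by
  obtain ⟨ε₁, hε₁, hs₁, hg₁⟩ := hρ.exists_ball h.divisor hz
  obtain ⟨ε₂, hε₂, -, hg₂⟩ := hρ'.exists_ball h.divisor hz
  have hb₁ : ball z (min ε₁ ε₂) ⊆ ball z ε₁ := ball_subset_ball (min_le_left _ _)
  have hb₂ : ball z (min ε₁ ε₂) ⊆ ball z ε₂ := ball_subset_ball (min_le_right _ _)
  have heq : Set.EqOn (cauchyCoeff f θ ρ k) (cauchyCoeff f θ ρ' k)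
      (S ∩ ball z (min ε₁ ε₂)) := by
    intro y hy
    obtain ⟨g, hg, hfg⟩ := h.exists_eq_mul y ⟨hy.1, hs₁ (hb₁ hy.2)⟩
    have e₁ := (hasFPowerSeriesOnBall_of_eq_mul (hg₁ y (hb₁ hy.2)) hg hfg).hasFPowerSeriesAt
    have e₂ := (hasFPowerSeriesOnBall_of_eq_mul (hg₂ y (hb₂ hy.2)) hg hfg).hasFPowerSeriesAt
    unfold cauchyCoeff
    rw [e₁.eq_formalMultilinearSeries e₂]
  exact heq.of_subset_closure
    (differentiableOn_cauchyCoeff h.dividend h.divisor isOpen_ball (hb₁.trans hs₁) hρ.1 hρ.2.1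
      (fun y hy => hg₁ y (hb₁ hy)) k).continuousOn
    (differentiableOn_cauchyCoeff h.dividend h.divisor isOpen_ball (hb₁.trans hs₁) hρ'.1 hρ'.2.1
      (fun y hy => hg₂ y (hb₂ hy)) k).continuousOn Set.inter_subset_right
    (h.ball_subset_closure (hb₁.trans hs₁)) (mem_ball_self (lt_min hε₁ hε₂))

theorem quotientCoeff_eq {z : ℂ} (hz : z ∈ ball (0 : ℂ) 1) {ρ : ℝ} (hρ : GoodRadius θ ρ z)
    (k : ℕ) : quotientCoeff f θ k z = cauchyCoeff f θ ρ k z :=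
  h.cauchyCoeff_eq hz (Classical.epsilon_spec (p := fun ρ => GoodRadius θ ρ z) ⟨ρ, hρ⟩) hρ k

theorem differentiableOn_quotientCoeff (k : ℕ) :
    DifferentiableOn ℂ (quotientCoeff f θ k) (ball 0 1) := by
  intro z hz
  obtain ⟨ρ, -, hρ⟩ := h.exists_goodRadius hz le_rfl one_pos
  obtain ⟨ε, hε, hs, hg⟩ := hρ.exists_ball h.divisor hz
  have hd := (differentiableOn_cauchyCoeff h.dividend h.divisor isOpen_ball hs hρ.1 hρ.2.1 hg
    k).differentiableAt (ball_mem_nhds z hε)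
  refine (hd.congr_of_eventuallyEq ?_).differentiableWithinAt
  filter_upwards [ball_mem_nhds z hε] with y hy using h.quotientCoeff_eq (hs hy) (hg y hy) k

theorem exists_norm_quotientCoeff_le {r : ℝ} (hr : 0 < r) (hr1 : r < 1) :
    ∃ M : ℝ, ∀ z : ℂ, ‖z‖ ≤ r → ∀ k, ‖quotientCoeff f θ k z‖ ≤ M * r⁻¹ ^ k := by
  suffices ∃ M : ℝ, ∀ z ∈ closedBall (0 : ℂ) r, ∀ k, ‖quotientCoeff f θ k z‖ ≤ M * r⁻¹ ^ k by
    exact this.imp fun M hM z hz => hM z (mem_closedBall_zero_iff.2 hz)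
  refine (isCompact_closedBall (0 : ℂ) r).induction_on
    (p := fun s => ∃ M : ℝ, ∀ z ∈ s, ∀ k, ‖quotientCoeff f θ k z‖ ≤ M * r⁻¹ ^ k)
    ⟨0, fun z hz => absurd hz (Set.notMem_empty z)⟩
    (fun s t hst ⟨M, hM⟩ => ⟨M, fun z hz => hM z (hst hz)⟩) ?_ fun z₀ hz₀ => ?_
  · rintro s t ⟨M, hM⟩ ⟨M', hM'⟩
    refine ⟨max M M', fun z hz k => ?_⟩
    rcases hz with hz | hz
    · exact (hM z hz k).trans (by gcongr; exact le_max_left _ _)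
    · exact (hM' z hz k).trans (by gcongr; exact le_max_right _ _)
  · have hz₁ : z₀ ∈ ball (0 : ℂ) 1 := closedBall_subset_ball hr1 hz₀
    obtain ⟨ρ, hρ, hg⟩ := h.exists_goodRadius hz₁ hr.le hr1
    obtain ⟨ε, hε, M, hs, hM⟩ := exists_ball_norm_cauchyCoeff_le h.dividend h.divisor hz₁ hg
    refine ⟨ball z₀ ε, mem_nhdsWithin_of_mem_nhds (ball_mem_nhds z₀ hε), M, fun z hz k => ?_⟩
    have hM0 : 0 ≤ M := by simpa using (norm_nonneg _).trans ((hM z hz).2 0)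
    calc ‖quotientCoeff f θ k z‖ = ‖cauchyCoeff f θ ρ k z‖ := by
          rw [h.quotientCoeff_eq (hs hz) (hM z hz).1 k]
      _ ≤ M * ρ⁻¹ ^ k := (hM z hz).2 k
      _ ≤ M * r⁻¹ ^ k := by have := hg.1; gcongr

theorem mul_tsum_quotientCoeff {x : ℂ × ℂ} (hx : x ∈ bidisk) :
    θ x * ∑' k, quotientCoeff f θ k x.1 * x.2 ^ k = f x := by
  obtain ⟨z₀, w⟩ := x
  obtain ⟨hz₀, hw⟩ : z₀ ∈ ball (0 : ℂ) 1 ∧ w ∈ ball (0 : ℂ) 1 := hx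
  obtain ⟨ρ, hρ, hg⟩ := h.exists_goodRadius hz₀ (norm_nonneg w) (mem_ball_zero_iff.1 hw)
  obtain ⟨ε, hε, M, hs, hM⟩ := exists_ball_norm_cauchyCoeff_le h.dividend h.divisor hz₀ hg
  have heq : Set.EqOn (fun z => θ (z, w) * ∑' k, cauchyCoeff f θ ρ k z * w ^ k)
      (fun z => f (z, w)) (S ∩ ball z₀ ε) := by
    intro z hz
    obtain ⟨g, hgd, hfg⟩ := h.exists_eq_mul z ⟨hz.1, hs hz.2⟩
    have hsum := (hasFPowerSeriesOnBall_of_eq_mul (hM z hz.2).1 hgd hfg).hasSum (y := w) (by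
      rw [eball_ofReal, mem_ball_zero_iff]; exact hρ)
    simp only [FormalMultilinearSeries.apply_eq_pow_smul_coeff, smul_eq_mul, zero_add,
      mul_comm (w ^ _)] at hsum
    dsimp only [cauchyCoeff]
    rw [hsum.tsum_eq, hfg w hw]
  have hcont : ContinuousOn (fun z => θ (z, w) * ∑' k, cauchyCoeff f θ ρ k z * w ^ k)
      (ball z₀ ε) := by
    refine ((h.divisor.left w hw).continuousOn.mono hs).mul ?_
    refine continuousOn_tsum (u := fun k => M * (‖w‖ / ρ) ^ k) (fun k => ?_) ?_ fun k z hz => ?_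
    · exact (differentiableOn_cauchyCoeff h.dividend h.divisor isOpen_ball hs hg.1 hg.2.1
        (fun z hz => (hM z hz).1) k).continuousOn.mul continuousOn_const
    · exact (summable_geometric_of_lt_one (div_nonneg (norm_nonneg w) hg.1.le)
        ((div_lt_one hg.1).2 hρ)).mul_left M
    · rw [norm_mul, norm_pow, div_eq_mul_inv, mul_pow, mul_comm (‖w‖ ^ k), ← mul_assoc]
      exact mul_le_mul_of_nonneg_right ((hM z hz).2 k) (by positivity)
  simpa only [h.quotientCoeff_eq hz₀ hg] using
    heq.of_subset_closure hcont ((h.dividend.left w hw).continuousOn.mono hs)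
      Set.inter_subset_right (h.ball_subset_closure hs) (mem_ball_self hε)

theorem exists_powerSum_mul_eq :
    ∃ b : ℕ × ℕ → ℂ, AbsConv b ∧ ∀ x ∈ bidisk, θ x * powerSum b x = f x := by
  obtain ⟨b, hb, hsum⟩ := exists_powerSum_eq_tsum h.differentiableOn_quotientCoeff
    fun r hr hr1 => h.exists_norm_quotientCoeff_le hr hr1
  exact ⟨b, hb, fun x hx => by rw [hsum x hx, h.mul_tsum_quotientCoeff hx]⟩

end DenselyDivides

end BidiskDivision

section Multipliers

open Complex Metric

theorem norm_mul_pow_mul_pow_le (a : ℂ) {z w : ℂ} {r : ℝ} (hz : ‖z‖ ≤ r) (hw : ‖w‖ ≤ r)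
    (k : ℕ × ℕ) : ‖a * (z ^ k.1 * w ^ k.2)‖ ≤ ‖a‖ * r ^ (k.1 + k.2) := by
  have : 0 ≤ r := (norm_nonneg _).trans hz
  rw [norm_mul, norm_mul, norm_pow, norm_pow, pow_add]
  gcongr

theorem AbsConv.exists_radius {a : ℕ × ℕ → ℂ} (ha : AbsConv a) {z w : ℂ}
    (hz : z ∈ ball (0 : ℂ) 1) (hw : w ∈ ball (0 : ℂ) 1) :
    ∃ r, z ∈ ball (0 : ℂ) r ∧ w ∈ ball (0 : ℂ) r ∧
      Summable fun k : ℕ × ℕ => ‖a k‖ * r ^ (k.1 + k.2) := by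
  obtain ⟨r, hr, hr1⟩ := exists_between
    (max_lt (mem_ball_zero_iff.1 hz) (mem_ball_zero_iff.1 hw))
  exact ⟨r, mem_ball_zero_iff.2 ((le_max_left _ _).trans_lt hr),
    mem_ball_zero_iff.2 ((le_max_right _ _).trans_lt hr),
    ha r ((le_max_of_le_left (norm_nonneg _)).trans hr.le) hr1⟩

theorem AbsConv.sepHolo {a : ℕ × ℕ → ℂ} (ha : AbsConv a) : SepHolo (powerSum a) where
  cont x hx := by
    obtain ⟨r, h₁, h₂, hs⟩ := ha.exists_radius hx.1 hx.2
    have hcont : ContinuousOn (powerSum a) (ball 0 r ×ˢ ball 0 r) :=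
      continuousOn_tsum (fun k => by fun_prop) hs fun k y hy =>
        norm_mul_pow_mul_pow_le (a k) (mem_ball_zero_iff.1 hy.1).le (mem_ball_zero_iff.1 hy.2).le k
    exact (hcont.continuousAt ((isOpen_ball.prod isOpen_ball).mem_nhds
      ⟨h₁, h₂⟩)).continuousWithinAt
  left w hw z hz := by
    obtain ⟨r, h₁, h₂, hs⟩ := ha.exists_radius hz hw
    have hd : DifferentiableOn ℂ (fun z => powerSum a (z, w)) (ball 0 r) :=
      differentiableOn_tsum_of_summable_norm hs (fun k => by fun_prop) isOpen_ball fun k y hy =>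
        norm_mul_pow_mul_pow_le (a k) (mem_ball_zero_iff.1 hy).le (mem_ball_zero_iff.1 h₂).le k
    exact (hd.differentiableAt (isOpen_ball.mem_nhds h₁)).differentiableWithinAt
  right z hz w hw := by
    obtain ⟨r, h₁, h₂, hs⟩ := ha.exists_radius hz hw
    have hd : DifferentiableOn ℂ (fun w => powerSum a (z, w)) (ball 0 r) :=
      differentiableOn_tsum_of_summable_norm hs (fun k => by fun_prop) isOpen_ball fun k y hy =>
        norm_mul_pow_mul_pow_le (a k) (mem_ball_zero_iff.1 h₁).le (mem_ball_zero_iff.1 hy).le k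
    exact (hd.differentiableAt (isOpen_ball.mem_nhds h₂)).differentiableWithinAt

theorem H2.sepHolo (f : H2) : SepHolo f.toFun := (absConv_coe f).sepHolo

theorem SepHolo.mul {F G : ℂ × ℂ → ℂ} (hF : SepHolo F) (hG : SepHolo G) :
    SepHolo fun x => F x * G x :=
  ⟨hF.cont.mul hG.cont, fun w hw => (hF.left w hw).mul (hG.left w hw),
    fun z hz => (hF.right z hz).mul (hG.right z hz)⟩

theorem sepHolo_one : SepHolo fun _ => 1 :=
  ⟨continuousOn_const, fun _ _ => differentiableOn_const _, fun _ _ => differentiableOn_const _⟩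

theorem sepHolo_of_differentiableOn {F : ℂ × ℂ → ℂ} (hF : DifferentiableOn ℂ F bidisk) :
    SepHolo F :=
  ⟨hF.continuousOn,
    fun w hw => hF.comp (f := fun z : ℂ => (z, w)) (by fun_prop) fun z hz => ⟨hz, hw⟩,
    fun z hz => hF.comp (f := fun w : ℂ => (z, w)) (by fun_prop) fun w hw => ⟨hz, hw⟩⟩

theorem SepHolo.freeze {F : ℂ × ℂ → ℂ} (hF : SepHolo F) {c : ℂ} (hc : c ∈ ball (0 : ℂ) 1) :
    SepHolo fun x => F (c, x.2) :=
  ⟨(hF.right c hc).continuousOn.comp continuousOn_snd fun _ hx => hx.2,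
    fun w _ => differentiableOn_const (F (c, w)), fun _ _ => hF.right c hc⟩

theorem SepHolo.exists_powerSum {F : ℂ × ℂ → ℂ} (hF : SepHolo F) :
    ∃ b : ℕ × ℕ → ℂ, AbsConv b ∧ ∀ x ∈ bidisk, powerSum b x = F x := by
  have hdiv : DenselyDivides (fun _ => 1) F Set.univ :=
    { divisor := sepHolo_one
      dividend := hF
      exists_ne_zero := fun _ _ => ⟨0, mem_ball_self one_pos, one_ne_zero⟩
      subset_closure := by simp
      exists_eq_mul := fun z hz =>
        ⟨fun w => F (z, w), hF.right z hz.2, fun w _ => (one_mul _).symm⟩ }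
  simpa only [one_mul] using hdiv.exists_powerSum_mul_eq

theorem H2.toFun_add (f g : H2) {x : ℂ × ℂ} (hx : x ∈ bidisk) :
    (f + g).toFun x = f.toFun x + g.toFun x := by
  simp only [H2.toFun]
  rw [← (f.summable hx).tsum_add (g.summable hx)]
  exact tsum_congr fun k => by rw [lp.coeFn_add, Pi.add_apply, add_mul]

theorem H2.toFun_smul (c : ℂ) (f : H2) (x : ℂ × ℂ) : (c • f).toFun x = c * f.toFun x := by
  simp only [H2.toFun]
  rw [← tsum_mul_left]
  exact tsum_congr fun k => by rw [lp.coeFn_smul, Pi.smul_apply, smul_eq_mul, mul_assoc]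

theorem H2.toFun_sub (f g : H2) {x : ℂ × ℂ} (hx : x ∈ bidisk) :
    (f - g).toFun x = f.toFun x - g.toFun x := by
  rw [sub_eq_add_neg, H2.toFun_add _ _ hx, ← neg_one_smul ℂ g, H2.toFun_smul]
  ring

theorem H2.toFun_zero (x : ℂ × ℂ) : (0 : H2).toFun x = 0 := by simp [H2.toFun]

theorem H2.ext_toFun {f g : H2} (h : ∀ x ∈ bidisk, f.toFun x = g.toFun x) : f = g := by
  obtain ⟨u, hu, hnorm⟩ := (absConv_coe (f - g)).exists_H2_of_slice_le 0 le_rfl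
    (Eventually.of_forall fun τ _ _ => ⟨0, one_pos, fun t _ ht => by
      have hx := mk_mem_bidisk ht τ
      rw [← toFun_eq_powerSum, H2.toFun_sub _ _ hx, h _ hx, sub_self, H2.toFun_zero, norm_zero,
        mul_zero]⟩)
  rwa [zero_mul, norm_le_zero_iff, show u = f - g from lp.ext hu, sub_eq_zero] at hnorm

/-- `|F| ≥ 1 / C` asymptotically at the boundary of almost every slice `t ↦ (t, t exp (iτ))`. This
controls the norm of division by `F`. -/
def SliceBoundedBelow (F : ℂ × ℂ → ℂ) (C : ℝ) : Prop :=
  ∀ᵐ τ : ℝ, ∀ ε > 0, ∃ ρ < (1 : ℝ), ∀ t : ℂ, ρ < ‖t‖ → ‖t‖ < 1 →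
    1 ≤ (C + ε) * ‖F (t, t * exp (τ * I))‖

theorem exists_H2_of_mul_eq {F : ℂ × ℂ → ℂ} {C : ℝ} (hC : 0 ≤ C) (hF : SliceBoundedBelow F C)
    {b : ℕ × ℕ → ℂ} (hb : AbsConv b) (f : H2)
    (hbf : ∀ x ∈ bidisk, F x * powerSum b x = f.toFun x) :
    ∃ h : H2, (h : ℕ × ℕ → ℂ) = b ∧ ‖h‖ ≤ C * ‖f‖ := by
  refine hb.exists_H2_of_slice_le f hC ?_
  filter_upwards [hF] with τ hτ ε hε
  obtain ⟨ρ, hρ, h⟩ := hτ ε hε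
  refine ⟨ρ, hρ, fun t ht ht1 => ?_⟩
  rw [← hbf _ (mk_mem_bidisk ht1 τ), norm_mul, ← mul_assoc]
  exact le_mul_of_one_le_left (norm_nonneg _) (h t ht ht1)

theorem norm_le_of_mul_eq {F : ℂ × ℂ → ℂ} {C : ℝ} (hC : 0 ≤ C) (hF : SliceBoundedBelow F C)
    {h f : H2} (hhf : ∀ x ∈ bidisk, f.toFun x = F x * h.toFun x) : ‖h‖ ≤ C * ‖f‖ := by
  obtain ⟨h', heq, hle⟩ := exists_H2_of_mul_eq hC hF (absConv_coe h) f fun x hx => (hhf x hx).symm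
  rwa [show h' = h from lp.ext heq] at hle

theorem exists_mul_eq_of_bounded {F : ℂ × ℂ → ℂ} (hF : SepHolo F) {C : ℝ}
    (hC : ∀ x ∈ bidisk, ‖F x‖ ≤ C) (h : H2) :
    ∃ g : H2, (∀ x ∈ bidisk, g.toFun x = F x * h.toFun x) ∧ ‖g‖ ≤ C * ‖h‖ := by
  have hC0 : 0 ≤ C := (norm_nonneg _).trans (hC (0, 0) ⟨by simp, by simp⟩)
  obtain ⟨b, hb, hbe⟩ := (hF.mul h.sepHolo).exists_powerSum
  obtain ⟨g, hg, hn⟩ := hb.exists_H2_of_slice_le h hC0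
    (Eventually.of_forall fun τ _ _ => ⟨0, one_pos, fun t _ ht => by
      have hx := mk_mem_bidisk ht τ
      rw [hbe _ hx, norm_mul]
      gcongr
      linarith [hC _ hx]⟩)
  exact ⟨g, fun x hx => by rw [toFun_eq_powerSum, hg, hbe x hx], hn⟩

theorem exists_mulOp {F : ℂ × ℂ → ℂ} (hF : SepHolo F) {C : ℝ} (hC : ∀ x ∈ bidisk, ‖F x‖ ≤ C) :
    ∃ X : H2 →L[ℂ] H2, ∀ h : H2, ∀ x ∈ bidisk, (X h).toFun x = F x * h.toFun x := by
  choose X hX hXn using exists_mul_eq_of_bounded hF hC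
  refine ⟨LinearMap.mkContinuous
    { toFun := X
      map_add' := fun f g => H2.ext_toFun fun x hx => ?_
      map_smul' := fun c f => H2.ext_toFun fun x hx => ?_ } C hXn, hX⟩
  · rw [hX _ x hx, H2.toFun_add _ _ hx, H2.toFun_add _ _ hx, hX _ x hx, hX _ x hx, mul_add]
  · rw [hX _ x hx, H2.toFun_smul, RingHom.id_apply, H2.toFun_smul, hX _ x hx]
    ring

end Multipliers

section Shift

open Metric
open ContinuousLinearMap (adjoint)

theorem Mz_apply_zero (f : H2) (n : ℕ) : Mz f (0, n) = 0 := rfl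

theorem Mz_apply_succ (f : H2) (m n : ℕ) : Mz f (m + 1, n) = f (m, n) := rfl

theorem norm_Mz (f : H2) : ‖Mz f‖ = ‖f‖ :=
  (Real.rpow_left_inj (norm_nonneg _) (norm_nonneg _) (by norm_num)).mp
    ((lp.hasSum_norm (p := 2) (by norm_num) (Mz f)).unique (hasSum_shiftCoeff f))

theorem Mz_single (m n : ℕ) :
    Mz (lp.single 2 (m, n) (1 : ℂ)) = lp.single 2 (m + 1, n) (1 : ℂ) := by
  ext ⟨i, j⟩
  cases i with
  | zero => rw [Mz_apply_zero, lp.single_apply_ne]; simp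
  | succ i =>
    rw [Mz_apply_succ]
    by_cases h : (i, j) = (m, n)
    · obtain ⟨rfl, rfl⟩ := Prod.mk.inj h
      rw [lp.single_apply_self, lp.single_apply_self]
    · rw [lp.single_apply_ne _ _ _ h, lp.single_apply_ne]
      simpa using h

theorem adjoint_Mz_apply (f : H2) (m n : ℕ) : adjoint Mz f (m, n) = f (m + 1, n) := by
  have h := ContinuousLinearMap.adjoint_inner_right Mz (lp.single 2 (m, n) (1 : ℂ)) f
  rw [Mz_single, lp.inner_single_left, lp.inner_single_left] at h
  simpa using h

theorem toFun_Mz (f : H2) (x : ℂ × ℂ) : (Mz f).toFun x = x.1 * f.toFun x := by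
  have hinj : Function.Injective (fun k : ℕ × ℕ => (k.1 + 1, k.2)) := by
    rintro ⟨a, b⟩ ⟨c, d⟩ h
    simpa using h
  rw [H2.toFun, ← hinj.tsum_eq, H2.toFun, ← tsum_mul_left]
  · refine tsum_congr fun k => ?_
    simp only [Mz_apply_succ]
    ring
  · rintro ⟨m, n⟩ hk
    cases m with
    | zero => exact absurd (zero_mul (x.1 ^ 0 * x.2 ^ n)) hk
    | succ m => exact ⟨(m, n), rfl⟩

theorem toFun_sub_Mz_adjoint (f : H2) (x : ℂ × ℂ) :
    (f - Mz (adjoint Mz f)).toFun x = f.toFun (0, x.2) := by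
  simp only [H2.toFun]
  refine tsum_congr fun ⟨m, n⟩ => ?_
  cases m with
  | zero => simp [Mz_apply_zero]
  | succ m => simp [Mz_apply_succ, adjoint_Mz_apply]

theorem mul_toFun_adjoint_Mz (f : H2) {x : ℂ × ℂ} (hx : x ∈ bidisk) :
    x.1 * (adjoint Mz f).toFun x = f.toFun x - f.toFun (0, x.2) := by
  rw [← toFun_sub_Mz_adjoint f x, H2.toFun_sub _ _ hx, toFun_Mz]
  ring

theorem norm_adjoint_Mz_le : ‖adjoint Mz‖ ≤ 1 := by
  rw [LinearIsometryEquiv.norm_map]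
  exact ContinuousLinearMap.opNorm_le_bound _ zero_le_one fun f => by rw [norm_Mz, one_mul]

/-- The adjoint of `Mz` divides `f - f (0, ·)` by `z`; composing with the resolvent
`(1 - c Mz*)⁻¹` moves the division from `0` to `c`. -/
theorem exists_evalOp {c : ℂ} (hc : ‖c‖ < 1) :
    ∃ ev D : H2 →L[ℂ] H2, (∀ f, f = ev f + (Mz (D f) - c • D f)) ∧
      ∀ f, ∀ x ∈ bidisk, (ev f).toFun x = f.toFun (c, x.2) := by
  have hlt : ‖c • adjoint Mz‖ < 1 := by
    rw [norm_smul]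
    exact (mul_le_of_le_one_right (norm_nonneg c) norm_adjoint_Mz_le).trans_lt hc
  obtain ⟨R, hR⟩ : ∃ R : H2 →L[ℂ] H2, (1 - c • adjoint Mz) * R = 1 :=
    ⟨_, Ring.mul_inverse_cancel _ (isUnit_one_sub_of_norm_lt_one hlt)⟩
  have hRf : ∀ f, R f - c • adjoint Mz (R f) = f := DFunLike.congr_fun hR
  refine ⟨R - Mz ∘L adjoint Mz ∘L R, adjoint Mz ∘L R, fun f => ?_, fun f x hx => ?_⟩
  · change f = (R f - Mz (adjoint Mz (R f))) +
      (Mz (adjoint Mz (R f)) - c • adjoint Mz (R f))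
    rw [sub_add_sub_cancel, hRf]
  · have hcx : (c, x.2) ∈ bidisk := ⟨mem_ball_zero_iff.2 hc, hx.2⟩
    calc (R f - Mz (adjoint Mz (R f))).toFun x = (R f).toFun (0, x.2) :=
          toFun_sub_Mz_adjoint _ x
      _ = (R f).toFun (c, x.2) - c * (adjoint Mz (R f)).toFun (c, x.2) := by
          rw [mul_toFun_adjoint_Mz (R f) hcx, sub_sub_cancel]
      _ = f.toFun (c, x.2) := by
          rw [← H2.toFun_smul, ← H2.toFun_sub _ _ hcx, hRf]

theorem norm_Mz_sub_smul_ge (c : ℂ) (f : H2) : (1 - ‖c‖) * ‖f‖ ≤ ‖Mz f - c • f‖ := by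
  have h := norm_sub_norm_le (Mz f) (c • f)
  rw [norm_Mz, norm_smul] at h
  linarith

end Shift

section RationalSlices

open Complex Metric Polynomial

theorem eventually_radial_mem_ball (s : ℝ) :
    ∀ᶠ r : ℝ in 𝓝[<] 1, (r : ℂ) * exp (s * I) ∈ ball (0 : ℂ) 1 := by
  filter_upwards [Ioo_mem_nhdsLT (zero_lt_one' ℝ)] with r hr
  rw [mem_ball_zero_iff, norm_mul, norm_exp_ofReal_mul_I, mul_one, norm_real,
    Real.norm_of_nonneg hr.1.le]
  exact hr.2

theorem tendsto_radial (s : ℝ) :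
    Tendsto (fun r : ℝ => (r : ℂ) * exp (s * I)) (𝓝[<] 1) (𝓝[closedBall 0 1] exp (s * I)) := by
  have h : Continuous fun r : ℝ => (r : ℂ) * exp (s * I) := by fun_prop
  have hlim := h.tendsto 1
  rw [ofReal_one, one_mul] at hlim
  exact tendsto_nhdsWithin_iff.2 ⟨hlim.mono_left nhdsWithin_le_nhds,
    (eventually_radial_mem_ball s).mono fun r hr => ball_subset_closedBall hr⟩

theorem norm_eq_one_of_ae_radial_limit {g : ℂ → ℂ} (hg : ContinuousOn g (closedBall 0 1))
    (hae : ∀ᵐ s : ℝ, ∃ c : ℂ, ‖c‖ = 1 ∧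
      Tendsto (fun r : ℝ => g (r * exp (s * I))) (𝓝[<] 1) (𝓝 c)) {t : ℂ} (ht : ‖t‖ = 1) :
    ‖g t‖ = 1 := by
  have hmem : ∀ s : ℝ, exp (s * I) ∈ closedBall (0 : ℂ) 1 := fun s => by
    rw [mem_closedBall_zero_iff, norm_exp_ofReal_mul_I]
  have hcont : Continuous fun s : ℝ => ‖g (exp (s * I))‖ :=
    (hg.comp_continuous (by fun_prop) hmem).norm
  have hone : (fun s : ℝ => ‖g (exp (s * I))‖) =ᵐ[volume] fun _ => 1 := by
    filter_upwards [hae] with s ⟨c, hc, hlim⟩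
    rw [tendsto_nhds_unique ((hg _ (hmem s)).tendsto.comp (tendsto_radial s)) hlim, hc]
  have harg : exp (t.arg * I) = t := by
    simpa only [ht, ofReal_one, one_mul] using norm_mul_exp_arg_mul_I t
  simpa only [harg] using congrFun ((hcont.ae_eq_iff_eq volume continuous_const).1 hone) t.arg

theorem exists_radius_one_le_mul_norm {g : ℂ → ℂ} (hg : ContinuousOn g (closedBall 0 1))
    (hone : ∀ t : ℂ, ‖t‖ = 1 → ‖g t‖ = 1) {ε : ℝ} (hε : 0 < ε) :
    ∃ ρ < (1 : ℝ), ∀ t : ℂ, ρ < ‖t‖ → ‖t‖ < 1 → 1 ≤ (1 + ε) * ‖g t‖ := by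
  set A := {t ∈ closedBall (0 : ℂ) 1 | (1 + ε) * ‖g t‖ ≤ 1}
  have hA : IsCompact A := (isCompact_closedBall (0 : ℂ) 1).of_isClosed_subset
    ((continuousOn_const.mul hg.norm).preimage_isClosed_of_isClosed isClosed_closedBall
      isClosed_Iic) fun t ht => ht.1
  have hout : ∀ t : ℂ, ‖t‖ < 1 → t ∉ A → 1 ≤ (1 + ε) * ‖g t‖ := fun t ht htA =>
    (not_le.1 fun h => htA ⟨mem_closedBall_zero_iff.2 ht.le, h⟩).le
  rcases A.eq_empty_or_nonempty with hempty | hne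
  · exact ⟨0, one_pos, fun t _ ht => hout t ht (hempty ▸ Set.notMem_empty t)⟩
  · obtain ⟨t₀, ht₀, hmax⟩ := hA.exists_isMaxOn hne continuous_norm.continuousOn
    refine ⟨‖t₀‖, lt_of_le_of_ne (mem_closedBall_zero_iff.1 ht₀.1) fun h => ?_,
      fun t ht ht1 => hout t ht1 fun htA => (hmax htA).not_gt ht⟩
    have := ht₀.2
    rw [hone t₀ h] at this
    linarith

/-- In lowest terms, a zero of the denominator on the circle would be a pole of the bounded
quotient. -/
theorem exists_continuousOn_eq_div {P Q : ℂ[X]} (hP : ∀ t ∈ ball (0 : ℂ) 1, P.eval t ≠ 0)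
    {C : ℝ} (hb : ∀ t ∈ ball (0 : ℂ) 1, ‖Q.eval t / P.eval t‖ ≤ C) :
    ∃ g : ℂ → ℂ, ContinuousOn g (closedBall 0 1) ∧
      ∀ t ∈ ball (0 : ℂ) 1, g t = Q.eval t / P.eval t := by
  have hP0 : P ≠ 0 := fun h => hP 0 (mem_ball_self one_pos) (by rw [h, eval_zero])
  obtain ⟨P', Q', D, hrel, rfl, rfl⟩ :=
    UniqueFactorizationMonoid.exists_reduced_factors P hP0 Q
  simp only [eval_mul, mul_ne_zero_iff] at hP hb ⊢
  have hquot : ∀ t ∈ ball (0 : ℂ) 1, D.eval t * Q'.eval t / (D.eval t * P'.eval t) =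
      Q'.eval t / P'.eval t := fun t ht => mul_div_mul_left _ _ (hP t ht).1
  have hle : ∀ t ∈ closedBall (0 : ℂ) 1, ‖Q'.eval t‖ ≤ C * ‖P'.eval t‖ := by
    intro t ht
    rw [← closure_ball (0 : ℂ) one_ne_zero] at ht
    refine le_on_closure (f := fun t => ‖Q'.eval t‖) (g := fun t => C * ‖P'.eval t‖)
      (fun t ht => ?_) Q'.continuous.norm.continuousOn
      (continuous_const.mul P'.continuous.norm).continuousOn ht
    rw [← div_le_iff₀ (norm_pos_iff.2 (hP t ht).2), ← norm_div, ← hquot t ht]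
    exact hb t ht
  refine ⟨fun t => Q'.eval t / P'.eval t, Q'.continuous.continuousOn.div
    P'.continuous.continuousOn fun t ht h0 => ?_, fun t ht => (hquot t ht).symm⟩
  have hQ0 := hle t ht
  rw [h0, norm_zero, mul_zero, norm_le_zero_iff] at hQ0
  obtain ⟨u, v, huv⟩ := hrel.isCoprime
  simpa [h0, hQ0] using congrArg (eval t) huv

theorem one_le_mul_norm_of_unimodular {P Q : ℂ[X]} (hP : ∀ t ∈ ball (0 : ℂ) 1, P.eval t ≠ 0)
    {C : ℝ} (hb : ∀ t ∈ ball (0 : ℂ) 1, ‖Q.eval t / P.eval t‖ ≤ C)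
    (hae : ∀ᵐ s : ℝ, ∃ c : ℂ, ‖c‖ = 1 ∧ Tendsto (fun r : ℝ =>
      Q.eval (r * exp (s * I)) / P.eval (r * exp (s * I))) (𝓝[<] 1) (𝓝 c))
    {ε : ℝ} (hε : 0 < ε) :
    ∃ ρ < (1 : ℝ), ∀ t : ℂ, ρ < ‖t‖ → ‖t‖ < 1 → 1 ≤ (1 + ε) * ‖Q.eval t / P.eval t‖ := by
  obtain ⟨g, hg, hgPQ⟩ := exists_continuousOn_eq_div hP hb
  have hae' : ∀ᵐ s : ℝ, ∃ c : ℂ, ‖c‖ = 1 ∧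
      Tendsto (fun r : ℝ => g (r * exp (s * I))) (𝓝[<] 1) (𝓝 c) := by
    filter_upwards [hae] with s ⟨c, hc, hlim⟩
    exact ⟨c, hc, hlim.congr' ((eventually_radial_mem_ball s).mono fun r hr => (hgPQ _ hr).symm)⟩
  obtain ⟨ρ, hρ, h⟩ := exists_radius_one_le_mul_norm hg
    (fun t => norm_eq_one_of_ae_radial_limit hg hae') hε
  exact ⟨ρ, hρ, fun t ht ht1 => hgPQ t (mem_ball_zero_iff.2 ht1) ▸ h t ht ht1⟩

theorem eval_eval_C_mul_X (p : ℂ[X][Y]) (e t : ℂ) :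
    (p.eval (C e * X)).eval t = p.evalEval t (t * e) := by
  have hcomp : (evalRingHom t).comp (evalRingHom (C e * X : ℂ[X])) =
      (evalRingHom t).comp (evalRingHom (C (t * e))) := by
    refine Polynomial.ringHom_ext (fun a => ?_) ?_
    · simp only [RingHom.comp_apply, coe_evalRingHom, eval_C]
    · simp only [RingHom.comp_apply, coe_evalRingHom, eval_X, eval_mul, eval_C, mul_comm]
  exact DFunLike.congr_fun hcomp p

theorem IsInner.ae_slice {θ : ℂ × ℂ → ℂ} (hθ : IsInner θ) :
    ∀ᵐ τ : ℝ, ∀ᵐ s : ℝ, ∃ c : ℂ, ‖c‖ = 1 ∧ Tendsto (fun r : ℝ =>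
      θ (r * exp (s * I), r * exp (s * I) * exp (τ * I))) (𝓝[<] 1) (𝓝 c) := by
  filter_upwards [Measure.ae_ae_of_ae_prod ((measurePreserving_prod_add_swap (volume : Measure ℝ)
    (volume : Measure ℝ)).quasiMeasurePreserving.ae hθ.unimodular)] with τ hτ
  filter_upwards [hτ] with s ⟨c, hc, hlim⟩
  refine ⟨c, hc, hlim.congr fun r => ?_⟩
  simp only [ofReal_add, add_mul, exp_add, mul_assoc]

theorem IsInner.sliceBoundedBelow {θ : ℂ × ℂ → ℂ} (hθ : IsInner θ) {p q : ℂ[X][Y]}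
    (hpq : ∀ x ∈ bidisk, p.evalEval x.1 x.2 ≠ 0 ∧
      θ x = q.evalEval x.1 x.2 / p.evalEval x.1 x.2) : SliceBoundedBelow θ 1 := by
  obtain ⟨K, hK⟩ := hθ.bounded
  filter_upwards [hθ.ae_slice] with τ hτ ε hε
  have hslice : ∀ t : ℂ, ‖t‖ < 1 → θ (t, t * exp (τ * I)) =
      (q.eval (C (exp (τ * I)) * X)).eval t / (p.eval (C (exp (τ * I)) * X)).eval t := by
    intro t ht
    rw [(hpq _ (mk_mem_bidisk ht τ)).2, eval_eval_C_mul_X, eval_eval_C_mul_X]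
  obtain ⟨ρ, hρ, h⟩ := one_le_mul_norm_of_unimodular
    (P := p.eval (C (exp (τ * I)) * X)) (Q := q.eval (C (exp (τ * I)) * X)) (C := K)
    (fun t ht => by
      rw [eval_eval_C_mul_X]
      exact (hpq _ (mk_mem_bidisk (mem_ball_zero_iff.1 ht) τ)).1)
    (fun t ht => by
      rw [← hslice t (mem_ball_zero_iff.1 ht)]
      exact hK _ (mk_mem_bidisk (mem_ball_zero_iff.1 ht) τ))
    (by
      filter_upwards [hτ] with s ⟨c, hc, hlim⟩
      exact ⟨c, hc, hlim.congr' ((eventually_radial_mem_ball s).mono fun r hr =>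
        hslice _ (mem_ball_zero_iff.1 hr))⟩) hε
  exact ⟨ρ, hρ, fun t ht ht1 => hslice t ht1 ▸ h t ht ht1⟩

end RationalSlices

section Blaschke

open Complex Metric

/-- The Blaschke factor of the unit disk with its zero at `c`. -/
def blaschke (c z : ℂ) : ℂ := (z - c) / (1 - conj c * z)

theorem one_sub_norm_le_norm_one_sub_conj_mul {c z : ℂ} (hz : ‖z‖ ≤ 1) :
    1 - ‖c‖ ≤ ‖1 - conj c * z‖ := by
  have h := norm_sub_norm_le (1 : ℂ) (conj c * z)
  rw [norm_one, norm_mul, norm_conj] at h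
  nlinarith [norm_nonneg c]

theorem one_sub_conj_mul_ne_zero {c z : ℂ} (hc : ‖c‖ < 1) (hz : ‖z‖ ≤ 1) :
    1 - conj c * z ≠ 0 :=
  norm_pos_iff.1 ((sub_pos.2 hc).trans_le (one_sub_norm_le_norm_one_sub_conj_mul hz))

theorem norm_blaschke_of_norm_eq_one {c z : ℂ} (hc : ‖c‖ < 1) (hz : ‖z‖ = 1) :
    ‖blaschke c z‖ = 1 := by
  have hnorm : ‖1 - conj c * z‖ = ‖z - c‖ := by
    have hconj : 1 - conj c * z = z * conj (z - c) := by
      rw [map_sub, mul_sub, mul_conj, normSq_eq_norm_sq, hz]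
      push_cast
      ring
    rw [hconj, norm_mul, hz, one_mul, norm_conj]
  rw [blaschke, norm_div, ← hnorm, div_self
    (norm_ne_zero_iff.2 (one_sub_conj_mul_ne_zero hc hz.le))]

theorem differentiableAt_blaschke {c z : ℂ} (hc : ‖c‖ < 1) (hz : ‖z‖ ≤ 1) :
    DifferentiableAt ℂ (blaschke c) z :=
  DifferentiableAt.div (by fun_prop) (by fun_prop) (one_sub_conj_mul_ne_zero hc hz)

theorem norm_blaschke_le {c z : ℂ} (hc : ‖c‖ < 1) (hz : ‖z‖ ≤ 1) :
    ‖blaschke c z‖ ≤ 2 / (1 - ‖c‖) := by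
  rw [blaschke, norm_div]
  have hnum : ‖z - c‖ ≤ 2 := (norm_sub_le _ _).trans (by linarith)
  exact div_le_div₀ zero_le_two hnum (sub_pos.2 hc) (one_sub_norm_le_norm_one_sub_conj_mul hz)

theorem le_norm_blaschke {c z : ℂ} (hc : ‖c‖ < 1) (hz : ‖z‖ ≤ 1) (hcz : (1 + ‖c‖) / 2 ≤ ‖z‖) :
    (1 - ‖c‖) / 4 ≤ ‖blaschke c z‖ := by
  rw [blaschke, norm_div, le_div_iff₀ (norm_pos_iff.2 (one_sub_conj_mul_ne_zero hc hz))]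
  have hden : ‖1 - conj c * z‖ ≤ 2 := by
    refine (norm_sub_le _ _).trans ?_
    rw [norm_one, norm_mul, norm_conj]
    nlinarith [norm_nonneg c, norm_nonneg z]
  have hnum := norm_sub_norm_le z c
  nlinarith

theorem norm_le_of_norm_blaschke_mul_le {c : ℂ} (hc : ‖c‖ < 1) {g : ℂ → ℂ}
    (hg : DifferentiableOn ℂ g (ball 0 1)) {C : ℝ}
    (h : ∀ z ∈ ball (0 : ℂ) 1, ‖blaschke c z * g z‖ ≤ C) :
    ∀ z ∈ ball (0 : ℂ) 1, ‖g z‖ ≤ 4 / (1 - ‖c‖) * C := by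
  set r := (1 + ‖c‖) / 2 with hr
  have hr0 : r ≠ 0 := by positivity
  have houter : ∀ z ∈ ball (0 : ℂ) 1, r ≤ ‖z‖ → ‖g z‖ ≤ 4 / (1 - ‖c‖) * C := by
    intro z hz hrz
    have hle := h z hz
    rw [norm_mul] at hle
    have hlower := (mul_le_mul_of_nonneg_right
      (le_norm_blaschke hc (mem_ball_zero_iff.1 hz).le hrz) (norm_nonneg (g z))).trans hle
    rw [div_mul_eq_mul_div, le_div_iff₀ (sub_pos.2 hc)]
    linarith
  intro z hz
  rcases le_or_gt r ‖z‖ with hrz | hrz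
  · exact houter z hz hrz
  have hr1 : r < 1 := by rw [hr]; linarith
  refine norm_le_of_forall_mem_frontier_norm_le (U := ball (0 : ℂ) r) isBounded_ball
    (DifferentiableOn.diffContOnCl ?_) (fun y hy => ?_)
    (subset_closure (mem_ball_zero_iff.2 hrz))
  · rw [closure_ball _ hr0]
    exact hg.mono (closedBall_subset_ball hr1)
  · rw [frontier_ball _ hr0, mem_sphere_zero_iff_norm] at hy
    exact houter y (mem_ball_zero_iff.2 (hy ▸ hr1)) hy.ge

end Blaschke

section UnivariateFactors

open Complex Metric Polynomial

theorem eventually_radial_mem_bidisk (t : ℝ × ℝ) :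
    ∀ᶠ r : ℝ in 𝓝[<] 1, ((r : ℂ) * exp (t.1 * I), (r : ℂ) * exp (t.2 * I)) ∈ bidisk :=
  (eventually_radial_mem_ball t.1).and (eventually_radial_mem_ball t.2)

theorem tendsto_radial_prod (t : ℝ × ℝ) :
    Tendsto (fun r : ℝ => ((r : ℂ) * exp (t.1 * I), (r : ℂ) * exp (t.2 * I))) (𝓝[<] 1)
      (𝓝 (exp (t.1 * I), exp (t.2 * I))) :=
  ((tendsto_radial t.1).mono_right nhdsWithin_le_nhds).prodMk_nhds
    ((tendsto_radial t.2).mono_right nhdsWithin_le_nhds)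

/-- One of the two coordinate functions of `ℂ × ℂ`, so that statements symmetric in the two
variables are proved once. -/
def IsCoordinate (π : ℂ × ℂ → ℂ) : Prop := π = Prod.fst ∨ π = Prod.snd

namespace IsCoordinate

variable {π : ℂ × ℂ → ℂ}

theorem differentiable (hπ : IsCoordinate π) : Differentiable ℂ π := by
  rcases hπ with rfl | rfl <;> [exact differentiable_fst; exact differentiable_snd]

theorem norm_lt_one (hπ : IsCoordinate π) {x : ℂ × ℂ} (hx : x ∈ bidisk) : ‖π x‖ < 1 := by
  rcases hπ with rfl | rfl <;> [exact mem_ball_zero_iff.1 hx.1; exact mem_ball_zero_iff.1 hx.2]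

theorem norm_torus (hπ : IsCoordinate π) (t : ℝ × ℝ) :
    ‖π (exp (t.1 * I), exp (t.2 * I))‖ = 1 := by
  rcases hπ with rfl | rfl <;> simp only [norm_exp_ofReal_mul_I]

theorem apply_diag (hπ : IsCoordinate π) (z : ℂ) : π (z, z) = z := by
  rcases hπ with rfl | rfl <;> rfl

theorem isUnivariate_comp (hπ : IsCoordinate π) (g : ℂ → ℂ) :
    IsUnivariate fun x => g (π x) := by
  rcases hπ with rfl | rfl
  · exact Or.inl ⟨g, fun x _ => rfl⟩
  · exact Or.inr ⟨g, fun x _ => rfl⟩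

theorem norm_le_of_norm_blaschke_mul_le (hπ : IsCoordinate π) {c : ℂ} (hc : ‖c‖ < 1)
    {ψ : ℂ × ℂ → ℂ} (hψ : SepHolo ψ) {C : ℝ}
    (h : ∀ x ∈ bidisk, ‖blaschke c (π x) * ψ x‖ ≤ C) :
    ∀ x ∈ bidisk, ‖ψ x‖ ≤ 4 / (1 - ‖c‖) * C := by
  rintro ⟨z, w⟩ ⟨hz, hw⟩
  rcases hπ with rfl | rfl
  · exact Bidisk.norm_le_of_norm_blaschke_mul_le hc (hψ.left w hw)
      (fun y hy => h (y, w) ⟨hy, hw⟩) z hz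
  · exact Bidisk.norm_le_of_norm_blaschke_mul_le hc (hψ.right z hz)
      (fun y hy => h (z, y) ⟨hz, hy⟩) w hw

theorem tendsto_blaschke_radial (hπ : IsCoordinate π) {c : ℂ} (hc : ‖c‖ < 1) (t : ℝ × ℝ) :
    Tendsto (fun r : ℝ => blaschke c (π (r * exp (t.1 * I), r * exp (t.2 * I)))) (𝓝[<] 1)
      (𝓝 (blaschke c (π (exp (t.1 * I), exp (t.2 * I))))) :=
  (differentiableAt_blaschke hc (hπ.norm_torus t).le).continuousAt.tendsto.comp
    ((hπ.differentiable.continuous.tendsto _).comp (tendsto_radial_prod t))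

theorem isInner_blaschke (hπ : IsCoordinate π) {c : ℂ} (hc : ‖c‖ < 1) :
    IsInner fun x => blaschke c (π x) where
  holomorphic x hx := ((differentiableAt_blaschke hc (hπ.norm_lt_one hx).le).comp x
    (hπ.differentiable x)).differentiableWithinAt
  bounded := ⟨_, fun _ hx => norm_blaschke_le hc (hπ.norm_lt_one hx).le⟩
  unimodular := Eventually.of_forall fun t =>
    ⟨_, norm_blaschke_of_norm_eq_one hc (hπ.norm_torus t), hπ.tendsto_blaschke_radial hc t⟩

theorem not_blaschke_eq_const (hπ : IsCoordinate π) {c : ℂ} (hc : ‖c‖ < 1) :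
    ¬∃ d, ∀ x ∈ bidisk, blaschke c (π x) = d := by
  rintro ⟨d, hd⟩
  obtain ⟨e, he, hec⟩ : ∃ e ∈ ball (0 : ℂ) 1, e ≠ c := by
    by_cases h0 : c = 0
    · exact ⟨1 / 2, by norm_num, by rw [h0]; norm_num⟩
    · exact ⟨0, mem_ball_self one_pos, Ne.symm h0⟩
  have hcc := hd (c, c) ⟨mem_ball_zero_iff.2 hc, mem_ball_zero_iff.2 hc⟩
  have hee := hd (e, e) ⟨he, he⟩
  rw [hπ.apply_diag, blaschke, sub_self, zero_div] at hcc
  rw [hπ.apply_diag, ← hcc] at hee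
  exact (div_ne_zero (sub_ne_zero.2 hec)
    (one_sub_conj_mul_ne_zero hc (mem_ball_zero_iff.1 he).le)) hee

theorem isInner_of_eq_blaschke_mul (hπ : IsCoordinate π) {θ ψ : ℂ × ℂ → ℂ} (hθ : IsInner θ)
    {c : ℂ} (hc : ‖c‖ < 1) (hψ : DifferentiableOn ℂ ψ bidisk)
    (h : ∀ x ∈ bidisk, θ x = blaschke c (π x) * ψ x) : IsInner ψ where
  holomorphic := hψ
  bounded := by
    obtain ⟨K, hK⟩ := hθ.bounded
    exact ⟨_, hπ.norm_le_of_norm_blaschke_mul_le hc (sepHolo_of_differentiableOn hψ)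
      fun x hx => h x hx ▸ hK x hx⟩
  unimodular := by
    filter_upwards [hθ.unimodular] with t ⟨d, hd, hlim⟩
    have hone := norm_blaschke_of_norm_eq_one hc (hπ.norm_torus t)
    have hlim' := hπ.tendsto_blaschke_radial hc t
    have hne := norm_ne_zero_iff.1 (hone.trans_ne one_ne_zero)
    refine ⟨_, by rw [norm_div, hd, hone, div_one], (hlim.div hlim' hne).congr' ?_⟩
    filter_upwards [hlim'.eventually_ne hne, eventually_radial_mem_bidisk t] with r hr hx
    rw [Pi.div_apply, h _ hx, mul_div_cancel_left₀ _ hr]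

theorem hasUnivariateInnerFactor (hπ : IsCoordinate π) {θ ψ : ℂ × ℂ → ℂ} (hθ : IsInner θ)
    {c : ℂ} (hc : ‖c‖ < 1) (hψ : DifferentiableOn ℂ ψ bidisk)
    (h : ∀ x ∈ bidisk, θ x = blaschke c (π x) * ψ x) : HasUnivariateInnerFactor θ :=
  ⟨_, ψ, hπ.isInner_blaschke hc, hπ.isInner_of_eq_blaschke_mul hθ hc hψ h, h,
    hπ.isUnivariate_comp _, hπ.not_blaschke_eq_const hc⟩

end IsCoordinate

theorem contDiff_evalEval (p : ℂ[X][Y]) {n : WithTop ℕ∞} :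
    ContDiff ℂ n fun x : ℂ × ℂ => p.evalEval x.1 x.2 := by
  induction p using Polynomial.induction_on' with
  | add p q hp hq => simpa only [evalEval_add] using hp.add hq
  | monomial k a =>
    have ha : ContDiff ℂ n fun z : ℂ => a.eval z := by
      simpa only [coe_aeval_eq_eval] using Polynomial.contDiff_aeval (𝕜 := ℂ) a n
    simp only [← C_mul_X_pow_eq_monomial, evalEval_mul, evalEval_pow, evalEval_C, evalEval_X]
    exact (ha.comp contDiff_fst).mul (contDiff_snd.pow k)

theorem differentiable_evalEval (p : ℂ[X][Y]) :
    Differentiable ℂ fun x : ℂ × ℂ => p.evalEval x.1 x.2 :=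
  (contDiff_evalEval p (n := 1)).differentiable one_ne_zero

variable {θ : ℂ × ℂ → ℂ} {p q : ℂ[X][Y]}

theorem IsCoordinate.hasUnivariateInnerFactor_of_evalEval_eq_mul {π : ℂ × ℂ → ℂ}
    (hπ : IsCoordinate π) (hθ : IsInner θ)
    (hpq : ∀ x ∈ bidisk, p.evalEval x.1 x.2 ≠ 0 ∧
      θ x = q.evalEval x.1 x.2 / p.evalEval x.1 x.2) {c : ℂ} (hc : ‖c‖ < 1) {q' : ℂ[X][Y]}
    (hq : ∀ x, q.evalEval x.1 x.2 = (π x - c) * q'.evalEval x.1 x.2) :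
    HasUnivariateInnerFactor θ := by
  refine hπ.hasUnivariateInnerFactor hθ hc
    (ψ := fun x => (1 - conj c * π x) * q'.evalEval x.1 x.2 / p.evalEval x.1 x.2) ?_ ?_
  · have hnum : Differentiable ℂ fun x : ℂ × ℂ => (1 - conj c * π x) * q'.evalEval x.1 x.2 :=
      ((hπ.differentiable.const_mul _).const_sub _).fun_mul (differentiable_evalEval q')
    simpa only [div_eq_mul_inv] using hnum.differentiableOn.fun_mul
      ((differentiable_evalEval p).differentiableOn.fun_inv fun x hx => (hpq x hx).1)
  · intro x hx
    have hden := one_sub_conj_mul_ne_zero hc (hπ.norm_lt_one hx).le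
    have hp := (hpq x hx).1
    rw [(hpq x hx).2, hq, blaschke, div_mul_div_comm, div_eq_div_iff hp (mul_ne_zero hden hp)]
    ring

theorem map_evalRingHom_ne_zero (hθ : IsInner θ) (hfactor : ¬HasUnivariateInnerFactor θ)
    (hpq : ∀ x ∈ bidisk, p.evalEval x.1 x.2 ≠ 0 ∧
      θ x = q.evalEval x.1 x.2 / p.evalEval x.1 x.2) {c : ℂ} (hc : ‖c‖ < 1) :
    q.map (evalRingHom c) ≠ 0 := by
  intro h
  have hdvd : C (X - C c) ∣ q := by
    rw [C_dvd_iff_dvd_coeff]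
    intro i
    rw [dvd_iff_isRoot, IsRoot.def, ← coe_evalRingHom, ← coeff_map, h, coeff_zero]
  obtain ⟨q', rfl⟩ := hdvd
  refine hfactor (IsCoordinate.hasUnivariateInnerFactor_of_evalEval_eq_mul (Or.inl rfl) hθ hpq hc
    (q' := q') fun x => ?_)
  rw [evalEval_mul, evalEval_C, eval_sub, eval_X, eval_C]

theorem eval_C_ne_zero_of_norm_lt (hθ : IsInner θ) (hfactor : ¬HasUnivariateInnerFactor θ)
    (hpq : ∀ x ∈ bidisk, p.evalEval x.1 x.2 ≠ 0 ∧
      θ x = q.evalEval x.1 x.2 / p.evalEval x.1 x.2) {w : ℂ} (hw : ‖w‖ < 1) :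
    q.eval (C w) ≠ 0 := by
  intro h
  obtain ⟨q', rfl⟩ := dvd_iff_isRoot.2 h
  refine hfactor (IsCoordinate.hasUnivariateInnerFactor_of_evalEval_eq_mul (Or.inr rfl) hθ hpq hw
    (q' := q') fun x => ?_)
  rw [evalEval_mul, evalEval_sub, evalEval_X, evalEval_C, eval_C]

theorem norm_evalEval_eq_on_torus (hθ : IsInner θ)
    (hpq : ∀ x ∈ bidisk, p.evalEval x.1 x.2 ≠ 0 ∧
      θ x = q.evalEval x.1 x.2 / p.evalEval x.1 x.2) (t : ℝ × ℝ) :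
    ‖q.evalEval (exp (t.1 * I)) (exp (t.2 * I))‖ =
      ‖p.evalEval (exp (t.1 * I)) (exp (t.2 * I))‖ := by
  have htorus : Continuous fun t : ℝ × ℝ => (exp (t.1 * I), exp (t.2 * I)) := by fun_prop
  have hcont := fun s : ℂ[X][Y] => ((differentiable_evalEval s).continuous.comp htorus).norm
  refine congrFun (((hcont q).ae_eq_iff_eq volume (hcont p)).1 ?_) t
  filter_upwards [hθ.unimodular] with t ⟨d, hd, hlim⟩
  have hradial := fun s : ℂ[X][Y] =>
    ((differentiable_evalEval s).continuous.tendsto _).comp (tendsto_radial_prod t)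
  have heq := tendsto_nhds_unique (hradial q) ((hlim.mul (hradial p)).congr'
    ((eventually_radial_mem_bidisk t).mono fun r hr => ?_))
  · simp only [Function.comp_apply, heq, norm_mul, hd, one_mul]
  · simp only [Function.comp_apply, (hpq _ hr).2, div_mul_cancel₀ _ (hpq _ hr).1]

theorem infinite_sphere : (sphere (0 : ℂ) 1).Infinite :=
  (isPreconnected_sphere (by rw [rank_real_complex]; exact Cardinal.one_lt_two) 0
    1).infinite_of_nontrivial ⟨1, by simp, -1, by simp, by norm_num⟩

theorem eval_C_ne_zero_of_norm_eq_one (hθ : IsInner θ) (hrel : IsRelPrime p q)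
    (hpq : ∀ x ∈ bidisk, p.evalEval x.1 x.2 ≠ 0 ∧
      θ x = q.evalEval x.1 x.2 / p.evalEval x.1 x.2) {w : ℂ} (hw : ‖w‖ = 1) :
    q.eval (C w) ≠ 0 := by
  intro hq
  have hp : p.eval (C w) = 0 := by
    refine eq_zero_of_infinite_isRoot _ (infinite_sphere.mono fun z hz => ?_)
    have hexp : ∀ u : ℂ, ‖u‖ = 1 → exp (u.arg * I) = u := fun u hu => by
      simpa only [hu, ofReal_one, one_mul] using norm_mul_exp_arg_mul_I u
    have hnorm := norm_evalEval_eq_on_torus hθ hpq (z.arg, w.arg)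
    rw [hexp z (mem_sphere_zero_iff_norm.1 hz), hexp w hw, evalEval, hq, eval_zero, norm_zero,
      eq_comm, norm_eq_zero] at hnorm
    exact hnorm
  exact not_isUnit_X_sub_C _ (hrel (dvd_iff_isRoot.2 hp) (dvd_iff_isRoot.2 hq))

end UnivariateFactors

section HausdorffDimension

open Metric

theorem dimH_image_le_of_locally {α β : Type*} [TopologicalSpace α] [SecondCountableTopology α]
    [EMetricSpace β] {f : α → β} {s : Set α} {d : ENNReal}
    (h : ∀ x ∈ s, ∃ N ∈ 𝓝 x, dimH (f '' (s ∩ N)) ≤ d) : dimH (f '' s) ≤ d := by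
  choose! N hN hdim using h
  obtain ⟨t, hts, htc, hcover⟩ := TopologicalSpace.countable_cover_nhdsWithin
    (f := N) (s := s) fun x hx => mem_nhdsWithin_of_mem_nhds (hN x hx)
  have hsub : f '' s ⊆ ⋃ x ∈ t, f '' (s ∩ N x) := by
    rintro _ ⟨y, hy, rfl⟩
    obtain ⟨x, hx, hyx⟩ := Set.mem_iUnion₂.1 (hcover hy)
    exact Set.mem_iUnion₂.2 ⟨x, hx, y, ⟨hy, hyx⟩, rfl⟩
  refine (dimH_mono hsub).trans ?_
  rw [dimH_bUnion htc]
  exact iSup₂_le fun x hx => hdim x (hts hx)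

theorem dimH_fst_image_le_dimH_snd_image {α β : Type*} [MetricSpace α] [MetricSpace β]
    {s : Set (α × β)} {K : NNReal}
    (h : ∀ x ∈ s, ∀ y ∈ s, dist x.1 y.1 ≤ K * dist x.2 y.2) :
    dimH (Prod.fst '' s) ≤ dimH (Prod.snd '' s) := by
  rcases s.eq_empty_or_nonempty with rfl | ⟨x₀, -⟩
  · rw [Set.image_empty, Set.image_empty, dimH_empty, dimH_empty]
  have : Nonempty α := ⟨x₀.1⟩
  have hex : ∀ w ∈ Prod.snd '' s, ∃ z, (z, w) ∈ s := by
    rintro _ ⟨y, hy, rfl⟩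
    exact ⟨y.1, hy⟩
  choose! φ hφ using hex
  have hlip : LipschitzOnWith K φ (Prod.snd '' s) :=
    LipschitzOnWith.of_dist_le_mul fun w hw w' hw' => h _ (hφ w hw) _ (hφ w' hw')
  have himage : Prod.fst '' s ⊆ φ '' (Prod.snd '' s) := by
    rintro _ ⟨y, hy, rfl⟩
    have hy2 : y.2 ∈ Prod.snd '' s := ⟨y, hy, rfl⟩
    refine ⟨y.2, hy2, dist_le_zero.1 ?_⟩
    simpa only [dist_self, mul_zero] using h _ (hφ _ hy2) _ hy
  exact (dimH_mono himage).trans hlip.dimH_image_le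

theorem exists_lipschitz_of_hasStrictFDerivAt {𝕜 : Type*} [NontriviallyNormedField 𝕜]
    {G : 𝕜 × 𝕜 → 𝕜} {L : 𝕜 × 𝕜 →L[𝕜] 𝕜} {x₀ : 𝕜 × 𝕜}
    (hG : HasStrictFDerivAt G L x₀) (hL : L (1, 0) ≠ 0) :
    ∃ N ∈ 𝓝 x₀, ∃ K : NNReal, ∀ x ∈ N, ∀ y ∈ N, G x = 0 → G y = 0 →
      dist x.1 y.1 ≤ K * dist x.2 y.2 := by
  have ha : 0 < ‖L (1, 0)‖ := norm_pos_iff.2 hL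
  have hsmall := hG.isLittleO.def (half_pos ha)
  rw [nhds_prod_eq] at hsmall
  obtain ⟨N, hN, hN'⟩ := eventually_prod_self_iff'.1 hsmall
  refine ⟨N, hN, Real.toNNReal ((‖L (0, 1)‖ + ‖L (1, 0)‖ / 2) / (‖L (1, 0)‖ / 2)),
    fun x hx y hy hGx hGy => ?_⟩
  rw [Real.coe_toNNReal _ (by positivity), div_mul_eq_mul_div, le_div_iff₀ (by positivity),
    dist_eq_norm, dist_eq_norm]
  have hLle := hN' x hx y hy
  simp only [hGx, hGy, sub_zero, zero_sub, norm_neg] at hLle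
  have hsum : ‖x - y‖ ≤ ‖x.1 - y.1‖ + ‖x.2 - y.2‖ :=
    max_le_add_of_nonneg (norm_nonneg _) (norm_nonneg _)
  have hfst : ‖x.1 - y.1‖ * ‖L (1, 0)‖ ≤ ‖L (x - y)‖ + ‖x.2 - y.2‖ * ‖L (0, 1)‖ := by
    have hsplit : (x.1 - y.1) • ((1, 0) : 𝕜 × 𝕜) = x - y - (x.2 - y.2) • (0, 1) := by
      ext <;> simp
    rw [← norm_smul, ← norm_smul, ← map_smul, ← map_smul, hsplit, map_sub]
    exact norm_sub_le _ _
  nlinarith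

theorem dimH_sphere_le_one : dimH (sphere (0 : ℂ) 1) ≤ 1 := by
  have hsub : sphere (0 : ℂ) 1 ⊆ Set.range fun τ : ℝ => Complex.exp (τ * Complex.I) :=
    fun w hw => ⟨w.arg, by
      simpa only [mem_sphere_zero_iff_norm.1 hw, Complex.ofReal_one, one_mul]
        using Complex.norm_mul_exp_arg_mul_I w⟩
  have hsmooth : ContDiff ℝ 1 fun τ : ℝ => Complex.exp (τ * Complex.I) :=
    (Complex.ofRealCLM.contDiff.mul contDiff_const).cexp
  refine (dimH_mono hsub).trans (hsmooth.dimH_range_le.trans_eq ?_)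
  rw [Module.finrank_self, Nat.cast_one]

end HausdorffDimension

section ToralZeros

open Complex Metric Polynomial

/-- The points `z` for which `q (z, ·)` has a zero on the unit circle. -/
def toralZeroProjection (q : ℂ[X][Y]) : Set ℂ := {z | ∃ w, ‖w‖ = 1 ∧ q.evalEval z w = 0}

theorem isClosed_toralZeroProjection (q : ℂ[X][Y]) : IsClosed (toralZeroProjection q) := by
  rw [← isOpen_compl_iff, isOpen_iff_eventually]
  intro z hz
  have hne : ∀ᶠ y in 𝓝 z, ∀ w ∈ sphere (0 : ℂ) 1, q.evalEval y w ≠ 0 :=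
    (isCompact_sphere (0 : ℂ) 1).eventually_forall_of_forall_eventually fun w hw =>
      (differentiable_evalEval q).continuous.continuousAt.eventually_ne
        fun h0 => hz ⟨w, mem_sphere_zero_iff_norm.1 hw, h0⟩
  filter_upwards [hne] with y hy
  rintro ⟨w, hw, h0⟩
  exact hy w (mem_sphere_zero_iff_norm.2 hw) h0

theorem exists_eval_C_eq_derivative (g : ℂ[X][Y]) :
    ∃ g' : ℂ[X][Y], ∀ w : ℂ, g'.eval (C w) = derivative (g.eval (C w)) := by
  induction g using Polynomial.induction_on' with
  | add p q hp hq =>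
    obtain ⟨p', hp⟩ := hp
    obtain ⟨q', hq⟩ := hq
    exact ⟨p' + q', fun w => by rw [eval_add, eval_add, hp, hq, derivative_add]⟩
  | monomial n a =>
    refine ⟨monomial n (derivative a), fun w => ?_⟩
    rw [eval_monomial, eval_monomial, ← C_pow, derivative_mul, derivative_C, mul_zero, add_zero]

theorem fderiv_evalEval_apply_one_zero (g : ℂ[X][Y]) (x : ℂ × ℂ) :
    fderiv ℂ (fun x : ℂ × ℂ => g.evalEval x.1 x.2) x (1, 0) =
      (derivative (g.eval (C x.2))).eval x.1 := by
  have hline : HasDerivAt (fun z : ℂ => (z, x.2)) ((1 : ℂ), (0 : ℂ)) x.1 :=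
    (hasDerivAt_id x.1).prodMk (hasDerivAt_const _ _)
  exact (((differentiable_evalEval g) x).hasFDerivAt.comp_hasDerivAt
    (f := fun z : ℂ => (z, x.2)) x.1 hline).unique ((g.eval (C x.2)).hasDerivAt x.1)

theorem dimH_fst_image_simple_zeros_le_one (g : ℂ[X][Y]) :
    dimH (Prod.fst '' {x : ℂ × ℂ | ‖x.2‖ = 1 ∧ g.evalEval x.1 x.2 = 0 ∧
      (derivative (g.eval (C x.2))).eval x.1 ≠ 0}) ≤ 1 := by
  refine dimH_image_le_of_locally fun x hx => ?_
  obtain ⟨N, hN, K, hK⟩ := exists_lipschitz_of_hasStrictFDerivAt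
    (((contDiff_evalEval g).contDiffAt (n := 1)).hasStrictFDerivAt one_ne_zero)
    (by rw [fderiv_evalEval_apply_one_zero g x]; exact hx.2.2)
  refine ⟨N, hN, (dimH_fst_image_le_dimH_snd_image fun y hy y' hy' =>
    hK y hy.2 y' hy'.2 hy.1.2.1 hy'.1.2.1).trans ((dimH_mono ?_).trans dimH_sphere_le_one)⟩
  rintro _ ⟨y, hy, rfl⟩
  exact mem_sphere_zero_iff_norm.2 hy.1.1

theorem exists_eval_C_eq_iterate_derivative (g : ℂ[X][Y]) (k : ℕ) :
    ∃ g' : ℂ[X][Y], ∀ w : ℂ, g'.eval (C w) = derivative^[k] (g.eval (C w)) := by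
  induction k with
  | zero => exact ⟨g, fun w => rfl⟩
  | succ k ih =>
    obtain ⟨g', hg'⟩ := ih
    obtain ⟨g'', hg''⟩ := exists_eval_C_eq_derivative g'
    exact ⟨g'', fun w => by rw [hg'', hg', Function.iterate_succ_apply']⟩

theorem exists_eval_iterate_derivative_eq_zero {P : ℂ[X]} (hP : P ≠ 0) {z : ℂ}
    (hz : P.eval z = 0) :
    ∃ k, (derivative^[k] P).eval z = 0 ∧ (derivative^[k + 1] P).eval z ≠ 0 := by
  by_contra! hstep
  have hzero : ∀ k, (derivative^[k] P).eval z = 0 := fun k => Nat.rec hz hstep k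
  refine hP (eq_zero_of_hasseDeriv_eq_zero _ z fun k => ?_)
  have hk := hzero k
  rw [← factorial_smul_hasseDeriv, LinearMap.smul_apply, eval_smul, nsmul_eq_mul] at hk
  exact (mul_eq_zero.1 hk).resolve_left (Nat.cast_ne_zero.2 k.factorial_ne_zero)

/-- A zero of order `k + 1` in `z` is a simple zero of the `k`-th derivative, and near such zeros
`z` is a Lipschitz function of the unimodular `w`. -/
theorem dimH_toralZeroProjection_le_one {q : ℂ[X][Y]}
    (h : ∀ w : ℂ, ‖w‖ = 1 → q.eval (C w) ≠ 0) : dimH (toralZeroProjection q) ≤ 1 := by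
  choose D hD using exists_eval_C_eq_iterate_derivative q
  have hcover : toralZeroProjection q ⊆ ⋃ k : ℕ, Prod.fst '' {x : ℂ × ℂ | ‖x.2‖ = 1 ∧
      (D k).evalEval x.1 x.2 = 0 ∧ (derivative ((D k).eval (C x.2))).eval x.1 ≠ 0} := by
    rintro z ⟨w, hw, h0⟩
    obtain ⟨k, hk, hk'⟩ := exists_eval_iterate_derivative_eq_zero (h w hw) h0
    refine Set.mem_iUnion.2 ⟨k, (z, w), ⟨hw, ?_, ?_⟩, rfl⟩
    · rw [evalEval, hD, hk]
    · rwa [hD, ← Function.iterate_succ_apply' (⇑derivative)]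
  refine (dimH_mono hcover).trans ?_
  rw [dimH_iUnion]
  exact iSup_le fun k => dimH_fst_image_simple_zeros_le_one (D k)

theorem dense_compl_toralZeroProjection {q : ℂ[X][Y]}
    (h : ∀ w : ℂ, ‖w‖ = 1 → q.eval (C w) ≠ 0) : Dense (toralZeroProjection q)ᶜ := by
  refine dense_compl_of_dimH_lt_finrank ((dimH_toralZeroProjection_le_one h).trans_lt ?_)
  rw [finrank_real_complex]
  norm_num

end ToralZeros

section SliceOperators

open Complex Metric Polynomial
open ContinuousLinearMap (adjoint)

/-- `θ = q / p` is an inner function such that no slice of `q` in `z` over the open disk and no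
slice in `w` over the closed disk vanishes identically. This is what the absence of univariate
inner factors provides. -/
structure IsRegularQuotient (θ : ℂ × ℂ → ℂ) (p q : ℂ[X][Y]) : Prop where
  isInner : IsInner θ
  eq_div : ∀ x ∈ bidisk, p.evalEval x.1 x.2 ≠ 0 ∧
    θ x = q.evalEval x.1 x.2 / p.evalEval x.1 x.2
  map_ne_zero : ∀ c : ℂ, ‖c‖ < 1 → q.map (evalRingHom c) ≠ 0
  eval_C_ne_zero : ∀ w : ℂ, ‖w‖ ≤ 1 → q.eval (C w) ≠ 0

/-- Multiplication by `θ` and by its slice `θ (c, ·)`, together with the evaluation at `z = c` and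
the difference quotient at `z = c`, which decompose `f` as `f (c, ·) + (z - c) * diffQuot f`. -/
structure SliceOperators (θ : ℂ × ℂ → ℂ) (c : ℂ) where
  mul : H2 →L[ℂ] H2
  mulSlice : H2 →L[ℂ] H2
  ev : H2 →L[ℂ] H2
  diffQuot : H2 →L[ℂ] H2
  toFun_mul : ∀ h : H2, ∀ x ∈ bidisk, (mul h).toFun x = θ x * h.toFun x
  toFun_mulSlice : ∀ h : H2, ∀ x ∈ bidisk, (mulSlice h).toFun x = θ (c, x.2) * h.toFun x
  toFun_ev : ∀ f : H2, ∀ x ∈ bidisk, (ev f).toFun x = f.toFun (c, x.2)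
  eq_ev_add : ∀ f, f = ev f + (Mz (diffQuot f) - c • diffQuot f)

variable {θ : ℂ × ℂ → ℂ} {p q : ℂ[X][Y]} {c : ℂ}

theorem IsInner.nonempty_sliceOperators (hθ : IsInner θ) (hc : ‖c‖ < 1) :
    Nonempty (SliceOperators θ c) := by
  obtain ⟨K, hK⟩ := hθ.bounded
  have hsep := sepHolo_of_differentiableOn hθ.holomorphic
  obtain ⟨mul, hmul⟩ := exists_mulOp hsep hK
  obtain ⟨mulSlice, hmulSlice⟩ := exists_mulOp (hsep.freeze (mem_ball_zero_iff.2 hc)) (C := K)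
    fun x hx => hK _ ⟨mem_ball_zero_iff.2 hc, hx.2⟩
  obtain ⟨ev, diffQuot, heq, hev⟩ := exists_evalOp hc
  exact ⟨⟨mul, mulSlice, ev, diffQuot, hmul, hmulSlice, hev, heq⟩⟩

theorem mk_mem_bidisk_of_mem (hc : ‖c‖ < 1) {x : ℂ × ℂ} (hx : x ∈ bidisk) : (c, x.2) ∈ bidisk :=
  ⟨mem_ball_zero_iff.2 hc, hx.2⟩

theorem toFun_Mz_sub_smul (c : ℂ) (h : H2) {x : ℂ × ℂ} (hx : x ∈ bidisk) :
    (Mz h - c • h).toFun x = (x.1 - c) * h.toFun x := by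
  rw [H2.toFun_sub _ _ hx, toFun_Mz, H2.toFun_smul, sub_mul]

namespace SliceOperators

variable (o : SliceOperators θ c)

theorem ev_mul (hc : ‖c‖ < 1) (h : H2) : o.ev (o.mul h) = o.mulSlice (o.ev h) :=
  H2.ext_toFun fun x hx => by
    rw [o.toFun_ev _ x hx, o.toFun_mul _ _ (mk_mem_bidisk_of_mem hc hx), o.toFun_mulSlice _ x hx,
      o.toFun_ev _ x hx]

theorem ev_mulSlice (hc : ‖c‖ < 1) (h : H2) : o.ev (o.mulSlice h) = o.mulSlice (o.ev h) :=
  H2.ext_toFun fun x hx => by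
    rw [o.toFun_ev _ x hx, o.toFun_mulSlice _ _ (mk_mem_bidisk_of_mem hc hx),
      o.toFun_mulSlice _ x hx, o.toFun_ev _ x hx]

theorem ev_Mz_sub_smul (hc : ‖c‖ < 1) (h : H2) : o.ev (Mz h - c • h) = 0 :=
  H2.ext_toFun fun x hx => by
    rw [o.toFun_ev _ x hx, toFun_Mz_sub_smul _ _ (mk_mem_bidisk_of_mem hc hx), sub_self, zero_mul,
      H2.toFun_zero]

theorem mul_Mz_sub_smul (h : H2) : o.mul (Mz h - c • h) = Mz (o.mul h) - c • o.mul h :=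
  H2.ext_toFun fun x hx => by
    rw [o.toFun_mul _ x hx, toFun_Mz_sub_smul _ _ hx, toFun_Mz_sub_smul _ _ hx, o.toFun_mul _ x hx]
    ring

theorem thetaH2_eq_range : thetaH2 θ = o.mul.range := by
  ext f
  constructor
  · rintro ⟨h, hh⟩
    exact ⟨h, H2.ext_toFun fun x hx => (o.toFun_mul h x hx).trans (hh x hx).symm⟩
  · rintro ⟨h, rfl⟩
    exact ⟨h, o.toFun_mul h⟩

theorem mem_thetaH2_iff (f : H2) : f ∈ thetaH2 θ ↔ ∃ h, o.mul h = f := by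
  rw [o.thetaH2_eq_range]
  rfl

end SliceOperators

theorem IsRegularQuotient.norm_le_norm_mul (hθ : IsRegularQuotient θ p q)
    (o : SliceOperators θ c) (h : H2) : ‖h‖ ≤ ‖o.mul h‖ := by
  simpa only [one_mul] using
    norm_le_of_mul_eq zero_le_one (hθ.isInner.sliceBoundedBelow hθ.eq_div) (o.toFun_mul h)

theorem IsRegularQuotient.orthogonal_quotientModule (hθ : IsRegularQuotient θ p q) :
    (quotientModule θ)ᗮ = thetaH2 θ := by
  obtain ⟨o⟩ := hθ.isInner.nonempty_sliceOperators (c := 0) (norm_zero.trans_lt one_pos)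
  have hanti : AntilipschitzWith 1 o.mul := o.mul.antilipschitz_of_bound fun h => by
    simpa only [NNReal.coe_one, one_mul] using hθ.norm_le_norm_mul o h
  have hclosed : IsClosed (o.mul.range : Set H2) := hanti.isClosed_range o.mul.uniformContinuous
  rw [quotientModule, Submodule.orthogonal_orthogonal_eq_closure, o.thetaH2_eq_range]
  exact hclosed.submodule_topologicalClosure_eq

theorem Mz_mem_thetaH2 {f : H2} (hf : f ∈ thetaH2 θ) : Mz f ∈ thetaH2 θ := by
  obtain ⟨h, hh⟩ := hf
  exact ⟨Mz h, fun x hx => by rw [toFun_Mz, toFun_Mz, hh x hx]; ring⟩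

theorem adjoint_Mz_mem_quotientModule {f : H2} (hf : f ∈ quotientModule θ) :
    adjoint Mz f ∈ quotientModule θ := by
  rw [quotientModule, Submodule.mem_orthogonal] at hf ⊢
  intro u hu
  rw [ContinuousLinearMap.adjoint_inner_right]
  exact hf _ (Mz_mem_thetaH2 hu)

theorem coe_adjoint_Sz (f : quotientModule θ) : (adjoint (Sz θ) f : H2) = adjoint Mz f := by
  suffices adjoint (Sz θ) f = ⟨adjoint Mz f, adjoint_Mz_mem_quotientModule f.2⟩ by rw [this]
  refine ext_inner_left ℂ fun g => ?_
  have hproj : ⟪Sz θ g, f⟫_ℂ = ⟪Mz (g : H2), (f : H2)⟫_ℂ :=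
    (quotientModule θ).inner_orthogonalProjectionOnto_eq_of_mem_right f (Mz (g : H2))
  rw [ContinuousLinearMap.adjoint_inner_right, hproj, ← ContinuousLinearMap.adjoint_inner_right,
    Submodule.coe_inner]

theorem mem_kernelBundle_adjoint_Sz_iff {d : ℂ} (f : quotientModule θ) :
    f ∈ kernelBundle (adjoint (Sz θ)) d ↔ adjoint Mz (f : H2) = d • (f : H2) := by
  rw [mem_kernelBundle_iff, ← coe_adjoint_Sz, ← Submodule.coe_smul, Subtype.coe_inj]

theorem inner_Mz_sub_smul_eq_zero {u : H2} (hu : adjoint Mz u = conj c • u) (h : H2) :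
    ⟪Mz h - c • h, u⟫_ℂ = 0 := by
  rw [inner_sub_left, ← ContinuousLinearMap.adjoint_inner_right, hu, inner_smul_right,
    inner_smul_left, sub_self]

namespace SliceOperators

variable (o : SliceOperators θ c)

theorem inner_ev_eq {u : H2} (hu : adjoint Mz u = conj c • u) (h : H2) :
    ⟪o.ev h, u⟫_ℂ = ⟪h, u⟫_ℂ := by
  conv_rhs => rw [o.eq_ev_add h, inner_add_left, inner_Mz_sub_smul_eq_zero hu, add_zero]

theorem inner_mulSlice_eq_zero (hc : ‖c‖ < 1) {u : H2} (huK : u ∈ quotientModule θ)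
    (hu : adjoint Mz u = conj c • u) (h : H2) : ⟪o.mulSlice h, u⟫_ℂ = 0 := by
  rw [← o.inner_ev_eq hu, o.ev_mulSlice hc, ← o.ev_mul hc, o.inner_ev_eq hu]
  exact huK _ ((o.mem_thetaH2_iff _).2 ⟨h, rfl⟩)

theorem adjoint_Mz_adjoint_ev (hc : ‖c‖ < 1) (v : H2) :
    adjoint Mz (adjoint o.ev v) = conj c • adjoint o.ev v := by
  refine ext_inner_left ℂ fun h => ?_
  rw [ContinuousLinearMap.adjoint_inner_right, inner_smul_right, ← inner_smul_left,
    ← sub_eq_zero, ← inner_sub_left, ContinuousLinearMap.adjoint_inner_right,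
    o.ev_Mz_sub_smul hc, inner_zero_left]

theorem adjoint_ev_mem_quotientModule (hc : ‖c‖ < 1) {v : H2}
    (hv : ∀ h, ⟪o.mulSlice h, v⟫_ℂ = 0) : adjoint o.ev v ∈ quotientModule θ := by
  rw [quotientModule, Submodule.mem_orthogonal]
  intro u hu
  obtain ⟨h, rfl⟩ := (o.mem_thetaH2_iff u).1 hu
  rw [ContinuousLinearMap.adjoint_inner_right, o.ev_mul hc, hv]

end SliceOperators

theorem eq_zero_of_mem_quotientModule_of_mem_thetaH2 {f : H2} (hK : f ∈ quotientModule θ)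
    (hθ : f ∈ thetaH2 θ) : f = 0 :=
  inner_self_eq_zero.1 (hK f hθ)

theorem coe_Sz_sub_apply (c : ℂ) (f : quotientModule θ) :
    ((Sz θ - c • ContinuousLinearMap.id ℂ (quotientModule θ)) f : H2) =
      (quotientModule θ).orthogonalProjectionOnto (Mz f - c • (f : H2)) := by
  rw [map_sub, map_smul, Submodule.orthogonalProjectionOnto_mem_subspace_eq_self]
  rfl

theorem IsRegularQuotient.sub_coe_Sz_sub_apply_mem_thetaH2 (hθ : IsRegularQuotient θ p q) (c : ℂ)
    (f : quotientModule θ) :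
    (Mz f - c • (f : H2)) - ((Sz θ - c • ContinuousLinearMap.id ℂ (quotientModule θ)) f : H2) ∈
      thetaH2 θ := by
  rw [coe_Sz_sub_apply]
  exact hθ.orthogonal_quotientModule.le ((quotientModule θ).sub_starProjection_mem_orthogonal _)

theorem eq_zero_of_Mz_eq_smul {f : H2} (h : Mz f = c • f) : f = 0 := by
  by_cases hc : c = 0
  · rw [← norm_eq_zero, ← norm_Mz, h, hc, zero_smul, norm_zero]
  have hcoeff : ∀ k, Mz f k = c * f k := fun k => by rw [h]; rfl
  ext ⟨m, n⟩
  change f (m, n) = 0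
  induction m with
  | zero =>
    have h0 := hcoeff (0, n)
    rw [Mz_apply_zero] at h0
    exact (mul_eq_zero.1 h0.symm).resolve_left hc
  | succ m ih =>
    have hm := hcoeff (m + 1, n)
    rw [Mz_apply_succ, ih] at hm
    exact (mul_eq_zero.1 hm.symm).resolve_left hc

theorem eq_zero_of_inner_Mz_sub_smul_self (hc : 1 ≤ ‖c‖) {f : H2}
    (h : ⟪Mz f - c • f, f⟫_ℂ = 0) : f = 0 := by
  have hpyth := norm_add_sq (𝕜 := ℂ) (Mz f - c • f) (c • f)
  rw [sub_add_cancel, inner_smul_right, h, mul_zero, map_zero, mul_zero, add_zero, norm_Mz,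
    norm_smul] at hpyth
  have hle : ‖f‖ ^ 2 ≤ (‖c‖ * ‖f‖) ^ 2 :=
    pow_le_pow_left₀ (norm_nonneg _) (le_mul_of_one_le_left (norm_nonneg _) hc) 2
  have hzero : ‖Mz f - c • f‖ ^ 2 = 0 := le_antisymm (by linarith) (sq_nonneg _)
  exact eq_zero_of_Mz_eq_smul (sub_eq_zero.1 (norm_eq_zero.1 (sq_eq_zero_iff.1 hzero)))

namespace IsRegularQuotient

theorem exists_slice_ne_zero (hθ : IsRegularQuotient θ p q) (hc : ‖c‖ < 1) :
    ∃ w ∈ ball (0 : ℂ) 1, θ (c, w) ≠ 0 := by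
  by_contra! hzero
  have hroot : ball (0 : ℂ) 1 ⊆ {w | (q.map (evalRingHom c)).IsRoot w} := fun w hw => by
    have hdiv := hθ.eq_div (c, w) ⟨mem_ball_zero_iff.2 hc, hw⟩
    rw [hzero w hw, eq_comm, div_eq_zero_iff] at hdiv
    change eval w _ = 0
    rw [map_evalRingHom_eval]
    exact hdiv.2.resolve_right hdiv.1
  exact hθ.map_ne_zero c hc (eq_zero_of_infinite_isRoot _
    ((infinite_of_mem_nhds (0 : ℂ) (ball_mem_nhds _ one_pos)).mono hroot))

theorem ev_eq_zero_of_mulSlice_eq_zero (hθ : IsRegularQuotient θ p q) (hc : ‖c‖ < 1)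
    (o : SliceOperators θ c) {h : H2} (hzero : o.mulSlice (o.ev h) = 0) : o.ev h = 0 := by
  have hcb : c ∈ ball (0 : ℂ) 1 := mem_ball_zero_iff.2 hc
  have hθc := ((sepHolo_of_differentiableOn hθ.isInner.holomorphic).right c hcb).analyticOnNhd
    isOpen_ball
  have hhc := (h.sepHolo.right c hcb).analyticOnNhd isOpen_ball
  have hmul : ∀ w ∈ ball (0 : ℂ) 1, θ (c, w) * h.toFun (c, w) = 0 := by
    intro w hw
    have hx : ((0 : ℂ), w) ∈ bidisk := ⟨mem_ball_self one_pos, hw⟩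
    have heq := o.toFun_mulSlice (o.ev h) _ hx
    rw [hzero, H2.toFun_zero, o.toFun_ev _ _ hx] at heq
    exact heq.symm
  rcases hθc.eq_zero_or_eq_zero_of_mul_eq_zero hhc hmul (convex_ball _ _).isPreconnected with
    hθ0 | hh0
  · obtain ⟨w, hw, hne⟩ := hθ.exists_slice_ne_zero hc
    exact absurd (hθ0 w hw) hne
  · exact H2.ext_toFun fun x hx => by rw [o.toFun_ev _ x hx, H2.toFun_zero, hh0 x.2 hx.2]

theorem eq_zero_of_Mz_sub_smul_mem_thetaH2 (hθ : IsRegularQuotient θ p q) (hc : ‖c‖ < 1) {f : H2}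
    (hK : f ∈ quotientModule θ) (hmem : Mz f - c • f ∈ thetaH2 θ) : f = 0 := by
  obtain ⟨o⟩ := hθ.isInner.nonempty_sliceOperators hc
  obtain ⟨h, hh⟩ := (o.mem_thetaH2_iff _).1 hmem
  have hev : o.ev h = 0 := hθ.ev_eq_zero_of_mulSlice_eq_zero hc o (by
    rw [← o.ev_mul hc, hh, o.ev_Mz_sub_smul hc])
  have hdq := o.eq_ev_add h
  rw [hev, zero_add] at hdq
  rw [hdq, o.mul_Mz_sub_smul] at hh
  have heig : Mz (f - o.mul (o.diffQuot h)) = c • (f - o.mul (o.diffQuot h)) := by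
    rw [map_sub, smul_sub, sub_eq_sub_iff_sub_eq_sub, hh]
  exact eq_zero_of_mem_quotientModule_of_mem_thetaH2 hK
    ((o.mem_thetaH2_iff _).2 ⟨_, (sub_eq_zero.1 (eq_zero_of_Mz_eq_smul heig)).symm⟩)

theorem injective_Sz_sub (hθ : IsRegularQuotient θ p q) (c : ℂ) :
    Function.Injective (Sz θ - c • ContinuousLinearMap.id ℂ (quotientModule θ)) := by
  rw [injective_iff_map_eq_zero]
  intro f hf
  have hmem := hθ.sub_coe_Sz_sub_apply_mem_thetaH2 c f
  rw [hf, Submodule.coe_zero, sub_zero] at hmem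
  rw [← Submodule.coe_eq_zero]
  rcases lt_or_ge ‖c‖ 1 with hc | hc
  · exact hθ.eq_zero_of_Mz_sub_smul_mem_thetaH2 hc f.2 hmem
  · exact eq_zero_of_inner_Mz_sub_smul_self hc (f.2 _ hmem)

end IsRegularQuotient

end SliceOperators

section Eigenvectors

open Complex Metric Polynomial
open ContinuousLinearMap (adjoint)

variable {θ : ℂ × ℂ → ℂ} {p q : ℂ[X][Y]} {c d : ℂ}

theorem apply_eq_pow_mul {f : H2} (hf : adjoint Mz f = d • f) (m n : ℕ) :
    f (m, n) = d ^ m * f (0, n) := by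
  induction m with
  | zero => rw [pow_zero, one_mul]
  | succ m ih =>
    rw [← adjoint_Mz_apply, hf]
    change d * f (m, n) = _
    rw [ih, pow_succ', mul_assoc]

theorem norm_lt_one_of_adjoint_Mz_eq {f : H2} (hf : adjoint Mz f = d • f) (hf0 : f ≠ 0) :
    ‖d‖ < 1 := by
  by_contra! hd
  refine hf0 ?_
  ext ⟨m, n⟩
  change f (m, n) = 0
  rw [apply_eq_pow_mul hf]
  refine mul_eq_zero_of_right _ ?_
  have hlim : Tendsto (fun m : ℕ => ‖f (m, n)‖ ^ 2) atTop (𝓝 0) :=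
    (f.hasSum_norm_sq.summable.comp_injective (Prod.mk_left_injective n)).tendsto_atTop_zero
  have hle : ‖f (0, n)‖ ^ 2 ≤ 0 := by
    refine ge_of_tendsto' hlim fun m => ?_
    rw [apply_eq_pow_mul hf m, norm_mul, norm_pow]
    exact pow_le_pow_left₀ (norm_nonneg _)
      (le_mul_of_one_le_left (norm_nonneg _) (one_le_pow₀ hd)) 2
  exact norm_eq_zero.1 (sq_eq_zero_iff.1 (le_antisymm hle (sq_nonneg _)))

theorem one_sub_mul_toFun {f : H2} (hf : adjoint Mz f = d • f) {x : ℂ × ℂ} (hx : x ∈ bidisk) :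
    (1 - d * x.1) * f.toFun x = f.toFun (0, x.2) := by
  have h := mul_toFun_adjoint_Mz f hx
  rw [hf, H2.toFun_smul] at h
  linear_combination -h

theorem exists_toFun_zero_ne_zero {f : H2} (hf : adjoint Mz f = d • f) (hf0 : f ≠ 0) :
    ∃ w ∈ ball (0 : ℂ) 1, f.toFun (0, w) ≠ 0 := by
  by_contra! hzero
  have hd := norm_lt_one_of_adjoint_Mz_eq hf hf0
  refine hf0 (H2.ext_toFun fun x hx => ?_)
  have hfx := one_sub_mul_toFun hf hx
  rw [hzero _ hx.2] at hfx
  rw [H2.toFun_zero]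
  refine (mul_eq_zero.1 hfx).resolve_left fun hone => ?_
  have hlt : ‖d * x.1‖ < 1 := by
    rw [norm_mul]
    exact mul_lt_one_of_nonneg_of_lt_one_left (norm_nonneg _) hd (mem_ball_zero_iff.1 hx.1).le
  rw [← sub_eq_zero.1 hone, norm_one] at hlt
  exact lt_irrefl _ hlt

/-- A polynomial in `w`, regarded as an element of `H²(𝔻²)`. -/
def polyW (s : ℂ[X]) : H2 := ∑ j ∈ s.support, lp.single 2 ((0 : ℕ), j) (s.coeff j)

theorem toFun_single (k : ℕ × ℕ) (a : ℂ) (x : ℂ × ℂ) :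
    H2.toFun (lp.single 2 k a) x = a * (x.1 ^ k.1 * x.2 ^ k.2) := by
  rw [H2.toFun, tsum_eq_single k]
  · rw [lp.single_apply_self]
  · intro j hj
    rw [lp.single_apply_ne _ _ _ hj, zero_mul]

theorem toFun_sum {ι : Type*} (t : Finset ι) (f : ι → H2) {x : ℂ × ℂ} (hx : x ∈ bidisk) :
    H2.toFun (∑ j ∈ t, f j) x = ∑ j ∈ t, (f j).toFun x := by
  classical
  induction t using Finset.induction_on with
  | empty => rw [Finset.sum_empty, Finset.sum_empty, H2.toFun_zero]
  | insert a t ha ih =>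
    rw [Finset.sum_insert ha, Finset.sum_insert ha, H2.toFun_add _ _ hx, ih]

theorem toFun_polyW (s : ℂ[X]) {x : ℂ × ℂ} (hx : x ∈ bidisk) :
    (polyW s).toFun x = s.eval x.2 := by
  rw [polyW, toFun_sum _ _ hx, eval_eq_sum, Polynomial.sum]
  refine Finset.sum_congr rfl fun j _ => ?_
  rw [toFun_single, pow_zero, one_mul]

theorem inner_polyW (s : ℂ[X]) (f : H2) :
    ⟪polyW s, f⟫_ℂ = ∑ j ∈ s.support, conj (s.coeff j) * f (0, j) := by
  rw [polyW, sum_inner]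
  refine Finset.sum_congr rfl fun j _ => ?_
  rw [lp.inner_single_left, RCLike.inner_apply, mul_comm]

theorem exists_norm_evalEval_le (r : ℂ[X][Y]) :
    ∃ M : ℝ, 0 < M ∧ ∀ z w : ℂ, ‖z‖ ≤ 1 → ‖w‖ ≤ 1 → ‖r.evalEval z w‖ ≤ M := by
  obtain ⟨M, hM⟩ := ((isCompact_closedBall (0 : ℂ) 1).prod
    (isCompact_closedBall (0 : ℂ) 1)).exists_bound_of_continuousOn
    (differentiable_evalEval r).continuous.continuousOn
  exact ⟨max M 1, lt_max_of_lt_right one_pos, fun z w hz hw => le_max_of_le_left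
    (hM (z, w) ⟨mem_closedBall_zero_iff.2 hz, mem_closedBall_zero_iff.2 hw⟩)⟩

/-- Multiplying by the denominator `p` shows that `q (c, w) w ^ k` is the slice at `z = c` of an
element of `θ H²`. -/
theorem IsRegularQuotient.inner_polyW_eq_zero (hθ : IsRegularQuotient θ p q) (hc : ‖c‖ < 1)
    {u : H2} (huK : u ∈ quotientModule θ) (hu : adjoint Mz u = conj c • u) (k : ℕ) :
    ⟪polyW (q.map (evalRingHom c) * X ^ k), u⟫_ℂ = 0 := by
  obtain ⟨o⟩ := hθ.isInner.nonempty_sliceOperators hc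
  obtain ⟨M, -, hM⟩ := exists_norm_evalEval_le p
  obtain ⟨mulP, hmulP⟩ := exists_mulOp
    (sepHolo_of_differentiableOn (differentiable_evalEval p).differentiableOn)
    (fun x hx => hM x.1 x.2 (mem_ball_zero_iff.1 hx.1).le (mem_ball_zero_iff.1 hx.2).le)
  have hev : o.ev (o.mul (mulP (polyW (X ^ k)))) = polyW (q.map (evalRingHom c) * X ^ k) := by
    refine H2.ext_toFun fun x hx => ?_
    have hx' := mk_mem_bidisk_of_mem hc hx
    have hdiv := hθ.eq_div _ hx'
    rw [o.toFun_ev _ x hx, o.toFun_mul _ _ hx', hmulP _ _ hx', toFun_polyW _ hx',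
      toFun_polyW _ hx, hdiv.2, eval_mul, map_evalRingHom_eval, ← mul_assoc,
      div_mul_cancel₀ _ hdiv.1]
  rw [← hev, o.inner_ev_eq hu]
  exact huK _ ((o.mem_thetaH2_iff _).2 ⟨_, rfl⟩)

theorem eq_zero_of_recurrence {s : ℂ[X]} (hs : s ≠ 0) {a : ℕ → ℂ}
    (hrec : ∀ k, ∑ j ∈ (s * X ^ k).support, conj ((s * X ^ k).coeff j) * a j = 0)
    (hinit : ∀ j < s.natDegree, a j = 0) (j : ℕ) : a j = 0 := by
  induction j using Nat.strong_induction_on with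
  | _ j ih =>
    rcases lt_or_ge j s.natDegree with hj | hj
    · exact hinit j hj
    obtain ⟨k, rfl⟩ := Nat.exists_eq_add_of_le hj
    have hdeg : (s * X ^ k).natDegree = s.natDegree + k := natDegree_mul_X_pow _ hs
    have hlead : (s * X ^ k).coeff (s.natDegree + k) ≠ 0 := by
      rw [coeff_mul_X_pow]
      exact leadingCoeff_ne_zero.2 hs
    have hk := hrec k
    rw [Finset.sum_eq_single (s.natDegree + k)] at hk
    · exact (mul_eq_zero.1 hk).resolve_left ((_root_.map_ne_zero _).2 hlead)
    · intro i hi hne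
      rw [ih i (lt_of_le_of_ne ((le_natDegree_of_mem_supp i hi).trans hdeg.le) hne), mul_zero]
    · exact fun hnot => absurd (mem_support_iff.2 hlead) hnot

namespace IsRegularQuotient

variable (hθ : IsRegularQuotient θ p q)
include hθ

theorem eq_zero_of_apply_zero_eq_zero (hc : ‖c‖ < 1) {u : H2} (huK : u ∈ quotientModule θ)
    (hu : adjoint Mz u = conj c • u)
    (h0 : ∀ j < (q.map (evalRingHom c)).natDegree, u (0, j) = 0) : u = 0 := by
  have hall : ∀ j, u (0, j) = 0 :=
    eq_zero_of_recurrence (a := fun j => u (0, j)) (hθ.map_ne_zero c hc)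
      (fun k => (inner_polyW _ u).symm.trans (hθ.inner_polyW_eq_zero hc huK hu k)) h0
  ext ⟨m, n⟩
  change u (m, n) = 0
  rw [apply_eq_pow_mul hu, hall, mul_zero]

theorem finiteDimensional_kernelBundle (d : ℂ) :
    FiniteDimensional ℂ (kernelBundle (adjoint (Sz θ)) d) := by
  let N := (q.map (evalRingHom (conj d))).natDegree
  let coeffs : kernelBundle (adjoint (Sz θ)) d →ₗ[ℂ] (Fin N → ℂ) :=
    { toFun := fun f j => ((f : quotientModule θ) : H2) (0, (j : ℕ))
      map_add' := fun _ _ => rfl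
      map_smul' := fun _ _ => rfl }
  refine Module.Finite.of_injective coeffs ((injective_iff_map_eq_zero coeffs).2 fun f hf => ?_)
  have heig := (mem_kernelBundle_adjoint_Sz_iff (f : quotientModule θ)).1 f.2
  by_contra hne
  have hne' : ((f : quotientModule θ) : H2) ≠ 0 := fun h => hne (Subtype.ext (Subtype.ext h))
  have hd := norm_lt_one_of_adjoint_Mz_eq heig hne'
  exact hne' (hθ.eq_zero_of_apply_zero_eq_zero (c := conj d) (by rwa [norm_conj])
    (f : quotientModule θ).2 (by rwa [conj_conj]) fun j hj => congrFun hf ⟨j, hj⟩)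

end IsRegularQuotient

end Eigenvectors

section ClosedRange

open Complex Metric Polynomial
open ContinuousLinearMap (adjoint)

theorem exists_le_norm_near_sphere {E F : Type*} [NormedAddCommGroup E] [NormedSpace ℝ E]
    [ProperSpace E] [Nontrivial E] [NormedAddCommGroup F] {g : E → F} (hg : Continuous g)
    (h : ∀ w, ‖w‖ = 1 → g w ≠ 0) :
    ∃ δ > 0, ∃ ρ < (1 : ℝ), ∀ w, ρ < ‖w‖ → ‖w‖ < 1 → δ ≤ ‖g w‖ := by
  obtain ⟨e, he, hmin⟩ := (isCompact_sphere (0 : E) 1).exists_isMinOn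
    (NormedSpace.sphere_nonempty.2 zero_le_one) hg.norm.continuousOn
  have hpos : 0 < ‖g e‖ := norm_pos_iff.2 (h e (mem_sphere_zero_iff_norm.1 he))
  have hopen : IsOpen {w | ‖g e‖ / 2 < ‖g w‖} := isOpen_lt continuous_const hg.norm
  obtain ⟨η, hη, hsub⟩ := (isCompact_sphere (0 : E) 1).exists_thickening_subset_open hopen
    fun w hw => (half_lt_self hpos).trans_le (hmin hw)
  refine ⟨‖g e‖ / 2, half_pos hpos, max (1 - η) 0, max_lt (by linarith) one_pos,
    fun w hw hw1 => le_of_lt (hsub ?_)⟩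
  have hw0 : 0 < ‖w‖ := (le_max_right _ _).trans_lt hw
  have hwη : 1 - η < ‖w‖ := (le_max_left _ _).trans_lt hw
  refine mem_thickening_iff.2 ⟨‖w‖⁻¹ • w, ?_, ?_⟩
  · rw [mem_sphere_zero_iff_norm, norm_smul, norm_inv, norm_norm, inv_mul_cancel₀ hw0.ne']
  · have hsmul : w - ‖w‖⁻¹ • w = (1 - ‖w‖⁻¹) • w := by rw [sub_smul, one_smul]
    have hinv : 1 ≤ ‖w‖⁻¹ := (one_le_inv₀ hw0).2 hw1.le
    rw [dist_eq_norm, hsmul, norm_smul, Real.norm_of_nonpos (by linarith), neg_sub, sub_mul,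
      one_mul, inv_mul_cancel₀ hw0.ne']
    linarith

theorem norm_le_norm_sub_of_inner_eq_zero {𝕜 E : Type*} [RCLike 𝕜] [NormedAddCommGroup E]
    [InnerProductSpace 𝕜 E] {x y : E} (h : inner 𝕜 x y = 0) : ‖x‖ ≤ ‖x - y‖ := by
  refine le_of_sq_le_sq ?_ (norm_nonneg _)
  rw [norm_sub_sq (𝕜 := 𝕜), h, map_zero, mul_zero, sub_zero]
  exact le_add_of_nonneg_right (sq_nonneg _)

variable {θ : ℂ × ℂ → ℂ} {p q : ℂ[X][Y]} {c : ℂ}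

theorem SliceOperators.Mz_sub_smul_sub_mul_diffQuot (o : SliceOperators θ c) {f h r : H2}
    (hh : o.mul h = Mz f - c • f - r) :
    Mz (f - o.mul (o.diffQuot h)) - c • (f - o.mul (o.diffQuot h)) = r + o.mul (o.ev h) := by
  have hmul : o.mul h =
      o.mul (o.ev h) + (Mz (o.mul (o.diffQuot h)) - c • o.mul (o.diffQuot h)) := by
    rw [← o.mul_Mz_sub_smul, ← map_add, ← o.eq_ev_add h]
  rw [hmul, eq_sub_iff_add_eq] at hh
  rw [map_sub, smul_sub, sub_sub_sub_comm, ← hh]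
  abel

theorem SliceOperators.norm_le_of_mul_eq_Mz_sub_smul_sub (o : SliceOperators θ c) (hc : ‖c‖ < 1)
    {K : NNReal} (hK : AntilipschitzWith K o.mulSlice) {f h r : H2} (hf : f ∈ quotientModule θ)
    (hh : o.mul h = Mz f - c • f - r) :
    (1 - ‖c‖) * ‖f‖ ≤ (1 + ‖o.mul‖ * (K * ‖o.ev‖)) * ‖r‖ := by
  have hslice : o.mulSlice (o.ev h) = -o.ev r := by
    rw [← o.ev_mul hc, hh, map_sub, o.ev_Mz_sub_smul hc, zero_sub]
  have hev : ‖o.ev h‖ ≤ K * (‖o.ev‖ * ‖r‖) := by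
    refine (hK.le_mul_norm (map_zero _) _).trans ?_
    rw [hslice, norm_neg]
    gcongr
    exact o.ev.le_opNorm _
  have hfg : ‖f‖ ≤ ‖f - o.mul (o.diffQuot h)‖ := norm_le_norm_sub_of_inner_eq_zero (𝕜 := ℂ)
    (inner_eq_zero_symm.1 (hf _ ((o.mem_thetaH2_iff _).2 ⟨_, rfl⟩)))
  calc (1 - ‖c‖) * ‖f‖ ≤ (1 - ‖c‖) * ‖f - o.mul (o.diffQuot h)‖ :=
        mul_le_mul_of_nonneg_left hfg (sub_pos.2 hc).le
    _ ≤ ‖r + o.mul (o.ev h)‖ := by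
      rw [← o.Mz_sub_smul_sub_mul_diffQuot hh]
      exact norm_Mz_sub_smul_ge c _
    _ ≤ ‖r‖ + ‖o.mul‖ * (K * (‖o.ev‖ * ‖r‖)) :=
      norm_add_le_of_le le_rfl ((o.mul.le_opNorm _).trans (by gcongr))
    _ = (1 + ‖o.mul‖ * (K * ‖o.ev‖)) * ‖r‖ := by ring

namespace IsRegularQuotient

variable (hθ : IsRegularQuotient θ p q) (hc : ‖c‖ < 1)
include hθ hc

theorem exists_sliceBoundedBelow (hcq : c ∉ toralZeroProjection q) :
    ∃ K : ℝ, 0 ≤ K ∧ SliceBoundedBelow (fun x => θ (c, x.2)) K := by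
  obtain ⟨δ, hδ, ρ, hρ, hq⟩ := exists_le_norm_near_sphere (g := fun w => q.evalEval c w)
    ((differentiable_evalEval q).continuous.comp (by fun_prop : Continuous fun w : ℂ => (c, w)))
    fun w hw h0 => hcq ⟨w, hw, h0⟩
  obtain ⟨M, hM0, hM⟩ := exists_norm_evalEval_le p
  refine ⟨M / δ, by positivity, Eventually.of_forall fun τ ε hε => ⟨ρ, hρ, fun t ht ht1 => ?_⟩⟩
  have hnorm : ‖t * exp (τ * I)‖ = ‖t‖ := by rw [norm_mul, norm_exp_ofReal_mul_I, mul_one]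
  generalize t * exp (τ * I) = w at hnorm ⊢
  rw [← hnorm] at ht ht1
  obtain ⟨hp, hdiv⟩ := hθ.eq_div (c, w) ⟨mem_ball_zero_iff.2 hc, mem_ball_zero_iff.2 ht1⟩
  have hle : δ / M ≤ ‖θ (c, w)‖ := by
    rw [hdiv, norm_div]
    exact div_le_div₀ (norm_nonneg _) (hq w ht ht1) (norm_pos_iff.2 hp) (hM c w hc.le ht1.le)
  calc (1 : ℝ) = M / δ * (δ / M) := by field_simp
    _ ≤ (M / δ + ε) * ‖θ (c, w)‖ := by gcongr; linarith

theorem exists_antilipschitzWith_mulSlice (hcq : c ∉ toralZeroProjection q)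
    (o : SliceOperators θ c) : ∃ K : NNReal, AntilipschitzWith K o.mulSlice := by
  obtain ⟨K, hK, hb⟩ := hθ.exists_sliceBoundedBelow hc hcq
  exact ⟨⟨K, hK⟩, o.mulSlice.antilipschitz_of_bound fun h =>
    norm_le_of_mul_eq (F := fun x => θ (c, x.2)) hK hb (o.toFun_mulSlice h)⟩

theorem exists_antilipschitzWith_Sz_sub (hcq : c ∉ toralZeroProjection q) :
    ∃ K : NNReal, AntilipschitzWith K (Sz θ - c • ContinuousLinearMap.id ℂ (quotientModule θ)) := by
  obtain ⟨o⟩ := hθ.isInner.nonempty_sliceOperators hc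
  obtain ⟨K, hK⟩ := hθ.exists_antilipschitzWith_mulSlice hc hcq o
  refine ⟨(1 - ‖c‖).toNNReal⁻¹ * (1 + ‖o.mul‖₊ * (K * ‖o.ev‖₊)),
    ContinuousLinearMap.antilipschitz_of_bound _ fun f => ?_⟩
  obtain ⟨h, hh⟩ := (o.mem_thetaH2_iff _).1 (hθ.sub_coe_Sz_sub_apply_mem_thetaH2 c f)
  have hbound := o.norm_le_of_mul_eq_Mz_sub_smul_sub hc hK f.2 hh
  rw [Submodule.coe_norm, Submodule.coe_norm, NNReal.coe_mul, NNReal.coe_inv,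
    Real.coe_toNNReal _ (sub_pos.2 hc).le, mul_assoc, le_inv_mul_iff₀ (sub_pos.2 hc)]
  exact hbound

theorem surjective_adjoint_Sz_sub (hcq : c ∉ toralZeroProjection q) :
    Function.Surjective
      (adjoint (Sz θ) - conj c • ContinuousLinearMap.id ℂ (quotientModule θ)) := by
  obtain ⟨K, hK⟩ := hθ.exists_antilipschitzWith_Sz_sub hc hcq
  rw [← adjoint_sub_smul_id]
  exact surjective_adjoint_of_antilipschitzWith hK

theorem exists_mulSlice_eq_ev (hcq : c ∉ toralZeroProjection q) (o : SliceOperators θ c)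
    {f : quotientModule θ}
    (hf : ∀ g ∈ kernelBundle (adjoint (Sz θ)) (conj c), ⟪g, f⟫_ℂ = 0) :
    ∃ g, o.mulSlice g = o.ev f := by
  obtain ⟨K, hK⟩ := hθ.exists_antilipschitzWith_mulSlice hc hcq o
  have hclosed : IsClosed (o.mulSlice.range : Set H2) :=
    hK.isClosed_range o.mulSlice.uniformContinuous
  suffices o.ev f ∈ (o.mulSlice.range)ᗮᗮ by
    rwa [Submodule.orthogonal_orthogonal_eq_closure,
      hclosed.submodule_topologicalClosure_eq] at this
  rw [Submodule.mem_orthogonal]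
  intro v hv
  have hmem := o.adjoint_ev_mem_quotientModule hc fun h => hv _ ⟨h, rfl⟩
  have horth := hf ⟨_, hmem⟩
    ((mem_kernelBundle_adjoint_Sz_iff _).2 (o.adjoint_Mz_adjoint_ev hc v))
  rw [Submodule.coe_inner] at horth
  rwa [← ContinuousLinearMap.adjoint_inner_left]

end IsRegularQuotient

end ClosedRange

section RationalInner

open Complex Metric Polynomial
open ContinuousLinearMap (adjoint)

variable {θ : ℂ × ℂ → ℂ} {p q : ℂ[X][Y]} {c d : ℂ}

namespace IsRegularQuotient

variable (hθ : IsRegularQuotient θ p q)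
include hθ

theorem dense_compl_toralZeroProjection : Dense (toralZeroProjection q)ᶜ :=
  Bidisk.dense_compl_toralZeroProjection fun w hw => hθ.eval_C_ne_zero w hw.le

theorem exists_eq_slice_mul {f : quotientModule θ} (hc : ‖c‖ < 1)
    (hcq : c ∉ toralZeroProjection q)
    (hf : ∀ g ∈ kernelBundle (adjoint (Sz θ)) (conj c), ⟪g, f⟫_ℂ = 0) :
    ∃ g : ℂ → ℂ, DifferentiableOn ℂ g (ball 0 1) ∧
      ∀ w ∈ ball (0 : ℂ) 1, (f : H2).toFun (c, w) = θ (c, w) * g w := by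
  have hcb : c ∈ ball (0 : ℂ) 1 := mem_ball_zero_iff.2 hc
  obtain ⟨o⟩ := hθ.isInner.nonempty_sliceOperators hc
  obtain ⟨g, hg⟩ := hθ.exists_mulSlice_eq_ev hc hcq o hf
  refine ⟨fun w => g.toFun (c, w), g.sepHolo.right c hcb, fun w hw => ?_⟩
  have hx : (c, w) ∈ bidisk := ⟨hcb, hw⟩
  rw [← o.toFun_mulSlice g _ hx, hg, o.toFun_ev _ _ hx]

theorem eq_zero_of_forall_inner_kernelBundle {f : quotientModule θ}
    (hf : ∀ c : ℂ, ‖c‖ < 1 → c ∉ toralZeroProjection q →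
      ∀ g ∈ kernelBundle (adjoint (Sz θ)) (conj c), ⟪g, f⟫_ℂ = 0) : f = 0 := by
  have hdvd : DenselyDivides θ (f : H2).toFun (toralZeroProjection q)ᶜ :=
    { divisor := sepHolo_of_differentiableOn hθ.isInner.holomorphic
      dividend := (f : H2).sepHolo
      exists_ne_zero := fun z hz => hθ.exists_slice_ne_zero (mem_ball_zero_iff.1 hz)
      subset_closure := by
        rw [hθ.dense_compl_toralZeroProjection.closure_eq]
        exact Set.subset_univ _
      exists_eq_mul := fun z ⟨hzq, hz⟩ =>
        have hz1 := mem_ball_zero_iff.1 hz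
        hθ.exists_eq_slice_mul hz1 hzq (hf z hz1 hzq) }
  obtain ⟨b, hb, hbf⟩ := hdvd.exists_powerSum_mul_eq
  obtain ⟨h, hh, -⟩ := exists_H2_of_mul_eq zero_le_one
    (hθ.isInner.sliceBoundedBelow hθ.eq_div) hb f hbf
  refine Subtype.ext (eq_zero_of_mem_quotientModule_of_mem_thetaH2 f.2 ⟨h, fun x hx => ?_⟩)
  rw [← hbf x hx, toFun_eq_powerSum h, hh]

theorem surjective_mulSlice (hc : ‖c‖ < 1) (hcq : c ∉ toralZeroProjection q)
    (o : SliceOperators θ c) (hne : ∀ w ∈ ball (0 : ℂ) 1, θ (c, w) ≠ 0) :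
    Function.Surjective o.mulSlice := by
  intro u
  obtain ⟨K, hK, hb⟩ := hθ.exists_sliceBoundedBelow hc hcq
  have hinv : SepHolo fun x : ℂ × ℂ => (θ (c, x.2))⁻¹ := by
    have hs := (sepHolo_of_differentiableOn hθ.isInner.holomorphic).freeze
      (mem_ball_zero_iff.2 hc)
    exact ⟨hs.cont.inv₀ fun x hx => hne _ hx.2,
      fun w hw => (hs.left w hw).fun_inv fun z _ => hne _ hw,
      fun z hz => (hs.right z hz).fun_inv fun w hw => hne _ hw⟩
  obtain ⟨b, hbc, hbf⟩ := (hinv.mul u.sepHolo).exists_powerSum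
  have hmul : ∀ x ∈ bidisk, θ (c, x.2) * powerSum b x = u.toFun x := fun x hx => by
    rw [hbf x hx, mul_inv_cancel_left₀ (hne _ hx.2)]
  obtain ⟨h, hh, -⟩ := exists_H2_of_mul_eq (F := fun x => θ (c, x.2)) hK hb hbc u hmul
  refine ⟨h, H2.ext_toFun fun x hx => ?_⟩
  rw [o.toFun_mulSlice _ x hx, toFun_eq_powerSum h, hh, hmul x hx]

theorem exists_slice_eq_zero (hc : ‖c‖ < 1) (hcq : c ∉ toralZeroProjection q)
    (hker : kernelBundle (adjoint (Sz θ)) (conj c) ≠ ⊥) :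
    ∃ w ∈ ball (0 : ℂ) 1, θ (c, w) = 0 := by
  by_contra! hne
  obtain ⟨o⟩ := hθ.isInner.nonempty_sliceOperators hc
  obtain ⟨u, hu, hu0⟩ := (Submodule.ne_bot_iff _).1 hker
  obtain ⟨h, hh⟩ := hθ.surjective_mulSlice hc hcq o hne u
  have horth := o.inner_mulSlice_eq_zero hc u.2 ((mem_kernelBundle_adjoint_Sz_iff u).1 hu) h
  rw [hh] at horth
  exact hu0 (Subtype.ext (inner_self_eq_zero.1 horth))

theorem exists_common_zero {f : quotientModule θ} (hf : f ∈ kernelBundle (adjoint (Sz θ)) d)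
    (hc : ‖c‖ < 1) (hcq : c ∉ toralZeroProjection q)
    (hker : kernelBundle (adjoint (Sz θ)) (conj c) ≠ ⊥)
    (horth : ∀ g ∈ kernelBundle (adjoint (Sz θ)) (conj c), ⟪g, f⟫_ℂ = 0) :
    ∃ w ∈ ball (0 : ℂ) 1, (f : H2).toFun (0, w) = 0 ∧ (q.eval (C w)).IsRoot c := by
  obtain ⟨w, hw, hw0⟩ := hθ.exists_slice_eq_zero hc hcq hker
  have hx : (c, w) ∈ bidisk := ⟨mem_ball_zero_iff.2 hc, hw⟩
  refine ⟨w, hw, ?_, ?_⟩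
  · obtain ⟨g, -, hg⟩ := hθ.exists_eq_slice_mul hc hcq horth
    rw [← one_sub_mul_toFun ((mem_kernelBundle_adjoint_Sz_iff f).1 hf) hx, hg w hw, hw0, zero_mul,
      mul_zero]
  · have hdiv := hθ.eq_div (c, w) hx
    rw [hw0, eq_comm, div_eq_zero_iff] at hdiv
    exact hdiv.2.resolve_right hdiv.1

theorem not_countable_inter_compl_toralZeroProjection {V : Set ℂ} (hV : IsOpen V)
    (hne : V.Nonempty) : ¬(V ∩ (toralZeroProjection q)ᶜ).Countable := by
  intro hcount
  obtain ⟨z, hz⟩ := (hcount.dense_compl ℝ).inter_open_nonempty _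
    (hV.inter (isClosed_toralZeroProjection q).isOpen_compl)
    (hθ.dense_compl_toralZeroProjection.inter_open_nonempty V hV hne)
  exact hz.2 hz.1

theorem eq_zero_of_inner_eq_zero_on_open {V : Set ℂ} (hV : IsOpen V) (hVne : V.Nonempty)
    (hV1 : ∀ c ∈ V, ‖c‖ < 1) (hker : ∀ c ∈ V, kernelBundle (adjoint (Sz θ)) (conj c) ≠ ⊥)
    {f : quotientModule θ} (hf : f ∈ kernelBundle (adjoint (Sz θ)) d)
    (horth : ∀ c ∈ V, ∀ g ∈ kernelBundle (adjoint (Sz θ)) (conj c), ⟪g, f⟫_ℂ = 0) : f = 0 := by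
  by_contra hf0
  have hzeros : {w ∈ ball (0 : ℂ) 1 | (f : H2).toFun (0, w) = 0}.Countable :=
    countable_zeros ((f : H2).sepHolo.right 0 (mem_ball_self one_pos)) isOpen_ball
      (convex_ball _ _).isPreconnected
      (exists_toFun_zero_ne_zero ((mem_kernelBundle_adjoint_Sz_iff f).1 hf)
        fun h => hf0 (Subtype.ext h))
  have hroots : ∀ w ∈ {w ∈ ball (0 : ℂ) 1 | (f : H2).toFun (0, w) = 0},
      {z | (q.eval (C w)).IsRoot z}.Countable := fun w hw =>
    (finite_setOfPred_isRoot (hθ.eval_C_ne_zero w (mem_ball_zero_iff.1 hw.1).le)).countable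
  refine hθ.not_countable_inter_compl_toralZeroProjection hV hVne
    ((hzeros.biUnion hroots).mono fun z ⟨hzV, hzq⟩ => ?_)
  obtain ⟨w, hw, hfw, hroot⟩ :=
    hθ.exists_common_zero hf (hV1 z hzV) hzq (hker z hzV) (horth z hzV)
  exact Set.mem_biUnion (show w ∈ {w ∈ ball (0 : ℂ) 1 | _} from ⟨hw, hfw⟩) hroot

theorem mem_baseSet_iff : c ∈ baseSet θ ↔
    Function.Surjective (adjoint (Sz θ) - c • ContinuousLinearMap.id ℂ (quotientModule θ)) ∧
      kernelBundle (adjoint (Sz θ)) c ≠ ⊥ :=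
  mem_conj_image_spectrum_diff_essentialSpectrum_iff hθ.injective_Sz_sub
    hθ.finiteDimensional_kernelBundle

theorem norm_lt_one_of_mem_baseSet (hc : c ∈ baseSet θ) : ‖c‖ < 1 := by
  obtain ⟨u, hu, hu0⟩ := (Submodule.ne_bot_iff _).1 (hθ.mem_baseSet_iff.1 hc).2
  exact norm_lt_one_of_adjoint_Mz_eq ((mem_kernelBundle_adjoint_Sz_iff u).1 hu)
    fun h => hu0 (Subtype.ext h)

theorem bundleSpan_baseSet : bundleSpan (baseSet θ) (kernelBundle (adjoint (Sz θ))) = ⊤ := by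
  rw [bundleSpan, Submodule.topologicalClosure_eq_top_iff, eq_bot_iff]
  intro f hf
  refine hθ.eq_zero_of_forall_inner_kernelBundle fun c hc hcq g hg => ?_
  by_cases hbot : kernelBundle (adjoint (Sz θ)) (conj c) = ⊥
  · rw [hbot, Submodule.mem_bot] at hg
    rw [hg, inner_zero_left]
  · exact hf g (le_biSup (kernelBundle (adjoint (Sz θ)))
      (hθ.mem_baseSet_iff.2 ⟨hθ.surjective_adjoint_Sz_sub hc hcq, hbot⟩) hg)

theorem isGeneralizedCowenDouglas_adjoint_Sz :
    IsGeneralizedCowenDouglas (baseSet θ) (adjoint (Sz θ)) :=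
  isGeneralizedCowenDouglas_adjoint hθ.injective_Sz_sub hθ.finiteDimensional_kernelBundle
    hθ.bundleSpan_baseSet

theorem eq_zero_of_inner_eq_zero_on_component {c₀ : ℂ} (hc₀ : c₀ ∈ baseSet θ)
    {f : quotientModule θ} (hf : f ∈ kernelBundle (adjoint (Sz θ)) d)
    (horth : ∀ c ∈ connectedComponentIn (baseSet θ) c₀,
      ∀ g ∈ kernelBundle (adjoint (Sz θ)) c, ⟪g, f⟫_ℂ = 0) : f = 0 := by
  have hsub := connectedComponentIn_subset (baseSet θ) c₀
  have hopen : IsOpen (connectedComponentIn (baseSet θ) c₀) :=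
    hθ.isGeneralizedCowenDouglas_adjoint_Sz.isOpen.connectedComponentIn
  refine hθ.eq_zero_of_inner_eq_zero_on_open
    (V := (fun c => conj c) ⁻¹' connectedComponentIn (baseSet θ) c₀)
    (hopen.preimage continuous_conj) ⟨conj c₀, ?_⟩ (fun c hc => ?_)
    (fun c hc => (hθ.mem_baseSet_iff.1 (hsub hc)).2) hf fun c hc => horth _ hc
  · rw [Set.mem_preimage, conj_conj]
    exact mem_connectedComponentIn hc₀
  · rw [← norm_conj]
    exact hθ.norm_lt_one_of_mem_baseSet (hsub hc)

theorem isReducible_Sz_iff : IsReducible (Sz θ) ↔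
    KernelBundleStrictlyReducible (baseSet θ) (adjoint (Sz θ)) :=
  isReducible_iff_kernelBundleStrictlyReducible_adjoint hθ.isGeneralizedCowenDouglas_adjoint_Sz
    fun _ hc₀ _ _ _ hf horth => hθ.eq_zero_of_inner_eq_zero_on_component hc₀ hf horth

end IsRegularQuotient

theorem exists_isRelPrime_eq_div
    (hpq : ∀ x ∈ bidisk, p.evalEval x.1 x.2 ≠ 0 ∧
      θ x = q.evalEval x.1 x.2 / p.evalEval x.1 x.2) :
    ∃ p' q' : ℂ[X][Y], IsRelPrime p' q' ∧ ∀ x ∈ bidisk, p'.evalEval x.1 x.2 ≠ 0 ∧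
      θ x = q'.evalEval x.1 x.2 / p'.evalEval x.1 x.2 := by
  have hp0 : p ≠ 0 := by
    rintro rfl
    exact (hpq (0, 0) ⟨mem_ball_self one_pos, mem_ball_self one_pos⟩).1 (evalEval_zero _ _)
  obtain ⟨p', q', r, hrel, hp, hq⟩ := UniqueFactorizationMonoid.exists_reduced_factors p hp0 q
  refine ⟨p', q', hrel, fun x hx => ?_⟩
  obtain ⟨hne, hdiv⟩ := hpq x hx
  rw [← hp, evalEval_mul] at hne
  refine ⟨right_ne_zero_of_mul hne, ?_⟩
  rw [hdiv, ← hp, ← hq, evalEval_mul, evalEval_mul, mul_div_mul_left _ _ (left_ne_zero_of_mul hne)]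

theorem exists_isRegularQuotient (hθ : IsRationalInner θ)
    (hfactor : ¬HasUnivariateInnerFactor θ) : ∃ p q, IsRegularQuotient θ p q := by
  obtain ⟨hinner, p₀, q₀, hpq₀⟩ := hθ
  obtain ⟨p, q, hrel, hpq⟩ := exists_isRelPrime_eq_div hpq₀
  refine ⟨p, q, hinner, hpq, fun c hc => map_evalRingHom_ne_zero hinner hfactor hpq hc,
    fun w hw => ?_⟩
  rcases hw.lt_or_eq with hw | hw
  · exact eval_C_ne_zero_of_norm_lt hinner hfactor hpq hw
  · exact eval_C_ne_zero_of_norm_eq_one hinner hrel hpq hw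

end RationalInner

end Bidisk

end

theorem mainTheorem2 (θ : ℂ × ℂ → ℂ) (hθ : Bidisk.IsRationalInner θ)
    (hfactor : ¬ Bidisk.HasUnivariateInnerFactor θ) :
    Bidisk.IsGeneralizedCowenDouglas (Bidisk.baseSet θ)
        (ContinuousLinearMap.adjoint (Bidisk.Sz θ)) ∧
      (Bidisk.IsReducible (Bidisk.Sz θ) ↔
        Bidisk.KernelBundleStrictlyReducible (Bidisk.baseSet θ)
          (ContinuousLinearMap.adjoint (Bidisk.Sz θ))) := by
  obtain ⟨p, q, hpq⟩ := Bidisk.exists_isRegularQuotient hθ hfactor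
  exact ⟨hpq.isGeneralizedCowenDouglas_adjoint_Sz, hpq.isReducible_Sz_iff⟩
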